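/- **Setting.** Let $n\ge 1$, $p_1,p_2,q_1,q_2\ge 0$, $p=p_1+p_2$. Let $X_t=(X_{1,t},X_{2,t})\in\mathbb R^{p_1}\times\mathbb R^{p_2}$, $t=1,\dots,n$, satisfy $X_{t+1}=A_tX_t+B_tW_{t+1}$ for $t=1,\dots,n-1$, with nonrandom matrices $A_t\in\mathbb R^{p\times p}$, $B_t\in\mathbb R^{p\times(q_1+q_2)}$, where $X_1\sim N(0,Q_{X_1})$, $W_t\sim N(0,Q_{W_t})$ ($t=2,\dots,n$), $Q_{X_1},Q_{W_t}\succeq0$, and $X_1,W_2,\dots,W_n$ are independent. Write $X^t=(X_1,\dots,X_t)$, $Y^t=(Y_1,\dots,Y_t)$ ($Y^0$ is empty) and $Y_t=(Y_{1,t},Y_{2,t})\in\mathbb R^{p_1}\times\mathbb R^{p_2}$. For $\Delta_1,\Delta_2\ge 0$ let $\mathcal Q(\Delta_1,\Delta_2)$ be the set of all joint laws of $(X^n,Y^n)$ which have the given law of $X^n$ as marginal, satisfy the causality condition $\mathbf P_{Y^t|X^n}=\mathbf P_{Y^t|X^t}$, $t=1,\dots,n-1$, and satisfy $\mathbf E\{\frac1n\sum_{t=1}^n\|X_{i,t}-Y_{i,t}\|^2\}\le\Delta_i$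 for $i=1,2$. The joint nonanticipative rate distortion function is $$R_{X^n}(\Delta_1,\Delta_2)=\inf_{\mathcal Q(\Delta_1,\Delta_2)}\ \sum_{t=1}^n I(X^t;Y_t|Y^{t-1})\in[0,\infty].$$ Put $\widehat X_{t|s}=\mathbf E\{X_t|Y^s\}=(\widehat X_{1,t|s},\widehat X_{2,t|s})$, with the convention $\widehat X_{0|0}=0$ (so that $A_0$ plays no role). For conditional covariances, $\mathrm{cov}(U,V|Y^{s})=\mathbf E\{(U-\mathbf E\{U|Y^s\})(V-\mathbf E\{V|Y^s\})^{\mathsf T}|Y^s\}$. $\dagger$ denotes the Moore–Penrose pseudoinverse. Equalities between random variables and between conditional laws hold almost surely. A *realization* with parameters $(H_t,Q_{V_t})_{t=1}^n$, $H_t\in\mathbb R^{p\times p}$ nonrandom, $Q_{V_t}\succeq 0$, is a process $$Y_t=H_tX_t+g_t(Y^{t-1})+V_t,\qquad g_t(Y^{t-1})=\widehat X_{t|t-1}-H_t\widehat X_{t|t-1},\qquad t=1,\dots,n,$$ where $V_t\sim N(0,Q_{V_t})$, and $V_1,\dots,V_n$ are independent of one another and jointly independent of $(X_1,W_2,\dots,W_n)$.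 **Theorem.** (a) There is an element of $\mathcal Q(\Delta_1,\Delta_2)$ which attains the infimum $R_{X^n}(\Delta_1,\Delta_2)$, is jointly Gaussian, and is the law of $(X^n,Y^n)$ for a realization $Y$ with suitable parameters $(H_t,Q_{V_t})$. Moreover, every realization has the following properties, for each $t=1,\dots,n$. The law of $(X^t,Y^t)$ is Gaussian, $Y_t=H_tX_t+(I-H_t)\widehat X_{t|t-1}+V_t$, and $\widehat X_{t|t-1}=A_{t-1}\widehat X_{t-1|t-1}$. (i) The conditional law of $Y_t$ given $(Y^{t-1},X_t)$ is $Q_t(\cdot\,|\,\widehat X_{t-1|t-1},X_t)$, where $Q_t(\cdot\,|\,\widehat x,x)=N\big(H_tx+(I-H_t)A_{t-1}\widehat x,\;Q_{V_t}\big)$. (ii) In $[0,\infty]$, $$\begin{aligned} I(X^t;Y_t|Y^{t-1})&=I(X_t;Y_t|Y^{t-1})=I(X_t;Y_t|Y^{t-1},\widehat X_{t-1|t-1})\\&=I(X_t;Y_t,\widehat X_{t|t}|Y^{t-1},\widehat X_{t|t-1})\\&=I(X_t;Y_t|Y^{t-1},\widehat X_{t-1|t-1},\widehat X_{t|t})+I(X_t;\widehat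 X_{t|t}|Y^{t-1},\widehat X_{t-1|t-1})\\&\ge I(X_t;\widehat X_{t|t}|Y^{t-1},\widehat X_{t|t-1}),\end{aligned}$$ and equality holds in the inequality if $$\widehat X_{i,t|t}=\mathbf E\{X_{i,t}|Y^t\}=Y_{i,t},\quad i=1,2.\tag{1}$$ (b) For every realization and each $t=1,\dots,n$, $$\widehat X_{t|t}=\widehat X_{t|t-1}+\mathrm{cov}(X_t,Y_t|Y^{t-1})\,\mathrm{cov}(Y_t,Y_t|Y^{t-1})^{\dagger}\big(Y_t-\mathbf E\{Y_t|Y^{t-1}\}\big),\tag{2}$$ and (1) holds at time $t$ whenever the right-hand side of (2) equals $Y_t$. If $\mathrm{cov}(Y_t,Y_t|Y^{t-1})$ is invertible, $\mathrm{cov}(X_t,Y_t|Y^{t-1})=\mathrm{cov}(Y_t,Y_t|Y^{t-1})$ and $\mathbf E\{X_t|Y^{t-1}\}=\mathbf E\{Y_t|Y^{t-1}\}$, then (2) holds and its right-hand side equals $Y_t$, so (1) holds. -/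

import Mathlib

open MeasureTheory ProbabilityTheory Matrix
open scoped ENNReal NNReal

namespace JointNRDF

/-! ### Moore–Penrose pseudoinverse of a real matrix -/

/-- The four Penrose equations: `P` is the pseudoinverse of `A`. -/
structure IsMoorePenrose {ι κ : Type*} [Fintype ι] [Fintype κ]
    (A : Matrix ι κ ℝ) (P : Matrix κ ι ℝ) : Prop where
  mul_mul_left : A * P * A = A
  mul_mul_right : P * A * P = P
  symm_left : (A * P)ᵀ = A * P
  symm_right : (P * A)ᵀ = P * A

theorem exists_isMoorePenrose {ι κ : Type*} [Fintype ι] [Fintype κ] [DecidableEq κ]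
    (A : Matrix ι κ ℝ) : ∃ P, IsMoorePenrose A P := by
  set S : Matrix κ κ ℝ := Aᵀ * A with hS
  have hSA : IsSelfAdjoint S := by
    rw [hS, isSelfAdjoint_iff, star_eq_conjTranspose, conjTranspose_eq_transpose_of_trivial]
    simp
  have hc : ∀ f : ℝ → ℝ, ContinuousOn f (spectrum ℝ S) := fun f =>
    (Matrix.finite_real_spectrum (A := S)).continuousOn f
  set G : Matrix κ κ ℝ := cfc (fun x : ℝ => x⁻¹) S with hG
  have hid : cfc (fun x : ℝ => x) S = S := cfc_id' ℝ S
  have hmul : ∀ f g : ℝ → ℝ, cfc f S * cfc g S = cfc (fun x => f x * g x) S := fun f g =>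
    (cfc_mul f g S (hc f) (hc g)).symm
  have hSG : S * G = cfc (fun x : ℝ => x * x⁻¹) S := by
    have h := hmul (fun x => x) (fun x => x⁻¹)
    rwa [hid] at h
  have hGS : G * S = cfc (fun x : ℝ => x * x⁻¹) S := by
    have h := hmul (fun x => x⁻¹) (fun x => x)
    rw [hid] at h
    rw [hG, h]
    simp only [mul_comm]
  have hGSG : G * S * G = G := by
    rw [hGS, hG, hmul]
    congr 1
    funext x
    by_cases h : x = 0 <;> simp [h]
  have hSGS : S * G * S = S := by
    have h := hmul (fun x => x * x⁻¹) (fun x => x)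
    rw [hid, ← hSG] at h
    rw [h]
    have h' : (fun x : ℝ => x * x⁻¹ * x) = fun x => x := by
      funext x
      by_cases h : x = 0 <;> simp [h]
    rw [h', hid]
  have hGT : Gᵀ = G := by
    have : IsSelfAdjoint G := cfc_predicate _ S
    rwa [isSelfAdjoint_iff, star_eq_conjTranspose, conjTranspose_eq_transpose_of_trivial] at this
  have hST : Sᵀ = S := by simp [hS]
  refine ⟨G * Aᵀ, ?_, ?_, ?_, ?_⟩
  · have h0 : A * (G * S - 1) = 0 := by
      rw [← Matrix.conjTranspose_mul_self_eq_zero, conjTranspose_eq_transpose_of_trivial,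
        transpose_mul, transpose_sub, transpose_mul, hGT, hST]
      have : ((S * G - 1ᵀ) * Aᵀ) * (A * (G * S - 1)) = (S * G - 1ᵀ) * (S * G * S - S) := by
        simp only [hS, Matrix.mul_assoc, Matrix.mul_sub, Matrix.mul_one]
      rw [this, hSGS]; simp
    have : A * (G * Aᵀ) * A = A * (G * S - 1) + A := by
      simp only [hS, Matrix.mul_assoc, Matrix.mul_sub, Matrix.mul_one, sub_add_cancel]
    rw [this, h0, zero_add]
  · have : G * Aᵀ * A * (G * Aᵀ) = (G * S * G) * Aᵀ := by
      simp only [hS, Matrix.mul_assoc]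
    rw [this, hGSG]
  · simp [transpose_mul, hGT, Matrix.mul_assoc]
  · rw [Matrix.mul_assoc, ← hS, transpose_mul, hGT, hST, hSG, hGS]

theorem IsMoorePenrose.unique {ι κ : Type*} [Fintype ι] [Fintype κ]
    {A : Matrix ι κ ℝ} {P Q : Matrix κ ι ℝ} (hP : IsMoorePenrose A P) (hQ : IsMoorePenrose A Q) :
    P = Q := by
  have h1 : A * P = A * Q := by
    calc A * P = (A * P)ᵀ := hP.symm_left.symm
      _ = ((A * Q * A) * P)ᵀ := by rw [hQ.mul_mul_left]
      _ = ((A * Q) * (A * P))ᵀ := by simp only [Matrix.mul_assoc]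
      _ = (A * P) * (A * Q) := by rw [transpose_mul, hP.symm_left, hQ.symm_left]
      _ = A * P * A * Q := by simp only [Matrix.mul_assoc]
      _ = A * Q := by rw [hP.mul_mul_left]
  have h2 : P * A = Q * A := by
    calc P * A = (P * A)ᵀ := hP.symm_right.symm
      _ = (P * (A * Q * A))ᵀ := by rw [hQ.mul_mul_left]
      _ = ((P * A) * (Q * A))ᵀ := by simp only [Matrix.mul_assoc]
      _ = (Q * A) * (P * A) := by rw [transpose_mul, hP.symm_right, hQ.symm_right]
      _ = Q * (A * P * A) := by simp only [Matrix.mul_assoc]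
      _ = Q * A := by rw [hP.mul_mul_left]
  calc P = P * A * P := hP.mul_mul_right.symm
    _ = Q * A * P := by rw [h2]
    _ = Q * (A * P) := Matrix.mul_assoc _ _ _
    _ = Q * A * Q := by rw [h1, Matrix.mul_assoc]
    _ = Q := hQ.mul_mul_right

/-- The Moore–Penrose pseudoinverse `A†`. -/
noncomputable def pinv {ι κ : Type*} [Fintype ι] [Fintype κ] [DecidableEq κ]
    (A : Matrix ι κ ℝ) : Matrix κ ι ℝ :=
  Classical.choose (exists_isMoorePenrose A)

theorem pinv_spec {ι κ : Type*} [Fintype ι] [Fintype κ] [DecidableEq κ]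
    (A : Matrix ι κ ℝ) : IsMoorePenrose A (pinv A) :=
  Classical.choose_spec (exists_isMoorePenrose A)

/-! ### Conditional mutual information and conditional covariance -/

/-- `I(X; Y | Z)`, in nats, with values in `[0, ∞]`: the relative entropy of the joint law
`P_{Z,X,Y}` with respect to `P_Z ⊗ (P_{X|Z} × P_{Y|Z})`. -/
noncomputable def condMutualInfo {Ω α β γ : Type*} [MeasurableSpace Ω]
    [MeasurableSpace α] [StandardBorelSpace α] [Nonempty α]
    [MeasurableSpace β] [StandardBorelSpace β] [Nonempty β] [MeasurableSpace γ]
    (μ : Measure Ω) [IsFiniteMeasure μ] (X : Ω → α) (Y : Ω → β) (Z : Ω → γ) : ℝ≥0∞ :=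
  InformationTheory.klDiv (μ.map fun ω => (Z ω, (X ω, Y ω)))
    ((μ.map Z) ⊗ₘ (condDistrib X Z μ ×ₖ condDistrib Y Z μ))

/-- The conditional covariance matrix
`cov(X, Y | m) = E[(X - E[X|m]) (Y - E[Y|m])ᵀ | m]`, a random matrix. -/
noncomputable def condCov {Ω ι κ : Type*} [Fintype ι] [Fintype κ] [MeasurableSpace Ω]
    (μ : Measure Ω) (m : MeasurableSpace Ω)
    (X : Ω → EuclideanSpace ℝ ι) (Y : Ω → EuclideanSpace ℝ κ) (ω : Ω) : Matrix ι κ ℝ :=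
  Matrix.of fun i j =>
    (μ[fun ω' => (X ω' i - (μ[X | m]) ω' i) * (Y ω' j - (μ[Y | m]) ω' j) | m]) ω

/-! ### Processes

Time runs over `1, …, n`; a process is a function `ℕ → Ω → E` of which only the values at the
relevant times matter. -/

/-- Two-component vectors `(x₁, x₂) ∈ ℝ^{p₁} × ℝ^{p₂}`, with the Euclidean norm. -/
abbrev Vec (p₁ p₂ : ℕ) : Type := EuclideanSpace ℝ (Fin p₁ ⊕ Fin p₂)

/-- Square matrices of size `p₁ + p₂`. -/
abbrev SqMat (p₁ p₂ : ℕ) : Type := Matrix (Fin p₁ ⊕ Fin p₂) (Fin p₁ ⊕ Fin p₂) ℝ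

/-- First component `x₁` of `x = (x₁, x₂)`. -/
def comp₁ {p₁ p₂ : ℕ} (x : Vec p₁ p₂) : EuclideanSpace ℝ (Fin p₁) :=
  WithLp.toLp 2 fun i => x (Sum.inl i)

/-- Second component `x₂` of `x = (x₁, x₂)`. -/
def comp₂ {p₁ p₂ : ℕ} (x : Vec p₁ p₂) : EuclideanSpace ℝ (Fin p₂) :=
  WithLp.toLp 2 fun i => x (Sum.inr i)

/-- Matrix times vector on Euclidean spaces. -/
def act {ι κ : Type*} [Fintype κ] (M : Matrix ι κ ℝ) (x : EuclideanSpace ℝ κ) :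
    EuclideanSpace ℝ ι :=
  WithLp.toLp 2 (M *ᵥ x.ofLp)

/-- The segment `(X_a, …, X_b)` of a process; `seg X 1 t` is `X^t`, and `seg X 1 0` is empty. -/
def seg {Ω E : Type*} (X : ℕ → Ω → E) (a b : ℕ) (ω : Ω) : Finset.Icc a b → E := fun s => X s ω

/-- The σ-algebra generated by `Y^s = (Y_1, …, Y_s)`. -/
abbrev sigma {Ω E : Type*} [MeasurableSpace E] (Y : ℕ → Ω → E) (s : ℕ) : MeasurableSpace Ω :=
  MeasurableSpace.comap (seg Y 1 s) inferInstance

/-- Trajectories `(x_1, …, x_n)`. -/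
abbrev Path (n : ℕ) (E : Type*) : Type _ := Finset.Icc 1 n → E

/-- The coordinate at time `t` of a trajectory (`0` outside `1, …, n`). -/
def coord {n : ℕ} {E : Type*} [Zero E] (t : ℕ) (x : Path n E) : E :=
  if h : t ∈ Finset.Icc 1 n then x ⟨t, h⟩ else 0

/-- The source process on the space of pairs of trajectories `(x^n, y^n)`. -/
def xproc {n : ℕ} {E : Type*} [Zero E] (t : ℕ) (z : Path n E × Path n E) : E := coord t z.1

/-- The reproduction process on the space of pairs of trajectories `(x^n, y^n)`. -/
def yproc {n : ℕ} {E : Type*} [Zero E] (t : ℕ) (z : Path n E × Path n E) : E := coord t z.2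

/-! ### The joint nonanticipative rate distortion function -/

/-- `d_n(x^n, y^n) = (1/n) ∑_{t=1}^n ‖x_t - y_t‖²`. -/
noncomputable def distortion {p : ℕ} (n : ℕ) (x y : ℕ → EuclideanSpace ℝ (Fin p)) : ℝ :=
  (1 / (n : ℝ)) * ∑ t ∈ Finset.Icc 1 n, ‖x t - y t‖ ^ 2

/-- The joint laws of `(X^n, Y^n)` whose `X^n`-marginal is `PX`, which are nonanticipative
(`P_{Y^t | X^n} = P_{Y^t | X^t}` for `t = 1, …, n - 1`) and which meet the two individual
fidelity criteria. -/
def admissible {n p₁ p₂ : ℕ} (PX : Measure (Path n (Vec p₁ p₂))) (Δ₁ Δ₂ : ℝ≥0) :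
    Set (ProbabilityMeasure (Path n (Vec p₁ p₂) × Path n (Vec p₁ p₂))) :=
  {P | P.toMeasure.map Prod.fst = PX ∧
    (∀ t ∈ Finset.Icc 1 (n - 1),
      ∀ᵐ z ∂P.toMeasure,
        condDistrib (seg yproc 1 t) (seg xproc 1 n)
            P.toMeasure (seg xproc 1 n z) =
          condDistrib (seg yproc 1 t) (seg xproc 1 t)
            P.toMeasure (seg xproc 1 t z)) ∧
    ∫⁻ z, ENNReal.ofReal (distortion n (fun t => comp₁ (xproc t z)) (fun t => comp₁ (yproc t z)))
        ∂P.toMeasure ≤ Δ₁ ∧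
    ∫⁻ z, ENNReal.ofReal (distortion n (fun t => comp₂ (xproc t z)) (fun t => comp₂ (yproc t z)))
        ∂P.toMeasure ≤ Δ₂}

/-- The pay-off `∑_{t=1}^n I(X^t; Y_t | Y^{t-1})`. -/
noncomputable def payoff {Ω : Type*} [MeasurableSpace Ω] {p₁ p₂ : ℕ} (n : ℕ)
    (μ : Measure Ω) [IsFiniteMeasure μ] (X Y : ℕ → Ω → Vec p₁ p₂) : ℝ≥0∞ :=
  ∑ t ∈ Finset.Icc 1 n, condMutualInfo μ (seg X 1 t) (Y t) (seg Y 1 (t - 1))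

/-- The joint nonanticipative rate distortion function `R_{X^n}(Δ₁, Δ₂)`. -/
noncomputable def jointNRDF {n p₁ p₂ : ℕ} (PX : Measure (Path n (Vec p₁ p₂)))
    (Δ₁ Δ₂ : ℝ≥0) : ℝ≥0∞ :=
  ⨅ P ∈ admissible PX Δ₁ Δ₂,
    payoff n P.toMeasure xproc yproc

/-! ### Gaussian Markov sources and the parametric realization -/

/-- `X_{t+1} = A_t X_t + B_t W_{t+1}` for `t = 1, …, n - 1`, where `X_1 ∼ N(0, QX)`,
`W_t ∼ N(0, QW_t)` and `X_1, W_2, …, W_n` are independent. -/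
structure IsGaussMarkov {Ω : Type*} [MeasurableSpace Ω] (μ : Measure Ω) {p₁ p₂ q₁ q₂ : ℕ}
    (n : ℕ) (A : ℕ → SqMat p₁ p₂) (B : ℕ → Matrix (Fin p₁ ⊕ Fin p₂) (Fin q₁ ⊕ Fin q₂) ℝ)
    (QX : SqMat p₁ p₂) (QW : ℕ → SqMat q₁ q₂)
    (X : ℕ → Ω → Vec p₁ p₂) (W : ℕ → Ω → Vec q₁ q₂) : Prop where
  measurable_X : ∀ t ∈ Finset.Icc 1 n, Measurable (X t)
  measurable_W : ∀ t ∈ Finset.Icc 2 n, Measurable (W t)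
  posSemidef_QX : QX.PosSemidef
  posSemidef_QW : ∀ t ∈ Finset.Icc 2 n, (QW t).PosSemidef
  law_X : μ.map (X 1) = multivariateGaussian 0 QX
  law_W : ∀ t ∈ Finset.Icc 2 n, μ.map (W t) = multivariateGaussian 0 (QW t)
  indep_W : iIndepFun (fun (s : Finset.Icc 2 n) => W s) μ
  indep_X_W : IndepFun (X 1) (seg W 2 n) μ
  recursion : ∀ t ∈ Finset.Icc 1 (n - 1),
    ∀ᵐ ω ∂μ, X (t + 1) ω = act (A t) (X t ω) + act (B t) (W (t + 1) ω)

/-- `X̂_{t|s} = E[X_t | Y^s]`. -/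
noncomputable def est {Ω : Type*} [MeasurableSpace Ω] (μ : Measure Ω) {p₁ p₂ : ℕ}
    (X Y : ℕ → Ω → Vec p₁ p₂) (t s : ℕ) : Ω → Vec p₁ p₂ :=
  μ[X t | sigma Y s]

/-- `X̂_{t-1|t-1}`, with the convention `X̂_{0|0} = 0`. -/
noncomputable def prevEst {Ω : Type*} [MeasurableSpace Ω] (μ : Measure Ω) {p₁ p₂ : ℕ}
    (X Y : ℕ → Ω → Vec p₁ p₂) (t : ℕ) : Ω → Vec p₁ p₂ :=
  if t = 1 then 0 else est μ X Y (t - 1) (t - 1)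

/-- `g_t(Y^{t-1}) = X̂_{t|t-1} - H_t X̂_{t|t-1}`. -/
noncomputable def feedback {Ω : Type*} [MeasurableSpace Ω] (μ : Measure Ω) {p₁ p₂ : ℕ}
    (H : ℕ → SqMat p₁ p₂) (X Y : ℕ → Ω → Vec p₁ p₂) (t : ℕ) (ω : Ω) : Vec p₁ p₂ :=
  est μ X Y t (t - 1) ω - act (H t) (est μ X Y t (t - 1) ω)

/-- `Y_t = H_t X_t + g_t(Y^{t-1}) + V_t`, `t = 1, …, n`, where `V_t ∼ N(0, QV_t)`, and
`V_1, …, V_n` are independent of one another and, jointly, of `(X_1, W_2, …, W_n)`. -/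
structure IsRealization {Ω : Type*} [MeasurableSpace Ω] (μ : Measure Ω) {p₁ p₂ q₁ q₂ : ℕ}
    (n : ℕ) (H QV : ℕ → SqMat p₁ p₂) (X : ℕ → Ω → Vec p₁ p₂) (W : ℕ → Ω → Vec q₁ q₂)
    (V Y : ℕ → Ω → Vec p₁ p₂) : Prop where
  measurable_V : ∀ t ∈ Finset.Icc 1 n, Measurable (V t)
  measurable_Y : ∀ t ∈ Finset.Icc 1 n, Measurable (Y t)
  posSemidef_QV : ∀ t ∈ Finset.Icc 1 n, (QV t).PosSemidef
  law_V : ∀ t ∈ Finset.Icc 1 n, μ.map (V t) = multivariateGaussian 0 (QV t)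
  indep_V : iIndepFun (fun (s : Finset.Icc 1 n) => V s) μ
  indep_V_XW : IndepFun (seg V 1 n) (fun ω => (X 1 ω, seg W 2 n ω)) μ
  realization : ∀ t ∈ Finset.Icc 1 n,
    ∀ᵐ ω ∂μ, Y t ω = act (H t) (X t ω) + feedback μ H X Y t ω + V t ω

/-- The test channel `Q_t(dy_t | x̂_{t-1|t-1}, x_t)`: the Gaussian law with mean
`H_t x_t + (I - H_t) A_{t-1} x̂_{t-1|t-1}` and covariance `QV_t`. -/
noncomputable def testChannel {p₁ p₂ : ℕ} (H QV Aprev : SqMat p₁ p₂) (xhat x : Vec p₁ p₂) :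
    Measure (Vec p₁ p₂) :=
  multivariateGaussian (act H x + act (1 - H) (act Aprev xhat)) QV

/-- `E[X_{i,t} | Y^t] = Y_{i,t}` a.s. for `i = 1, 2`. -/
def EstEqReproduction {Ω : Type*} [MeasurableSpace Ω] (μ : Measure Ω) {p₁ p₂ : ℕ}
    (X Y : ℕ → Ω → Vec p₁ p₂) (t : ℕ) : Prop :=
  μ[fun ω => comp₁ (X t ω) | sigma Y t] =ᵐ[μ] (fun ω => comp₁ (Y t ω)) ∧
  μ[fun ω => comp₂ (X t ω) | sigma Y t] =ᵐ[μ] (fun ω => comp₂ (Y t ω))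

/-- `E[X_t|Y^{t-1}] + cov(X_t,Y_t|Y^{t-1}) cov(Y_t,Y_t|Y^{t-1})† (Y_t - E[Y_t|Y^{t-1}])`. -/
noncomputable def kalmanUpdate {Ω : Type*} [MeasurableSpace Ω] (μ : Measure Ω) {p₁ p₂ : ℕ}
    (X Y : ℕ → Ω → Vec p₁ p₂) (t : ℕ) (ω : Ω) : Vec p₁ p₂ :=
  est μ X Y t (t - 1) ω +
    act (condCov μ (sigma Y (t - 1)) (X t) (Y t) ω *
        pinv (condCov μ (sigma Y (t - 1)) (Y t) (Y t) ω))
      (Y t ω - (μ[Y t | sigma Y (t - 1)]) ω)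

end JointNRDF

open JointNRDF

set_option linter.unusedSectionVars false

namespace JointNRDF

/-! ### Calculus of conditional mutual information -/

section Info

open InformationTheory Kernel

theorem klDiv_map_measurableEquiv {α β : Type*} [MeasurableSpace α] [MeasurableSpace β]
    (μ ν : Measure α) [IsFiniteMeasure μ] [IsFiniteMeasure ν] (e : α ≃ᵐ β) :
    klDiv (μ.map e) (ν.map e) = klDiv μ ν := by
  refine le_antisymm (klDiv_map_le μ ν e.measurable) ?_
  have h := klDiv_map_le (μ.map e) (ν.map e) e.symm.measurable
  rwa [Measure.map_map e.symm.measurable e.measurable, Measure.map_map e.symm.measurable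
    e.measurable, e.symm_comp_self, Measure.map_id, Measure.map_id] at h

variable {α β γ : Type*} [MeasurableSpace α] [MeasurableSpace β] [MeasurableSpace γ]

theorem map_assoc_compProd_prod (ν : Measure α) [SFinite ν] (κ : Kernel α β) (η : Kernel α γ)
    [IsMarkovKernel κ] [IsMarkovKernel η] :
    (ν ⊗ₘ (κ ×ₖ η)).map MeasurableEquiv.prodAssoc.symm = (ν ⊗ₘ κ) ⊗ₘ η.prodMkRight β := by
  refine Measure.ext_of_lintegral _ fun f hf => ?_
  rw [MeasureTheory.lintegral_map hf (MeasurableEquiv.measurable _), Measure.lintegral_compProd (by fun_prop),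
    Measure.lintegral_compProd hf, Measure.lintegral_compProd (by
      exact Measurable.lintegral_kernel_prod_right' hf)]
  refine lintegral_congr fun a => ?_
  rw [Kernel.lintegral_prod _ _ _ (by fun_prop)]
  rfl

theorem map_swap_compProd_prodMkRight (ν : Measure α) [SFinite ν] (κ : Kernel α β)
    (η : Kernel α γ) [IsMarkovKernel κ] [IsMarkovKernel η] :
    ((ν ⊗ₘ κ) ⊗ₘ η.prodMkRight β).map (fun p => ((p.1.1, p.2), p.1.2)) =
      (ν ⊗ₘ η) ⊗ₘ κ.prodMkRight γ := by
  refine Measure.ext_of_lintegral _ fun f hf => ?_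
  have hf' : Measurable fun p : (α × β) × γ => f ((p.1.1, p.2), p.1.2) := by fun_prop
  rw [MeasureTheory.lintegral_map hf (by fun_prop), Measure.lintegral_compProd hf', Measure.lintegral_compProd hf,
    Measure.lintegral_compProd (Measurable.lintegral_kernel_prod_right' hf'),
    Measure.lintegral_compProd (Measurable.lintegral_kernel_prod_right' hf)]
  refine lintegral_congr fun a => ?_
  simp only [prodMkRight_apply]
  exact lintegral_lintegral_swap (by fun_prop)

variable {Ω : Type*} [MeasurableSpace Ω] (μ : Measure Ω) [IsProbabilityMeasure μ]
  [StandardBorelSpace α] [Nonempty α] [StandardBorelSpace β] [Nonempty β]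
  {δ : Type*} [MeasurableSpace δ]

theorem condMutualInfo_eq_klDiv {X : Ω → α} {Y : Ω → β} {Z : Ω → δ} (hX : Measurable X)
    (hY : Measurable Y) (hZ : Measurable Z) :
    condMutualInfo μ X Y Z = klDiv (μ.map fun ω => ((Z ω, X ω), Y ω))
      ((μ.map fun ω => (Z ω, X ω)) ⊗ₘ (condDistrib Y Z μ).prodMkRight α) := by
  have := Measure.isProbabilityMeasure_map (μ := μ) hZ.aemeasurable
  have := Measure.isProbabilityMeasure_map (μ := μ) (hZ.prodMk (hX.prodMk hY)).aemeasurable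
  rw [condMutualInfo, ← klDiv_map_measurableEquiv _ _ MeasurableEquiv.prodAssoc.symm,
    map_assoc_compProd_prod, compProd_map_condDistrib hX.aemeasurable,
    Measure.map_map (MeasurableEquiv.measurable _) (by fun_prop)]
  rfl

theorem condMutualInfo_comm {X : Ω → α} {Y : Ω → β} {Z : Ω → δ} (hX : Measurable X)
    (hY : Measurable Y) (hZ : Measurable Z) :
    condMutualInfo μ X Y Z = condMutualInfo μ Y X Z := by
  have := Measure.isProbabilityMeasure_map (μ := μ) hZ.aemeasurable
  have := Measure.isProbabilityMeasure_map (μ := μ) (hZ.prodMk (hX.prodMk hY)).aemeasurable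
  let e : δ × α × β ≃ᵐ δ × β × α :=
    MeasurableEquiv.prodCongr (MeasurableEquiv.refl δ) MeasurableEquiv.prodComm
  rw [condMutualInfo, condMutualInfo, ← klDiv_map_measurableEquiv _ _ e,
    Measure.map_map (MeasurableEquiv.measurable _) (by fun_prop)]
  congr 1
  have he : (e : δ × α × β → δ × β × α) = Prod.map id Prod.swap := rfl
  rw [he, ← Measure.compProd_map measurable_swap, Kernel.map_prod_swap]

theorem condMutualInfo_eq_klDiv' {X : Ω → α} {Y : Ω → β} {Z : Ω → δ} (hX : Measurable X)
    (hY : Measurable Y) (hZ : Measurable Z) :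
    condMutualInfo μ X Y Z = klDiv (μ.map fun ω => ((Z ω, Y ω), X ω))
      ((μ.map fun ω => (Z ω, Y ω)) ⊗ₘ (condDistrib X Z μ).prodMkRight β) := by
  rw [condMutualInfo_comm μ hX hY hZ, condMutualInfo_eq_klDiv μ hY hX hZ]

theorem condMutualInfo_congr {X X' : Ω → α} {Y Y' : Ω → β} {Z Z' : Ω → δ}
    (hX : X =ᵐ[μ] X') (hY : Y =ᵐ[μ] Y') (hZ : Z =ᵐ[μ] Z') :
    condMutualInfo μ X Y Z = condMutualInfo μ X' Y' Z' := by
  rw [condMutualInfo, condMutualInfo, condDistrib_congr hX hZ, condDistrib_congr hY hZ,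
    Measure.map_congr hZ, Measure.map_congr (hZ.prodMk (hX.prodMk hY))]

/-- If `Y` and `X` are conditionally independent given `Z`, then `I(X; Y | Z) = 0`. -/
theorem condMutualInfo_eq_zero {X : Ω → α} {Y : Ω → β} {Z : Ω → δ} (hX : Measurable X)
    (hY : Measurable Y) (hZ : Measurable Z) (κ : Kernel δ β) [IsMarkovKernel κ]
    (h : μ.map (fun ω => ((Z ω, X ω), Y ω)) =
      (μ.map fun ω => (Z ω, X ω)) ⊗ₘ κ.prodMkRight α) :
    condMutualInfo μ X Y Z = 0 := by
  have := Measure.isProbabilityMeasure_map (μ := μ) hZ.aemeasurable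
  have := Measure.isProbabilityMeasure_map (μ := μ) (hZ.prodMk hX).aemeasurable
  have h1 : μ.map (fun ω => (Z ω, Y ω)) = μ.map Z ⊗ₘ κ := by
    have := congrArg (Measure.map fun p : (δ × α) × β => (p.1.1, p.2)) h
    rw [Measure.map_map (by fun_prop) (by fun_prop)] at this
    refine this.trans (Measure.ext_of_lintegral _ fun f hf => ?_)
    rw [MeasureTheory.lintegral_map hf (by fun_prop), Measure.lintegral_compProd (by fun_prop),
      Measure.lintegral_compProd hf,
      MeasureTheory.lintegral_map (by
        exact Measurable.lintegral_kernel_prod_right'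
          (κ := κ.prodMkRight α) (f := fun p => f (p.1.1, p.2)) (by fun_prop)) (by fun_prop),
      MeasureTheory.lintegral_map (Measurable.lintegral_kernel_prod_right' hf) hZ]
    rfl
  have h2 := condDistrib_ae_eq_of_measure_eq_compProd Z hY.aemeasurable h1
  rw [condMutualInfo_eq_klDiv μ hX hY hZ, h]
  have h3 : (μ.map fun ω => (Z ω, X ω)) ⊗ₘ κ.prodMkRight α =
      (μ.map fun ω => (Z ω, X ω)) ⊗ₘ (condDistrib Y Z μ).prodMkRight α := by
    refine Measure.compProd_congr ?_
    have h4 : ∀ᵐ p ∂(μ.map fun ω => (Z ω, X ω)), condDistrib Y Z μ p.1 = κ p.1 := by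
      have : μ.map Z = (μ.map fun ω => (Z ω, X ω)).map Prod.fst := by
        rw [Measure.map_map (by fun_prop) (by fun_prop)]; rfl
      rw [this] at h2
      exact ae_of_ae_map (by fun_prop) h2
    filter_upwards [h4] with p hp
    exact hp.symm
  rw [h3, klDiv_self]

theorem condMutualInfo_comp_le {X : Ω → α} {Y : Ω → β} {Z : Ω → δ} (hX : Measurable X)
    (hY : Measurable Y) (hZ : Measurable Z) {ε : Type*} [MeasurableSpace ε]
    [StandardBorelSpace ε] [Nonempty ε] {h : β → ε} (hh : Measurable h) :
    condMutualInfo μ X (fun ω => h (Y ω)) Z ≤ condMutualInfo μ X Y Z := by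
  have := Measure.isProbabilityMeasure_map (μ := μ) (hZ.prodMk hX).aemeasurable
  have := Measure.isProbabilityMeasure_map (μ := μ) ((hZ.prodMk hX).prodMk hY).aemeasurable
  rw [condMutualInfo_eq_klDiv μ hX hY hZ, condMutualInfo_eq_klDiv μ hX (by fun_prop) hZ]
  refine le_trans (le_of_eq ?_) (klDiv_map_le _ _ (g := Prod.map id h) (by fun_prop))
  rw [Measure.map_map (by fun_prop) (by fun_prop), ← Measure.compProd_map hh]
  congr 1
  refine Measure.compProd_congr ?_
  have h2 : condDistrib (fun ω => h (Y ω)) Z μ =ᵐ[μ.map Z] (condDistrib Y Z μ).map h :=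
    condDistrib_comp (μ := μ) Z hY.aemeasurable hh
  have : μ.map Z = (μ.map fun ω => (Z ω, X ω)).map Prod.fst := by
    rw [Measure.map_map (by fun_prop) (by fun_prop)]; rfl
  rw [this] at h2
  filter_upwards [ae_of_ae_map (by fun_prop) h2] with p hp
  rw [prodMkRight_apply, Kernel.map_prodMkRight, prodMkRight_apply]
  exact hp

/-- The chain rule `I(X; E, Y | Z) = I(X; E | Z) + I(X; Y | Z, E)`. -/
theorem condMutualInfo_prod_eq_add {ε : Type*} [MeasurableSpace ε] [StandardBorelSpace ε]
    [Nonempty ε] {X : Ω → α} {E : Ω → ε} {Y : Ω → β} {Z : Ω → δ} (hX : Measurable X)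
    (hE : Measurable E) (hY : Measurable Y) (hZ : Measurable Z) :
    condMutualInfo μ X (fun ω => (E ω, Y ω)) Z =
      condMutualInfo μ X E Z + condMutualInfo μ X Y (fun ω => (Z ω, E ω)) := by
  have := Measure.isProbabilityMeasure_map (μ := μ) (hZ.prodMk hE).aemeasurable
  have := Measure.isProbabilityMeasure_map (μ := μ) ((hZ.prodMk hE).prodMk hX).aemeasurable
  have := Measure.isProbabilityMeasure_map (μ := μ) ((hZ.prodMk hE).prodMk hY).aemeasurable
  have := Measure.isProbabilityMeasure_map (μ := μ)
    ((hZ.prodMk (hE.prodMk hY)).prodMk hX).aemeasurable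
  have := Measure.isProbabilityMeasure_map (μ := μ)
    (hZ.prodMk (hE.prodMk hY)).aemeasurable
  rw [condMutualInfo_eq_klDiv' μ hX (hE.prodMk hY) hZ, condMutualInfo_eq_klDiv' μ hX hE hZ,
    condMutualInfo_eq_klDiv μ hX hY (hZ.prodMk hE)]
  let e : (δ × ε × β) × α ≃ᵐ ((δ × ε) × α) × β :=
    { toFun := fun p => (((p.1.1, p.1.2.1), p.2), p.1.2.2)
      invFun := fun p => ((p.1.1.1, p.1.1.2, p.2), p.1.2)
      left_inv := fun _ => rfl
      right_inv := fun _ => rfl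
      measurable_toFun := by
        change Measurable fun p : (δ × ε × β) × α => (((p.1.1, p.1.2.1), p.2), p.1.2.2)
        fun_prop
      measurable_invFun := by
        change Measurable fun p : ((δ × ε) × α) × β => ((p.1.1.1, p.1.1.2, p.2), p.1.2)
        fun_prop }
  have h1 : (μ.map fun ω => ((Z ω, E ω, Y ω), X ω)).map e =
      (μ.map fun ω => ((Z ω, E ω), X ω)) ⊗ₘ condDistrib Y (fun ω => ((Z ω, E ω), X ω)) μ := by
    rw [compProd_map_condDistrib hY.aemeasurable, Measure.map_map e.measurable (by fun_prop)]
    rfl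
  have h2 : ((μ.map fun ω => (Z ω, E ω, Y ω)) ⊗ₘ (condDistrib X Z μ).prodMkRight (ε × β)).map e =
      ((μ.map fun ω => (Z ω, E ω)) ⊗ₘ (condDistrib X Z μ).prodMkRight ε) ⊗ₘ
        (condDistrib Y (fun ω => (Z ω, E ω)) μ).prodMkRight α := by
    rw [← map_swap_compProd_prodMkRight, compProd_map_condDistrib hY.aemeasurable]
    have h3 : (μ.map fun ω => ((Z ω, E ω), Y ω)) =
        (μ.map fun ω => (Z ω, E ω, Y ω)).map MeasurableEquiv.prodAssoc.symm := by
      rw [Measure.map_map (MeasurableEquiv.measurable _) (by fun_prop)]; rfl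
    rw [h3]
    refine Measure.ext_of_lintegral _ fun f hf => ?_
    have hf' : Measurable fun p : ((δ × ε) × β) × α => f ((p.1.1, p.2), p.1.2) := by fun_prop
    rw [MeasureTheory.lintegral_map hf e.measurable, Measure.lintegral_compProd (by fun_prop),
      MeasureTheory.lintegral_map hf (by fun_prop), Measure.lintegral_compProd hf',
      MeasureTheory.lintegral_map (Measurable.lintegral_kernel_prod_right' hf') (MeasurableEquiv.measurable _)]
    rfl
  rw [← klDiv_map_measurableEquiv _ _ e, h1, h2, klDiv_compProd_eq_add,
    compProd_map_condDistrib hY.aemeasurable]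

theorem condMutualInfo_comp_self {X : Ω → α} {Z : Ω → δ} (hX : Measurable X)
    (hZ : Measurable Z) {g : δ → β} (hg : Measurable g) :
    condMutualInfo μ X (fun ω => g (Z ω)) Z = 0 := by
  refine condMutualInfo_eq_zero μ hX (by fun_prop) hZ (Kernel.deterministic g hg) ?_
  have : (Kernel.deterministic g hg).prodMkRight α =
      Kernel.deterministic (fun p : δ × α => g p.1) (by fun_prop) := by
    ext p s hs
    simp [Kernel.deterministic_apply]
  rw [this, Measure.compProd_deterministic, Measure.map_map (by fun_prop) (by fun_prop)]
  rfl

variable [StandardBorelSpace δ] [Nonempty δ]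

/-- Data processing: `I(X; h(Z, Y) | Z) ≤ I(X; Y | Z)`. -/
theorem condMutualInfo_le_right {X : Ω → α} {Y : Ω → β} {Z : Ω → δ} (hX : Measurable X)
    (hY : Measurable Y) (hZ : Measurable Z) {ε : Type*} [MeasurableSpace ε]
    [StandardBorelSpace ε] [Nonempty ε] {Y' : Ω → ε} {h : δ × β → ε} (hh : Measurable h)
    (hY' : Y' =ᵐ[μ] fun ω => h (Z ω, Y ω)) :
    condMutualInfo μ X Y' Z ≤ condMutualInfo μ X Y Z := by
  rw [condMutualInfo_congr μ (Filter.EventuallyEq.refl _ X) hY' (Filter.EventuallyEq.refl _ Z)]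
  have h1 := condMutualInfo_comp_le μ hX (hY.prodMk hZ) hZ
    (h := fun p : β × δ => h (p.2, p.1)) (by fun_prop)
  refine h1.trans (le_of_eq ?_)
  rw [condMutualInfo_prod_eq_add μ hX hY hZ hZ,
    condMutualInfo_comp_self μ hX (hZ.prodMk hY) (g := Prod.fst) measurable_fst, add_zero]

/-- Data processing: `I(g(Z, X); h(Z, Y) | Z) ≤ I(X; Y | Z)`. -/
theorem condMutualInfo_le {X : Ω → α} {Y : Ω → β} {Z : Ω → δ} (hX : Measurable X)
    (hY : Measurable Y) (hZ : Measurable Z) {ε ζ : Type*} [MeasurableSpace ε]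
    [StandardBorelSpace ε] [Nonempty ε] [MeasurableSpace ζ] [StandardBorelSpace ζ] [Nonempty ζ]
    {X' : Ω → ζ} {Y' : Ω → ε} {g : δ × α → ζ} {h : δ × β → ε} (hg : Measurable g)
    (hh : Measurable h) (hX' : X' =ᵐ[μ] fun ω => g (Z ω, X ω))
    (hY' : Y' =ᵐ[μ] fun ω => h (Z ω, Y ω)) :
    condMutualInfo μ X' Y' Z ≤ condMutualInfo μ X Y Z := by
  rw [condMutualInfo_congr μ hX' (Filter.EventuallyEq.refl _ Y') (Filter.EventuallyEq.refl _ Z)]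
  refine (condMutualInfo_le_right μ (X := fun ω => g (Z ω, X ω)) (by fun_prop) hY hZ hh hY').trans ?_
  rw [condMutualInfo_comm μ (by fun_prop) hY hZ, condMutualInfo_comm μ hX hY hZ]
  exact condMutualInfo_le_right μ hY hX hZ hg (Filter.EventuallyEq.refl _ _)

theorem condMutualInfo_prod_comp {X : Ω → α} {Y : Ω → β} {Z : Ω → δ} (hX : Measurable X)
    (hY : Measurable Y) (hZ : Measurable Z) {ε : Type*} [MeasurableSpace ε]
    [StandardBorelSpace ε] [Nonempty ε] {g : δ → ε} (hg : Measurable g) :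
    condMutualInfo μ X Y (fun ω => (Z ω, g (Z ω))) = condMutualInfo μ X Y Z := by
  have h1 := condMutualInfo_prod_eq_add μ hX (E := fun ω => g (Z ω)) (by fun_prop) hY hZ
  rw [condMutualInfo_comp_self μ hX hZ hg, zero_add] at h1
  rw [← h1]
  refine le_antisymm ?_ ?_
  · exact condMutualInfo_le_right μ hX hY hZ (h := fun p => (g p.1, p.2)) (by fun_prop)
      (Filter.EventuallyEq.refl _ _)
  · exact condMutualInfo_le_right μ hX (by fun_prop) hZ (h := fun p => p.2.2) (by fun_prop)
      (Filter.EventuallyEq.refl _ _)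

omit [StandardBorelSpace δ] [Nonempty δ] in
omit [IsProbabilityMeasure μ] in
theorem condDistrib_prod_swap_ae_eq [IsFiniteMeasure μ] {ε : Type*} [MeasurableSpace ε] {U : Ω → α}
    {Z : Ω → δ} {E : Ω → ε} (hU : Measurable U) (hZ : Measurable Z) (hE : Measurable E) :
    condDistrib U (fun ω => (Z ω, E ω)) μ =ᵐ[μ.map fun ω => (Z ω, E ω)]
      (condDistrib U (fun ω => (E ω, Z ω)) μ).comap Prod.swap measurable_swap := by
  refine condDistrib_ae_eq_of_measure_eq_compProd _ hU.aemeasurable ?_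
  have h1 : μ.map (fun ω => (E ω, Z ω)) ⊗ₘ condDistrib U (fun ω => (E ω, Z ω)) μ =
      μ.map fun ω => ((E ω, Z ω), U ω) := compProd_map_condDistrib hU.aemeasurable
  have h2 := congrArg (Measure.map (Prod.map Prod.swap id)) h1
  rw [Measure.map_map (by fun_prop) (by fun_prop)] at h2
  refine h2.symm.trans (Measure.ext_of_lintegral _ fun f hf => ?_)
  have h3 : (μ.map fun ω => (E ω, Z ω)) = (μ.map fun ω => (Z ω, E ω)).map Prod.swap := by
    rw [Measure.map_map (by fun_prop) (by fun_prop)]; rfl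
  rw [MeasureTheory.lintegral_map hf (by fun_prop), Measure.lintegral_compProd (by fun_prop),
    Measure.lintegral_compProd hf, h3, MeasureTheory.lintegral_map
      (Measurable.lintegral_kernel_prod_right'
        (f := fun p => f (Prod.map Prod.swap id p)) (by fun_prop)) measurable_swap]
  rfl

omit [StandardBorelSpace δ] [Nonempty δ] in
theorem condDistrib_of_indepFun {U : Ω → α} {Z : Ω → δ}
    (hU : Measurable U) (hZ : Measurable Z) (h : IndepFun U Z μ) :
    condDistrib U Z μ =ᵐ[μ.map Z] Kernel.const δ (μ.map U) := by
  have := Measure.isProbabilityMeasure_map (μ := μ) hU.aemeasurable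
  have := Measure.isProbabilityMeasure_map (μ := μ) hZ.aemeasurable
  refine condDistrib_ae_eq_of_measure_eq_compProd _ hU.aemeasurable ?_
  rw [Measure.compProd_const]
  exact (indepFun_iff_map_prod_eq_prod_map_map hZ.aemeasurable hU.aemeasurable).1 h.symm

omit [StandardBorelSpace δ] [Nonempty δ] in
theorem condMutualInfo_prod_swap {ε : Type*} [MeasurableSpace ε] {X : Ω → α} {Y : Ω → β}
    {Z : Ω → δ} {E : Ω → ε} (hX : Measurable X) (hY : Measurable Y) (hZ : Measurable Z)
    (hE : Measurable E) :
    condMutualInfo μ X Y (fun ω => (Z ω, E ω)) = condMutualInfo μ X Y (fun ω => (E ω, Z ω)) := by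
  have := Measure.isProbabilityMeasure_map (μ := μ) (hZ.prodMk hE).aemeasurable
  have := Measure.isProbabilityMeasure_map (μ := μ) (hE.prodMk hZ).aemeasurable
  have := Measure.isProbabilityMeasure_map (μ := μ)
    ((hZ.prodMk hE).prodMk (hX.prodMk hY)).aemeasurable
  let e : (δ × ε) × (α × β) ≃ᵐ (ε × δ) × (α × β) :=
    MeasurableEquiv.prodCongr MeasurableEquiv.prodComm (MeasurableEquiv.refl _)
  rw [condMutualInfo, condMutualInfo, ← klDiv_map_measurableEquiv _ _ e,
    Measure.map_map e.measurable (by fun_prop)]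
  congr 1
  have h3 := Measure.compProd_congr (μ := μ.map fun ω => (Z ω, E ω))
    (κ := condDistrib X (fun ω => (Z ω, E ω)) μ ×ₖ condDistrib Y (fun ω => (Z ω, E ω)) μ)
    (η := (condDistrib X (fun ω => (E ω, Z ω)) μ ×ₖ condDistrib Y (fun ω => (E ω, Z ω)) μ).comap
      Prod.swap measurable_swap) (by
      filter_upwards [condDistrib_prod_swap_ae_eq μ hX hZ hE,
        condDistrib_prod_swap_ae_eq μ hY hZ hE] with p h1 h2
      rw [Kernel.prod_apply, h1, h2, Kernel.comap_apply, Kernel.comap_apply, Kernel.comap_apply,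
        Kernel.prod_apply])
  rw [h3]
  refine Measure.ext_of_lintegral _ fun f hf => ?_
  have : (μ.map fun ω => (E ω, Z ω)) = (μ.map fun ω => (Z ω, E ω)).map Prod.swap := by
    rw [Measure.map_map (by fun_prop) (by fun_prop)]; rfl
  rw [MeasureTheory.lintegral_map hf e.measurable, Measure.lintegral_compProd (by fun_prop), this,
    Measure.lintegral_compProd hf,
    MeasureTheory.lintegral_map (Measurable.lintegral_kernel_prod_right' hf) measurable_swap]
  rfl

/-- `I(X; Y | Z)` depends on `Z` only through the information in `Z`. -/
theorem condMutualInfo_congr_cond {ε : Type*} [MeasurableSpace ε] [StandardBorelSpace ε]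
    [Nonempty ε] {X : Ω → α} {Y : Ω → β} {Z : Ω → δ} {Z' : Ω → ε} (hX : Measurable X)
    (hY : Measurable Y) (hZ : Measurable Z) (hZ' : Measurable Z') {φ : δ → ε} {ψ : ε → δ}
    (hφ : Measurable φ) (hψ : Measurable ψ) (h1 : Z' =ᵐ[μ] fun ω => φ (Z ω))
    (h2 : Z =ᵐ[μ] fun ω => ψ (Z' ω)) :
    condMutualInfo μ X Y Z = condMutualInfo μ X Y Z' := by
  rw [← condMutualInfo_prod_comp μ hX hY hZ hφ, ← condMutualInfo_prod_comp μ hX hY hZ' hψ]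
  rw [condMutualInfo_congr μ (Filter.EventuallyEq.refl _ X) (Filter.EventuallyEq.refl _ Y)
    ((Filter.EventuallyEq.refl _ Z).prodMk h1.symm), condMutualInfo_prod_swap μ hX hY hZ hZ']
  exact condMutualInfo_congr μ (Filter.EventuallyEq.refl _ X) (Filter.EventuallyEq.refl _ Y)
    ((Filter.EventuallyEq.refl _ Z').prodMk h2)

omit [StandardBorelSpace δ] [Nonempty δ] in
/-- If `(X, Y)` is independent of `Z`, then `I(X; Y | Z) = I(X; Y)`. -/
theorem condMutualInfo_of_indepFun {X : Ω → α} {Y : Ω → β} {Z : Ω → δ} (hX : Measurable X)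
    (hY : Measurable Y) (hZ : Measurable Z) (h : IndepFun (fun ω => (X ω, Y ω)) Z μ) :
    condMutualInfo μ X Y Z =
      klDiv (μ.map fun ω => (X ω, Y ω)) ((μ.map X).prod (μ.map Y)) := by
  have := Measure.isProbabilityMeasure_map (μ := μ) hX.aemeasurable
  have := Measure.isProbabilityMeasure_map (μ := μ) hY.aemeasurable
  have := Measure.isProbabilityMeasure_map (μ := μ) hZ.aemeasurable
  have := Measure.isProbabilityMeasure_map (μ := μ) (hX.prodMk hY).aemeasurable
  have hXZ : IndepFun X Z μ := h.comp measurable_fst measurable_id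
  have hYZ : IndepFun Y Z μ := h.comp measurable_snd measurable_id
  have h3 := Measure.compProd_congr (μ := μ.map Z)
    (κ := condDistrib X Z μ ×ₖ condDistrib Y Z μ)
    (η := Kernel.const δ ((μ.map X).prod (μ.map Y))) (by
      filter_upwards [condDistrib_of_indepFun μ hX hZ hXZ, condDistrib_of_indepFun μ hY hZ hYZ] with p h1 h2
      rw [Kernel.prod_apply, h1, h2]; rfl)
  have h4 : (μ.map fun ω => (Z ω, X ω, Y ω)) =
      μ.map Z ⊗ₘ Kernel.const δ (μ.map fun ω => (X ω, Y ω)) := by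
    rw [Measure.compProd_const]
    exact (indepFun_iff_map_prod_eq_prod_map_map hZ.aemeasurable (by fun_prop)).1 h.symm
  rw [condMutualInfo, h3, h4, Measure.compProd_const, Measure.compProd_const,
    ← klDiv_map_measurableEquiv _ _ MeasurableEquiv.prodComm]
  have h5 : ∀ (ν : Measure (α × β)) [IsProbabilityMeasure ν],
      ((μ.map Z).prod ν).map MeasurableEquiv.prodComm = ν ⊗ₘ Kernel.const _ (μ.map Z) := by
    intro ν _
    rw [Measure.compProd_const]
    exact Measure.prod_swap
  rw [h5, h5, klDiv_compProd_left]

end Info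


/-! ### Variational lower bound for the relative entropy -/

section Variational

open InformationTheory

theorem mul_sub_exp_le_klFun {r y : ℝ} (hr : 0 ≤ r) :
    r * y + 1 - Real.exp y ≤ klFun r := by
  rw [klFun_apply]
  rcases hr.eq_or_lt with rfl | hr
  · simp [Real.exp_nonneg]
  · have h := Real.add_one_le_exp (y - Real.log r)
    rw [Real.exp_sub, Real.exp_log hr, le_div_iff₀ hr] at h
    nlinarith

/-- The easy half of the Donsker–Varadhan formula. -/
theorem ofReal_integral_le_klDiv {α : Type*} [MeasurableSpace α] (μ ν : Measure α)
    [IsProbabilityMeasure μ] [IsProbabilityMeasure ν] {f : α → ℝ} (hf : Integrable f μ)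
    (hfm : Measurable f) (hν : ∫⁻ x, ENNReal.ofReal (Real.exp (f x)) ∂ν ≤ 1) :
    ENNReal.ofReal (∫ x, f x ∂μ) ≤ klDiv μ ν := by
  by_cases hac : μ ≪ ν
  swap
  · simp [klDiv_of_not_ac hac]
  by_cases hint : Integrable (llr μ ν) μ
  swap
  · simp [klDiv_of_not_integrable hint]
  have hk : Integrable (fun x => klFun (μ.rnDeriv ν x).toReal) ν :=
    (integrable_klFun_rnDeriv_iff hac).2 hint
  have he : Integrable (fun x => Real.exp (f x)) ν := by
    refine ⟨(by fun_prop : Measurable fun x => Real.exp (f x)).aestronglyMeasurable, ?_⟩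
    rw [hasFiniteIntegral_iff_ofReal (Filter.Eventually.of_forall fun x => (Real.exp_pos _).le)]
    exact hν.trans_lt ENNReal.one_lt_top
  have he1 : ∫ x, Real.exp (f x) ∂ν ≤ 1 := by
    rw [integral_eq_lintegral_of_nonneg_ae (Filter.Eventually.of_forall fun x =>
      (Real.exp_pos _).le) he.1]
    exact ENNReal.toReal_le_of_le_ofReal zero_le_one (by simpa using hν)
  have hrf : Integrable (fun x => (μ.rnDeriv ν x).toReal • f x) ν :=
    (integrable_rnDeriv_smul_iff hac).2 hf
  have hrf1 : Integrable (fun x => (μ.rnDeriv ν x).toReal • f x + 1) ν :=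
    hrf.add (integrable_const 1)
  have h1 : ∫ x, ((μ.rnDeriv ν x).toReal • f x + 1 - Real.exp (f x)) ∂ν ≤
      ∫ x, klFun (μ.rnDeriv ν x).toReal ∂ν :=
    integral_mono (hrf1.sub he) hk
      fun x => mul_sub_exp_le_klFun ENNReal.toReal_nonneg
  rw [integral_sub hrf1 he, integral_add hrf (integrable_const 1),
    integral_rnDeriv_smul hac] at h1
  rw [← ENNReal.ofReal_toReal (klDiv_ne_top hac hint), toReal_klDiv_eq_integral_klFun hac]
  refine ENNReal.ofReal_le_ofReal ?_
  simp at h1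
  linarith

/-- The relative entropy of a measure with log-density `f`. -/
theorem klDiv_withDensity_exp {α : Type*} [MeasurableSpace α] (μ ν : Measure α)
    [IsProbabilityMeasure μ] [IsProbabilityMeasure ν] {f : α → ℝ} (hf : Integrable f μ)
    (hfm : Measurable f) (h : μ = ν.withDensity fun x => ENNReal.ofReal (Real.exp (f x))) :
    klDiv μ ν = ENNReal.ofReal (∫ x, f x ∂μ) := by
  have hac : μ ≪ ν := h ▸ withDensity_absolutelyContinuous _ _
  have hd : μ.rnDeriv ν =ᵐ[ν] fun x => ENNReal.ofReal (Real.exp (f x)) := by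
    conv_lhs => rw [h]
    exact Measure.rnDeriv_withDensity ν (by fun_prop)
  have hl : llr μ ν =ᵐ[μ] f := by
    filter_upwards [hac.ae_le hd] with x hx
    rw [llr, hx, ENNReal.toReal_ofReal (Real.exp_nonneg _), Real.log_exp]
  rw [klDiv_of_ac_of_integrable hac (hf.congr hl.symm), integral_congr_ae hl]
  simp

end Variational


/-! ### Gaussian test functions -/

section GaussianTest

theorem gaussianReal_eq_withDensity_std (m : ℝ) {v : ℝ≥0} (hv : v ≠ 0) :
    gaussianReal m v = (gaussianReal 0 1).withDensity fun z =>
      ENNReal.ofReal (Real.exp (-(z - m) ^ 2 / (2 * v) + z ^ 2 / 2 - Real.log v / 2)) := by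
  rw [gaussianReal_of_var_ne_zero m hv, gaussianReal_of_var_ne_zero 0 one_ne_zero,
    ← withDensity_mul _ (measurable_gaussianPDF 0 1) (by fun_prop)]
  congr 1
  ext z
  rw [Pi.mul_apply, gaussianPDF, gaussianPDF, ← ENNReal.ofReal_mul (gaussianPDFReal_nonneg _ _ _)]
  congr 1
  have hv' : (0 : ℝ) < v := by positivity
  have h1 : √(2 * Real.pi * v) = √(2 * Real.pi) * √v :=
    Real.sqrt_mul (by positivity) _
  have h2 : Real.exp (Real.log v / 2) = √v := by
    rw [Real.sqrt_eq_rpow, Real.rpow_def_of_pos hv']; ring_nf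
  have h3 : -(z - m) ^ 2 / (2 * (v : ℝ)) + z ^ 2 / 2 - Real.log v / 2 =
    -(z - m) ^ 2 / (2 * v) + (-(-(z - 0) ^ 2 / (2 * ((1 : ℝ≥0) : ℝ))) + -(Real.log v / 2)) := by
    simp; ring
  have h4 : (0 : ℝ) < √v := Real.sqrt_pos.2 hv'
  rw [gaussianPDFReal, gaussianPDFReal, h1, h3, Real.exp_add, Real.exp_add, Real.exp_neg,
    Real.exp_neg, h2]
  have h5 := Real.exp_pos (-(z - 0) ^ 2 / (2 * ((1 : ℝ≥0) : ℝ)))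
  simp only [NNReal.coe_one, mul_one] at h5 ⊢
  field_simp

theorem pi_withDensity {ι : Type*} [Fintype ι] {α : ι → Type*} [∀ i, MeasurableSpace (α i)]
    (ν : ∀ i, Measure (α i)) [∀ i, IsProbabilityMeasure (ν i)] (d : ∀ i, α i → ℝ≥0∞)
    (hd : ∀ i, Measurable (d i)) [∀ i, SigmaFinite ((ν i).withDensity (d i))] :
    Measure.pi (fun i => (ν i).withDensity (d i)) =
      (Measure.pi ν).withDensity fun x => ∏ i, d i (x i) := by
  refine Measure.pi_eq fun s hs => ?_
  rw [withDensity_apply _ (MeasurableSet.univ_pi hs), ← lintegral_indicator (MeasurableSet.univ_pi hs)]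
  have h1 : (fun x => (Set.univ.pi s).indicator (fun x => ∏ i, d i (x i)) x) =
      fun x => ∏ i, (s i).indicator (d i) (x i) := by
    ext x
    by_cases hx : x ∈ Set.univ.pi s
    · rw [Set.indicator_of_mem hx]
      exact Finset.prod_congr rfl fun i _ => (Set.indicator_of_mem (hx i trivial) _).symm
    · rw [Set.indicator_of_notMem hx]
      obtain ⟨i, hi⟩ : ∃ i, x i ∉ s i := by simpa [Set.mem_pi] using hx
      exact (Finset.prod_eq_zero (Finset.mem_univ i) (Set.indicator_of_notMem hi _)).symm
  have h2 := lintegral_prod_eq_prod_lintegral_of_indepFun Finset.univ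
    (fun i (x : ∀ i, α i) => (s i).indicator (d i) (x i))
    (iIndepFun_pi (μ := ν) fun i => ((hd i).indicator (hs i)).aemeasurable)
    fun i => ((hd i).indicator (hs i)).comp (measurable_pi_apply i)
  rw [h1, h2]
  refine Finset.prod_congr rfl fun i _ => ?_
  rw [withDensity_apply _ (hs i), ← lintegral_indicator (hs i)]
  exact (measurePreserving_eval ν i).lintegral_comp ((hd i).indicator (hs i))

variable {r : ℕ}

/-- The log-density of `∏ₐ N(mₐ, sₐ)` with respect to the standard Gaussian law. -/
noncomputable def gaussLogDensity (s : Fin r → ℝ≥0) (m z : Fin r → ℝ) : ℝ :=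
  ∑ a, (-(z a - m a) ^ 2 / (2 * s a) + z a ^ 2 / 2 - Real.log (s a) / 2)

@[fun_prop]
theorem measurable_gaussLogDensity (s : Fin r → ℝ≥0) :
    Measurable fun p : (Fin r → ℝ) × (Fin r → ℝ) => gaussLogDensity s p.1 p.2 := by
  unfold gaussLogDensity
  fun_prop

theorem pi_gaussianReal_eq_withDensity {s : Fin r → ℝ≥0} (hs : ∀ a, s a ≠ 0) (m : Fin r → ℝ) :
    Measure.pi (fun a => gaussianReal (m a) (s a)) =
      (Measure.pi fun _ : Fin r => gaussianReal 0 1).withDensity fun z =>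
        ENNReal.ofReal (Real.exp (gaussLogDensity s m z)) := by
  have h : (fun a => gaussianReal (m a) (s a)) = fun a => (gaussianReal 0 1).withDensity fun z =>
      ENNReal.ofReal (Real.exp (-(z - m a) ^ 2 / (2 * s a) + z ^ 2 / 2 - Real.log (s a) / 2)) :=
    funext fun a => gaussianReal_eq_withDensity_std (m a) (hs a)
  have hσ : ∀ a, SigmaFinite ((gaussianReal 0 1).withDensity fun z => ENNReal.ofReal
      (Real.exp (-(z - m a) ^ 2 / (2 * s a) + z ^ 2 / 2 - Real.log (s a) / 2))) := fun a => by
    rw [← gaussianReal_eq_withDensity_std (m a) (hs a)]; infer_instance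
  rw [h, pi_withDensity _ _ fun a => by fun_prop]
  congr 1
  ext z
  rw [gaussLogDensity, Real.exp_sum, ENNReal.ofReal_prod_of_nonneg fun _ _ => (Real.exp_pos _).le]

theorem lintegral_exp_gaussLogDensity {s : Fin r → ℝ≥0} (hs : ∀ a, s a ≠ 0) (m : Fin r → ℝ) :
    ∫⁻ z, ENNReal.ofReal (Real.exp (gaussLogDensity s m z))
      ∂(Measure.pi fun _ : Fin r => gaussianReal 0 1) = 1 := by
  have h := congrArg (fun ν : Measure (Fin r → ℝ) => ν Set.univ)
    (pi_gaussianReal_eq_withDensity hs m)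
  simp only [withDensity_apply _ MeasurableSet.univ, Measure.restrict_univ, measure_univ] at h
  exact h.symm

variable {Ω : Type*} [MeasurableSpace Ω] {μ : Measure Ω} [IsProbabilityMeasure μ]

theorem integral_gaussLogDensity (s : Fin r → ℝ≥0) {M U : Fin r → Ω → ℝ}
    (hM : ∀ a, MemLp (M a) 2 μ) (hU : ∀ a, MemLp (U a) 2 μ) (hU1 : ∀ a, ∫ ω, U a ω ^ 2 ∂μ = 1) :
    Integrable (fun ω => gaussLogDensity s (fun a => M a ω) fun a => U a ω) μ ∧
    ∫ ω, gaussLogDensity s (fun a => M a ω) (fun a => U a ω) ∂μ =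
      ∑ a, (-(∫ ω, (U a ω - M a ω) ^ 2 ∂μ) / (2 * s a) + 1 / 2 - Real.log (s a) / 2) := by
  have h1 : ∀ a, Integrable (fun ω => -(U a ω - M a ω) ^ 2 / (2 * (s a : ℝ))) μ := fun a =>
    (((hU a).sub (hM a)).integrable_sq.neg).div_const _
  have h2 : ∀ a, Integrable (fun ω => U a ω ^ 2 / 2) μ := fun a =>
    (hU a).integrable_sq.div_const _
  have h12 : ∀ a, Integrable
      (fun ω => -(U a ω - M a ω) ^ 2 / (2 * (s a : ℝ)) + U a ω ^ 2 / 2) μ := fun a =>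
    (h1 a).add (h2 a)
  have h3 : ∀ a, Integrable (fun ω => -(U a ω - M a ω) ^ 2 / (2 * (s a : ℝ)) + U a ω ^ 2 / 2 -
      Real.log (s a) / 2) μ := fun a => (h12 a).sub (integrable_const _)
  refine ⟨integrable_finsetSum _ fun a _ => h3 a, ?_⟩
  simp only [gaussLogDensity]
  rw [integral_finsetSum _ fun a _ => h3 a]
  refine Finset.sum_congr rfl fun a _ => ?_
  rw [integral_sub (h12 a) (integrable_const _), integral_add (h1 a) (h2 a), integral_div,
    integral_div, integral_neg, hU1]
  simp

/-- Centred jointly Gaussian orthonormal variables are independent standard Gaussian. -/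
theorem map_eq_pi_std_of_orthonormal {U : Fin r → Ω → ℝ}
    (hG : HasGaussianLaw (fun ω a => U a ω) μ) {v : Fin r → ℝ≥0} (h0 : ∀ a, ∫ ω, U a ω ∂μ = 0)
    (h1 : ∀ a b, ∫ ω, U a ω * U b ω ∂μ = if a = b then (v a : ℝ) else 0) :
    μ.map (fun ω a => U a ω) = Measure.pi fun a => gaussianReal 0 (v a) := by
  have hL : ∀ a, MemLp (U a) 2 μ := fun a => (hG.eval a).memLp_two
  have hcov : ∀ a b, cov[U a, U b; μ] = if a = b then (v a : ℝ) else 0 := fun a b => by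
    rw [covariance_eq_sub (hL a) (hL b), h0, h0]
    simpa using h1 a b
  have hind : iIndepFun U μ := hG.iIndepFun_of_covariance_eq_zero fun a b hab => by
    rw [hcov, if_neg hab]
  rw [(iIndepFun_iff_map_fun_eq_pi_map fun a => (hL a).aemeasurable).1 hind]
  congr 1
  ext1 a
  rw [(hG.eval a).map_eq_gaussianReal, ← covariance_self (hL a).aemeasurable, hcov, h0, if_pos rfl,
    Real.toNNReal_coe]

end GaussianTest

/-! ### The Gaussian mutual information as a function of second moments -/

section GMI

open InformationTheory

variable {ι κ : Type*} [Fintype ι] [Fintype κ]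

/-- The matrix of second moments of a family of random variables. -/
noncomputable def secondMoment {Ω ι : Type*} [MeasurableSpace Ω] (μ : Measure Ω)
    (z : ι → Ω → ℝ) : Matrix ι ι ℝ :=
  Matrix.of fun i j => ∫ ω, z i ω * z j ω ∂μ

/-- The expectation of the Gaussian log-density for second moments `K`. -/
noncomputable def gmiValue {r : ℕ} (u : Fin r → ι → ℝ) (l : Fin r → κ → ℝ) (s : Fin r → ℝ≥0)
    (K : Matrix (ι ⊕ κ) (ι ⊕ κ) ℝ) : ℝ :=
  ∑ a, (-(Sum.elim (u a) (-l a) ⬝ᵥ K *ᵥ Sum.elim (u a) (-l a)) / (2 * s a) + 1 / 2 -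
    Real.log (s a) / 2)

/-- The mutual information of a Gaussian pair with second moments `K`, in variational form; `S` is
the block of `K` which belongs to the first component. -/
noncomputable def gmi (S : Matrix ι ι ℝ) (K : Matrix (ι ⊕ κ) (ι ⊕ κ) ℝ) : ℝ≥0∞ :=
  ⨆ (r : ℕ) (u : Fin r → ι → ℝ) (l : Fin r → κ → ℝ) (s : Fin r → ℝ≥0)
    (_ : ∀ a b, u a ⬝ᵥ S *ᵥ u b = if a = b then 1 else 0) (_ : ∀ a, s a ≠ 0),
    ENNReal.ofReal (gmiValue u l s K)

theorem continuous_gmiValue {r : ℕ} (u : Fin r → ι → ℝ) (l : Fin r → κ → ℝ) (s : Fin r → ℝ≥0) :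
    Continuous (gmiValue u l s) := by
  unfold gmiValue
  fun_prop

theorem lowerSemicontinuous_gmi (S : Matrix ι ι ℝ) :
    LowerSemicontinuous (gmi (κ := κ) S) := by
  unfold gmi
  refine lowerSemicontinuous_iSup fun r => lowerSemicontinuous_iSup fun u =>
    lowerSemicontinuous_iSup fun l => lowerSemicontinuous_iSup fun s =>
    lowerSemicontinuous_iSup fun _ => lowerSemicontinuous_iSup fun _ => ?_
  exact (ENNReal.continuous_ofReal.comp (continuous_gmiValue u l s)).lowerSemicontinuous

variable {Ω : Type*} [MeasurableSpace Ω] {μ : Measure Ω} [IsProbabilityMeasure μ]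

theorem integral_sum_mul_sum {z : ι → Ω → ℝ} (hz : ∀ i, MemLp (z i) 2 μ) (c d : ι → ℝ) :
    ∫ ω, (∑ i, c i * z i ω) * (∑ i, d i * z i ω) ∂μ = c ⬝ᵥ secondMoment μ z *ᵥ d := by
  have h1 : ∀ ω, (∑ i, c i * z i ω) * (∑ i, d i * z i ω) =
      ∑ i, ∑ j, c i * d j * (z i ω * z j ω) := fun ω => by
    rw [Finset.sum_mul_sum]
    exact Finset.sum_congr rfl fun i _ => Finset.sum_congr rfl fun j _ => by ring
  have h2 : ∀ i j, Integrable (fun ω => c i * d j * (z i ω * z j ω)) μ := fun i j =>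
    ((hz i).integrable_mul (hz j)).const_mul _
  simp_rw [h1]
  rw [integral_finsetSum _ fun i _ => integrable_finsetSum _ fun j _ => h2 i j]
  simp only [dotProduct, mulVec, Finset.mul_sum]
  refine Finset.sum_congr rfl fun i _ => ?_
  rw [integral_finsetSum _ fun j _ => h2 i j]
  refine Finset.sum_congr rfl fun j _ => ?_
  rw [integral_const_mul, secondMoment, Matrix.of_apply]
  ring

theorem memLp_sum_mul {z : ι → Ω → ℝ} (hz : ∀ i, MemLp (z i) 2 μ) (c : ι → ℝ) :
    MemLp (fun ω => ∑ i, c i * z i ω) 2 μ :=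
  memLp_finsetSum _ fun i _ => (hz i).const_mul _

theorem hasGaussianLaw_sum_mul {ι' : Type*} [Fintype ι'] {x : ι → Ω → ℝ}
    (hG : HasGaussianLaw (fun ω i => x i ω) μ)
    (u : ι' → ι → ℝ) : HasGaussianLaw (fun ω a => ∑ i, u a i * x i ω) μ := by
  let L : (ι → ℝ) →L[ℝ] (ι' → ℝ) := LinearMap.toContinuousLinearMap (Matrix.mulVecLin (of u))
  exact hG.map_fun L

theorem gmiValue_secondMoment {r : ℕ} {x : ι → Ω → ℝ} {y : κ → Ω → ℝ}
    (hx : ∀ i, MemLp (x i) 2 μ) (hy : ∀ j, MemLp (y j) 2 μ) (u : Fin r → ι → ℝ)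
    (l : Fin r → κ → ℝ) (s : Fin r → ℝ≥0) :
    gmiValue u l s (secondMoment μ (Sum.elim x y)) =
      ∑ a, (-(∫ ω, ((∑ i, u a i * x i ω) - ∑ j, l a j * y j ω) ^ 2 ∂μ) / (2 * s a) + 1 / 2 -
        Real.log (s a) / 2) := by
  unfold gmiValue
  refine Finset.sum_congr rfl fun a _ => ?_
  rw [← integral_sum_mul_sum (by rintro (i | j) <;> simp [hx, hy])]
  congr! 6 with ω
  simp [Fintype.sum_sum_type, sq, sub_eq_add_neg]

/-- Among all laws with given second moments and Gaussian first marginal, the Gaussian one has the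
least mutual information. -/
theorem gmi_le_klDiv {x : ι → Ω → ℝ} {y : κ → Ω → ℝ} (hxm : ∀ i, Measurable (x i))
    (hym : ∀ j, Measurable (y j)) (hy : ∀ j, MemLp (y j) 2 μ)
    (hG : HasGaussianLaw (fun ω i => x i ω) μ) (h0 : ∀ i, ∫ ω, x i ω ∂μ = 0) :
    gmi (secondMoment μ x) (secondMoment μ (Sum.elim x y)) ≤
      klDiv (μ.map fun ω => (fun i => x i ω, fun j => y j ω))
        ((μ.map fun ω i => x i ω).prod (μ.map fun ω j => y j ω)) := by
  have hx : ∀ i, MemLp (x i) 2 μ := fun i => (hG.eval i).memLp_two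
  have hxv : Measurable fun ω i => x i ω := measurable_pi_lambda _ hxm
  have hyv : Measurable fun ω j => y j ω := measurable_pi_lambda _ hym
  have := Measure.isProbabilityMeasure_map (μ := μ) hxv.aemeasurable
  have := Measure.isProbabilityMeasure_map (μ := μ) hyv.aemeasurable
  have := Measure.isProbabilityMeasure_map (μ := μ) (hxv.prodMk hyv).aemeasurable
  refine iSup_le fun r => iSup_le fun u => iSup_le fun l => iSup_le fun s => iSup_le fun hu =>
    iSup_le fun hs => ?_
  let f : (ι → ℝ) × (κ → ℝ) → ℝ := fun p =>
    gaussLogDensity s (fun a => ∑ j, l a j * p.2 j) fun a => ∑ i, u a i * p.1 i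
  have hf : Measurable f := (measurable_gaussLogDensity s).comp
    (f := fun p : (ι → ℝ) × (κ → ℝ) => (fun a => ∑ j, l a j * p.2 j, fun a => ∑ i, u a i * p.1 i))
    (by fun_prop)
  obtain ⟨hint, hval⟩ := integral_gaussLogDensity (μ := μ) s (fun a => memLp_sum_mul hy (l a))
    (fun a => memLp_sum_mul hx (u a)) fun a => by
      simp_rw [sq]
      rw [integral_sum_mul_sum hx, hu, if_pos rfl]
  rw [gmiValue_secondMoment hx hy, ← hval]
  have hmap : ∫ ω, gaussLogDensity s (fun a => ∑ j, l a j * y j ω)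
      (fun a => ∑ i, u a i * x i ω) ∂μ =
      ∫ p, f p ∂(μ.map fun ω => (fun i => x i ω, fun j => y j ω)) := by
    rw [integral_map (by fun_prop) hf.aestronglyMeasurable]
  rw [hmap]
  refine ofReal_integral_le_klDiv _ _ ?_ hf ?_
  · rw [integrable_map_measure hf.aestronglyMeasurable (by fun_prop)]
    exact hint
  · have hstd : (μ.map fun ω i => x i ω).map (fun p a => ∑ i, u a i * p i) =
        Measure.pi fun _ : Fin r => gaussianReal 0 1 := by
      rw [Measure.map_map (by fun_prop) hxv]
      refine map_eq_pi_std_of_orthonormal (U := fun a ω => ∑ i, u a i * x i ω)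
        (hasGaussianLaw_sum_mul hG u) (fun a => ?_) fun a b => ?_
      · rw [integral_finsetSum _ fun i _ => ((hx i).integrable (by norm_num)).const_mul _]
        exact Finset.sum_eq_zero fun i _ => by rw [integral_const_mul, h0, mul_zero]
      · rw [integral_sum_mul_sum hx, hu]; simp
    have hfe : Measurable fun p => ENNReal.ofReal (Real.exp (f p)) := by fun_prop
    rw [lintegral_prod_symm _ hfe.aemeasurable]
    have h1 : ∀ q : κ → ℝ, ∫⁻ p, ENNReal.ofReal (Real.exp (f (p, q))) ∂(μ.map fun ω i => x i ω) =
        1 := fun q => by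
      have hm : Measurable fun z : Fin r → ℝ =>
          ENNReal.ofReal (Real.exp (gaussLogDensity s (fun a => ∑ j, l a j * q j) z)) :=
        (Real.measurable_exp.comp ((measurable_gaussLogDensity s).comp
          (f := fun z : Fin r → ℝ => (fun a => ∑ j, l a j * q j, z))
          (by fun_prop))).ennreal_ofReal
      rw [← lintegral_exp_gaussLogDensity hs fun a => ∑ j, l a j * q j, ← hstd,
        lintegral_map hm (by fun_prop)]
    simp [h1]

end GMI


section Canonical

/-- Two finite families of vectors: the span of the first one has an orthonormal basis whose
residuals with respect to the span of the second one are orthogonal. -/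
theorem exists_canonical_basis {V ι κ : Type*} [NormedAddCommGroup V] [InnerProductSpace ℝ V]
    [Fintype ι] [Fintype κ] (x : ι → V) (y : κ → V) :
    ∃ (r : ℕ) (u : Fin r → ι → ℝ) (l : Fin r → κ → ℝ) (s : Fin r → ℝ≥0) (c : ι → Fin r → ℝ),
      (∀ a b, inner ℝ (∑ i, u a i • x i) (∑ i, u b i • x i) = if a = b then (1 : ℝ) else 0) ∧
      (∀ a j, inner ℝ ((∑ i, u a i • x i) - ∑ j, l a j • y j) (y j) = 0) ∧
      (∀ a b, inner ℝ ((∑ i, u a i • x i) - ∑ j, l a j • y j)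
        ((∑ i, u b i • x i) - ∑ j, l b j • y j) = if a = b then (s a : ℝ) else 0) ∧
      ∀ i, x i = ∑ a, c i a • ∑ k, u a k • x k := by
  classical
  set M := Submodule.span ℝ (Set.range x) with hM
  set N := Submodule.span ℝ (Set.range y) with hN
  have : FiniteDimensional ℝ M := FiniteDimensional.span_of_finite ℝ (Set.finite_range x)
  have : FiniteDimensional ℝ N := FiniteDimensional.span_of_finite ℝ (Set.finite_range y)
  have hx : ∀ i, x i ∈ M := fun i => Submodule.subset_span ⟨i, rfl⟩
  let P : V →L[ℝ] V := Nᗮ.starProjection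
  have hPsymm : ∀ v w, inner ℝ (P v) w = inner ℝ v (P w) := fun v w =>
    Submodule.starProjection_isSymmetric (K := Nᗮ) v w
  have hPidem : ∀ v, P (P v) = P v := fun v =>
    Submodule.starProjection_eq_self_iff.2 (Submodule.starProjection_apply_mem Nᗮ v)
  have hPinner : ∀ v w, inner ℝ (P v) (P w) = inner ℝ (P v) w := fun v w => by
    rw [← hPsymm, hPidem]
  let T : M →ₗ[ℝ] M := (M.orthogonalProjectionOnto : V →ₗ[ℝ] M) ∘ₗ (P : V →ₗ[ℝ] V) ∘ₗ M.subtype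
  have hTinner : ∀ m m' : M, inner ℝ (T m) m' = inner ℝ (P m) (m' : V) := fun m m' => by
    change inner ℝ (M.orthogonalProjectionOnto (P m)) m' = _
    exact Submodule.inner_orthogonalProjectionOnto_eq_of_mem_right m' (P m)
  have hT : T.IsSymmetric := fun m m' => by
    rw [hTinner, real_inner_comm, ← hPsymm, real_inner_comm (T m'), hTinner]
  let b := hT.eigenvectorBasis rfl
  have hb : ∀ a, ∃ u : ι → ℝ, ∑ i, u i • x i = (b a : V) := fun a =>
    (Submodule.mem_span_range_iff_exists_fun ℝ).1 (b a).2
  choose u hu using hb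
  have hl : ∀ a, ∃ l : κ → ℝ, ∑ j, l j • y j = N.starProjection (b a : V) := fun a =>
    (Submodule.mem_span_range_iff_exists_fun ℝ).1 (Submodule.starProjection_apply_mem N _)
  choose l hl using hl
  have hR : ∀ a, (b a : V) - N.starProjection (b a : V) = P (b a) := fun a => by
    rw [sub_eq_iff_eq_add']
    exact (Submodule.starProjection_add_starProjection_orthogonal _).symm
  refine ⟨_, u, l, fun a => (‖P (b a)‖ ^ 2).toNNReal, fun i a => inner ℝ (b a) (⟨x i, hx i⟩ : M), fun a a' => ?_, fun a j => ?_, fun a a' => ?_,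
    fun i => ?_⟩
  · rw [hu, hu]
    exact orthonormal_iff_ite.1 b.orthonormal a a'
  · rw [hu, hl, hR]
    exact Submodule.inner_left_of_mem_orthogonal (Submodule.subset_span (Set.mem_range_self j))
      (Submodule.starProjection_apply_mem Nᗮ _)
  · rw [hu, hl, hR, hu, hl, hR]
    split_ifs with h
    · subst h
      rw [real_inner_self_eq_norm_sq, Real.coe_toNNReal _ (sq_nonneg _)]
    · rw [hPinner, ← hTinner, hT.apply_eigenvectorBasis, inner_smul_left,
        orthonormal_iff_ite.1 b.orthonormal a a', if_neg h, mul_zero]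
  · have h := congrArg (Subtype.val) (b.sum_repr' (⟨x i, hx i⟩ : M))
    simp only [hu]
    simpa using h.symm

end Canonical

section GaussianMI

open InformationTheory

variable {ι κ : Type*} [Fintype ι] [Fintype κ]
  {Ω : Type*} [MeasurableSpace Ω] {μ : Measure Ω} [IsProbabilityMeasure μ]

theorem toLp_sum_smul {z : ι → Ω → ℝ} (hz : ∀ i, MemLp (z i) 2 μ) (c : ι → ℝ) :
    (memLp_sum_mul hz c).toLp (fun ω => ∑ i, c i * z i ω) =
      ∑ i, c i • (hz i).toLp (z i) := by
  rw [Lp.ext_iff]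
  refine (MemLp.coeFn_toLp _).trans ?_
  have h1 : ∀ᵐ ω ∂μ, ∀ i, (hz i).toLp (z i) ω = z i ω :=
    ae_all_iff.2 fun i => MemLp.coeFn_toLp (hz i)
  have h2 : ∀ᵐ ω ∂μ, ∀ i, (c i • (hz i).toLp (z i) : Lp ℝ 2 μ) ω = c i • (hz i).toLp (z i) ω :=
    ae_all_iff.2 fun i => Lp.coeFn_smul _ _
  filter_upwards [h1, h2, Lp.coeFn_finsetSum Finset.univ fun i => c i • (hz i).toLp (z i)]
    with ω h1 h2 h3
  rw [h3]
  simp [h1, h2]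

theorem inner_toLp_eq_integral {f g : Ω → ℝ} (hf : MemLp f 2 μ) (hg : MemLp g 2 μ) :
    inner ℝ (hf.toLp f) (hg.toLp g) = ∫ ω, f ω * g ω ∂μ := by
  rw [L2.inner_def]
  refine integral_congr_ae ?_
  filter_upwards [hf.coeFn_toLp, hg.coeFn_toLp] with ω h1 h2
  rw [h1, h2]
  simp [mul_comm]

theorem exists_canonical_variables {x : ι → Ω → ℝ} {y : κ → Ω → ℝ}
    (hx : ∀ i, MemLp (x i) 2 μ) (hy : ∀ j, MemLp (y j) 2 μ) :
    ∃ (r : ℕ) (u : Fin r → ι → ℝ) (l : Fin r → κ → ℝ) (s : Fin r → ℝ≥0) (c : ι → Fin r → ℝ),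
      (∀ a b, ∫ ω, (∑ i, u a i * x i ω) * (∑ i, u b i * x i ω) ∂μ = if a = b then (1 : ℝ) else 0) ∧
      (∀ a j, ∫ ω, ((∑ i, u a i * x i ω) - ∑ j, l a j * y j ω) * y j ω ∂μ = 0) ∧
      (∀ a b, ∫ ω, ((∑ i, u a i * x i ω) - ∑ j, l a j * y j ω) *
        ((∑ i, u b i * x i ω) - ∑ j, l b j * y j ω) ∂μ = if a = b then (s a : ℝ) else 0) ∧
      ∀ i, x i =ᵐ[μ] fun ω => ∑ a, c i a * ∑ k, u a k * x k ω := by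
  obtain ⟨r, u, l, s, c, h1, h2, h3, h4⟩ :=
    exists_canonical_basis (fun i => (hx i).toLp (x i)) (fun j => (hy j).toLp (y j))
  have hU := fun a => memLp_sum_mul hx (u a)
  have hM := fun a => memLp_sum_mul hy (l a)
  simp only [← toLp_sum_smul, ← MemLp.toLp_sub] at h1 h2 h3
  refine ⟨r, u, l, s, c, fun a b => ?_, fun a j => ?_, fun a b => ?_, fun i => ?_⟩
  · rw [← h1, inner_toLp_eq_integral]
  · rw [← h2 a j, inner_toLp_eq_integral]; rfl
  · rw [← h3 a b, inner_toLp_eq_integral]; rfl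
  · have h := h4 i
    simp only [← toLp_sum_smul hx] at h
    rw [← toLp_sum_smul hU] at h
    exact (MemLp.toLp_eq_toLp_iff _ _).1 h

/-- The mutual information of a centred Gaussian pair is at most its variational form. -/
theorem klDiv_le_gmi {x : ι → Ω → ℝ} {y : κ → Ω → ℝ} (hxm : ∀ i, Measurable (x i))
    (hym : ∀ j, Measurable (y j))
    (hG : HasGaussianLaw (fun ω (k : ι ⊕ κ) => Sum.elim x y k ω) μ)
    (hx0 : ∀ i, ∫ ω, x i ω ∂μ = 0) (hy0 : ∀ j, ∫ ω, y j ω ∂μ = 0) :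
    klDiv (μ.map fun ω => (fun i => x i ω, fun j => y j ω))
        ((μ.map fun ω i => x i ω).prod (μ.map fun ω j => y j ω)) ≤
      gmi (secondMoment μ x) (secondMoment μ (Sum.elim x y)) := by
  have hx : ∀ i, MemLp (x i) 2 μ := fun i => (hG.eval (Sum.inl i)).memLp_two
  have hy : ∀ j, MemLp (y j) 2 μ := fun j => (hG.eval (Sum.inr j)).memLp_two
  obtain ⟨r, u, l, s, c, h1, h2, h3, h4⟩ := exists_canonical_variables hx hy
  have hU := fun a => memLp_sum_mul hx (u a)
  have hM := fun a => memLp_sum_mul hy (l a)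
  have hu : ∀ a b, u a ⬝ᵥ secondMoment μ x *ᵥ u b = if a = b then 1 else 0 := fun a b => by
    rw [← integral_sum_mul_sum hx, h1]
  have hsq : ∀ a, ∫ ω, ((∑ i, u a i * x i ω) - ∑ j, l a j * y j ω) ^ 2 ∂μ = s a := fun a => by
    simp_rw [sq, h3, if_true]
  have hle : ∀ s' : Fin r → ℝ≥0, (∀ a, s' a ≠ 0) →
      ENNReal.ofReal (∑ a, (-(s a : ℝ) / (2 * s' a) + 1 / 2 - Real.log (s' a) / 2)) ≤
        gmi (secondMoment μ x) (secondMoment μ (Sum.elim x y)) := fun s' hs' => by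
    have h := gmiValue_secondMoment hx hy u l s'
    simp only [hsq] at h
    rw [← h]
    exact le_iSup_of_le r <| le_iSup_of_le u <| le_iSup_of_le l <| le_iSup_of_le s' <|
      le_iSup_of_le hu <| le_iSup_of_le hs' le_rfl
  by_cases hs : ∀ a, s a ≠ 0
  swap
  · -- a degenerate direction makes the variational form infinite
    push Not at hs
    obtain ⟨a₀, ha₀⟩ := hs
    have htop : gmi (secondMoment μ x) (secondMoment μ (Sum.elim x y)) = ∞ := by
      refine ENNReal.eq_top_of_forall_nnreal_le fun C => ?_
      let D : ℝ := ∑ a, if s a = 0 then (0 : ℝ) else (-(s a : ℝ) / (2 * s a) + 1 / 2 - Real.log (s a) / 2)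
      let ε : ℝ≥0 := ⟨Real.exp (-2 * (C + |D|)), (Real.exp_pos _).le⟩
      have hε : ε ≠ 0 := by
        rw [← NNReal.coe_ne_zero]; exact (Real.exp_pos _).ne'
      have hlog : Real.log ε = -2 * (C + |D|) := Real.log_exp _
      refine le_trans ?_ (hle (fun a => if s a = 0 then ε else s a) fun a => by
        split_ifs with h
        · exact hε
        · exact h)
      rw [← ENNReal.ofReal_coe_nnreal]
      refine ENNReal.ofReal_le_ofReal ?_
      have hsum : ∑ a, (-(s a : ℝ) / (2 * (if s a = 0 then ε else s a : ℝ≥0)) + 1 / 2 -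
          Real.log (if s a = 0 then ε else s a : ℝ≥0) / 2) =
          D + ∑ a, if s a = 0 then (1 / 2 - Real.log ε / 2) else 0 := by
        rw [← Finset.sum_add_distrib]
        refine Finset.sum_congr rfl fun a _ => ?_
        split_ifs with h <;> simp [h]
      have hterm : (1 / 2 - Real.log ε / 2) ≤
          ∑ a, if s a = 0 then (1 / 2 - Real.log ε / 2) else 0 := by
        have hn : 0 ≤ 1 / 2 - Real.log ε / 2 := by
          rw [hlog]; have := abs_nonneg D; have := C.2; nlinarith [NNReal.coe_nonneg C]
        have := Finset.single_le_sum (f := fun a => if s a = 0 then (1 / 2 - Real.log ε / 2) else 0)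
          (fun a _ => by split_ifs; exacts [hn, le_rfl]) (Finset.mem_univ a₀)
        simpa [ha₀] using this
      rw [hsum]
      have := neg_abs_le D
      rw [hlog] at hterm
      rw [hlog]
      linarith
    rw [htop]; exact le_top
  have hxv : Measurable fun ω i => x i ω := measurable_pi_lambda _ hxm
  have hyv : Measurable fun ω j => y j ω := measurable_pi_lambda _ hym
  let U : Ω → Fin r → ℝ := fun ω a => ∑ i, u a i * x i ω
  let M : (κ → ℝ) → Fin r → ℝ := fun q a => ∑ j, l a j * q j
  let R : Ω → Fin r → ℝ := fun ω a => (∑ i, u a i * x i ω) - ∑ j, l a j * y j ω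
  have hMm : Measurable M := by fun_prop
  have hUm : Measurable U := by fun_prop
  have hRm : Measurable R := by fun_prop
  have := Measure.isProbabilityMeasure_map (μ := μ) hxv.aemeasurable
  have := Measure.isProbabilityMeasure_map (μ := μ) hyv.aemeasurable
  have := Measure.isProbabilityMeasure_map (μ := μ) hUm.aemeasurable
  have := Measure.isProbabilityMeasure_map (μ := μ) (hUm.prodMk hyv).aemeasurable
  have := Measure.isProbabilityMeasure_map (μ := μ) (hxv.prodMk hyv).aemeasurable
  -- reduction to the canonical variables
  let Cm : (Fin r → ℝ) → ι → ℝ := fun z i => ∑ a, c i a * z a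
  have hCm : Measurable Cm := by fun_prop
  have hxU : (fun ω i => x i ω) =ᵐ[μ] fun ω => Cm (U ω) := by
    filter_upwards [ae_all_iff.2 h4] with ω h
    exact funext h
  have hred : klDiv (μ.map fun ω => (fun i => x i ω, fun j => y j ω))
        ((μ.map fun ω i => x i ω).prod (μ.map fun ω j => y j ω)) ≤
      klDiv (μ.map fun ω => (U ω, fun j => y j ω)) ((μ.map U).prod (μ.map fun ω j => y j ω)) := by
    refine le_trans (le_of_eq ?_) (klDiv_map_le _ _ (g := Prod.map Cm id) (by fun_prop))
    have e1 : (μ.map fun ω i => x i ω) = (μ.map U).map Cm := by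
      rw [Measure.map_congr hxU, Measure.map_map hCm hUm]; rfl
    have e2 : (μ.map fun ω => (fun i => x i ω, fun j => y j ω)) =
        (μ.map fun ω => (U ω, fun j => y j ω)).map (Prod.map Cm id) := by
      rw [Measure.map_map (by fun_prop) (by fun_prop),
        Measure.map_congr (hxU.prodMk (Filter.EventuallyEq.refl _ _))]; rfl
    rw [e1, e2]
    congr 1
    rw [← Measure.map_prod_map _ _ hCm measurable_id, Measure.map_id]
  refine hred.trans ?_
  -- laws of the canonical variables
  have hxG : HasGaussianLaw (fun ω i => x i ω) μ := by
    let L : (ι ⊕ κ → ℝ) →L[ℝ] (ι → ℝ) := ContinuousLinearMap.pi fun i => .proj (Sum.inl i)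
    exact hG.map_fun L
  have hx0' : ∀ a, ∫ ω, ∑ i, u a i * x i ω ∂μ = 0 := fun a => by
    rw [integral_finsetSum _ fun i _ => ((hx i).integrable (by norm_num)).const_mul _]
    exact Finset.sum_eq_zero fun i _ => by rw [integral_const_mul, hx0, mul_zero]
  have hy0' : ∀ a, ∫ ω, ∑ j, l a j * y j ω ∂μ = 0 := fun a => by
    rw [integral_finsetSum _ fun i _ => ((hy i).integrable (by norm_num)).const_mul _]
    exact Finset.sum_eq_zero fun i _ => by rw [integral_const_mul, hy0, mul_zero]
  have hR0 : ∀ a, ∫ ω, R ω a ∂μ = 0 := fun a => by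
    rw [integral_sub ((hU a).integrable (by norm_num)) ((hM a).integrable (by norm_num)), hx0',
      hy0', sub_zero]
  have hUstd : μ.map U = Measure.pi fun _ : Fin r => gaussianReal 0 1 :=
    map_eq_pi_std_of_orthonormal (U := fun a ω => U ω a) (v := fun _ => 1)
      (hasGaussianLaw_sum_mul hxG u) hx0' fun a b => by rw [h1]; simp
  have hRY : HasGaussianLaw (fun ω => (R ω, fun j => y j ω)) μ := by
    let L : (ι ⊕ κ → ℝ) →L[ℝ] (Fin r → ℝ) × (κ → ℝ) := ContinuousLinearMap.prod
      (ContinuousLinearMap.pi fun a => (∑ i, u a i • .proj (Sum.inl i)) -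
        ∑ j, l a j • .proj (Sum.inr j))
      (ContinuousLinearMap.pi fun j => .proj (Sum.inr j))
    have hL : (fun ω => (R ω, fun j => y j ω)) = fun ω => L fun k => Sum.elim x y k ω := by
      ext ω a <;> simp [L, R]
    rw [hL]
    exact hG.map_fun L
  have hRlaw : μ.map R = Measure.pi fun a => gaussianReal 0 (s a) :=
    map_eq_pi_std_of_orthonormal (U := fun a ω => R ω a) hRY.fst hR0 h3
  have hRind : IndepFun R (fun ω j => y j ω) μ := by
    refine HasGaussianLaw.indepFun_of_covariance_eval (X := fun a ω => R ω a) hRY fun a j => ?_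
    rw [covariance_eq_sub (X := fun ω => R ω a) ((hU a).sub (hM a)) (hy j)]
    have e1 : μ[(fun ω => R ω a) * y j] = 0 := h2 a j
    have e2 : μ[fun ω => R ω a] = 0 := hR0 a
    rw [e1, e2]; simp
  -- the density of the joint law
  let f : (Fin r → ℝ) × (κ → ℝ) → ℝ := fun p => gaussLogDensity s (M p.2) p.1
  have hf : Measurable f := (measurable_gaussLogDensity s).comp
    (f := fun p : (Fin r → ℝ) × (κ → ℝ) => (M p.2, p.1)) (by fun_prop)
  have hdens : (μ.map fun ω => (U ω, fun j => y j ω)) =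
      ((μ.map U).prod (μ.map fun ω j => y j ω)).withDensity
        fun p => ENNReal.ofReal (Real.exp (f p)) := by
    refine Measure.ext_of_lintegral _ fun g hg => ?_
    have hshift : ∀ m : Fin r → ℝ, (Measure.pi fun a => gaussianReal 0 (s a)).map (fun z => z + m) =
        Measure.pi fun a => gaussianReal (m a) (s a) := fun m => by
      have h := Measure.pi_map_pi (μ := fun a => gaussianReal 0 (s a))
        (f := fun a z => z + m a) fun a => by fun_prop
      simp only [gaussianReal_map_add_const, zero_add] at h
      exact h
    have hUR : (fun ω => (U ω, fun j => y j ω)) =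
        (fun p : (Fin r → ℝ) × (κ → ℝ) => (p.1 + M p.2, p.2)) ∘ fun ω => (R ω, fun j => y j ω) := by
      ext ω a <;> simp [U, R, M]
    have hadd : Measurable fun p : (Fin r → ℝ) × (κ → ℝ) => (p.1 + M p.2, p.2) := by fun_prop
    rw [hUR, ← Measure.map_map hadd (hRm.prodMk hyv),
      (indepFun_iff_map_prod_eq_prod_map_map hRm.aemeasurable hyv.aemeasurable).1 hRind, hRlaw,
      lintegral_map hg hadd, lintegral_prod_symm (fun p => g (p.1 + M p.2, p.2)) (hg.comp hadd).aemeasurable,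
      lintegral_withDensity_eq_lintegral_mul _ (by fun_prop) hg,
      lintegral_prod_symm _ (by fun_prop)]
    refine lintegral_congr fun q => ?_
    have hgq : Measurable fun z => g (z, q) := by fun_prop
    have e1 : ∫⁻ z, g (z + M q, q) ∂(Measure.pi fun a => gaussianReal 0 (s a)) =
        ∫⁻ z, g (z, q) ∂(Measure.pi fun a => gaussianReal (M q a) (s a)) := by
      rw [← hshift (M q), lintegral_map hgq (by fun_prop)]
    have hfq : Measurable fun z : Fin r → ℝ => ENNReal.ofReal (Real.exp (gaussLogDensity s (M q) z)) :=
      (Real.measurable_exp.comp (hf.comp (f := fun z => (z, q)) (by fun_prop))).ennreal_ofReal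
    rw [e1, pi_gaussianReal_eq_withDensity hs, lintegral_withDensity_eq_lintegral_mul _ hfq hgq,
      hUstd]
    rfl
  obtain ⟨hint, hval⟩ := integral_gaussLogDensity (μ := μ) s hM hU fun a => by
    simp_rw [sq, h1, if_true]
  have hfint : Integrable f (μ.map fun ω => (U ω, fun j => y j ω)) := by
    rw [integrable_map_measure hf.aestronglyMeasurable (by fun_prop)]
    exact hint
  rw [klDiv_withDensity_exp _ _ hfint hf hdens, integral_map (by fun_prop) hf.aestronglyMeasurable]
  refine le_trans (le_of_eq ?_) (hle s hs)
  congr 1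
  refine hval.trans ?_
  simp only [hsq]

end GaussianMI


/-! ### Gaussian regression -/

section Regression

variable {Ω : Type*} [MeasurableSpace Ω] {μ : Measure Ω} [IsProbabilityMeasure μ]

theorem indepFun_prodMk_of_indepFun {α β γ : Type*} [MeasurableSpace α] [MeasurableSpace β]
    [MeasurableSpace γ] {a : Ω → α} {b : Ω → β} {c : Ω → γ} (ha : AEMeasurable a μ)
    (hb : AEMeasurable b μ) (hc : AEMeasurable c μ) (hab : IndepFun a b μ)
    (habc : IndepFun (fun ω => (a ω, b ω)) c μ) : IndepFun a (fun ω => (b ω, c ω)) μ := by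
  have hbc : IndepFun b c μ := habc.comp measurable_snd measurable_id
  have := Measure.isProbabilityMeasure_map (μ := μ) ha
  have := Measure.isProbabilityMeasure_map (μ := μ) hb
  have := Measure.isProbabilityMeasure_map (μ := μ) hc
  rw [indepFun_iff_map_prod_eq_prod_map_map ha (hb.prodMk hc),
    (indepFun_iff_map_prod_eq_prod_map_map hb hc).1 hbc]
  have h1 := (indepFun_iff_map_prod_eq_prod_map_map (ha.prodMk hb) hc).1 habc
  rw [(indepFun_iff_map_prod_eq_prod_map_map ha hb).1 hab] at h1
  have h2 := congrArg (Measure.map MeasurableEquiv.prodAssoc) h1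
  rw [AEMeasurable.map_map_of_aemeasurable (MeasurableEquiv.measurable _).aemeasurable
    ((ha.prodMk hb).prodMk hc), Measure.prodAssoc_prod] at h2
  exact h2

/-- The Moore–Penrose form of the normal equations. -/
theorem crossMoment_mul_pinv_mul {ι κ : Type*} [Fintype κ] [DecidableEq κ]
    {x : ι → Ω → ℝ} {y : κ → Ω → ℝ} (hx : ∀ i, MemLp (x i) 2 μ) (hy : ∀ j, MemLp (y j) 2 μ) :
    (Matrix.of fun i j => ∫ ω, x i ω * y j ω ∂μ) * pinv (secondMoment μ y) * secondMoment μ y =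
      Matrix.of fun i j => ∫ ω, x i ω * y j ω ∂μ := by
  set C := secondMoment μ y with hC
  set S : Matrix ι κ ℝ := Matrix.of fun i j => ∫ ω, x i ω * y j ω ∂μ with hS
  have hker : ∀ d : κ → ℝ, C *ᵥ d = 0 → S *ᵥ d = 0 := fun d hd => by
    have h1 : ∫ ω, (∑ k, d k * y k ω) * (∑ k, d k * y k ω) ∂μ = 0 := by
      rw [integral_sum_mul_sum hy, ← hC, hd, dotProduct_zero]
    have h2 : (fun ω => (∑ k, d k * y k ω) * (∑ k, d k * y k ω)) =ᵐ[μ] 0 :=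
      (integral_eq_zero_iff_of_nonneg (fun ω => mul_self_nonneg _)
        ((memLp_sum_mul hy d).integrable_mul (memLp_sum_mul hy d))).1 h1
    ext i
    have h3 : ∫ ω, x i ω * ∑ k, d k * y k ω ∂μ = 0 := by
      rw [← integral_zero Ω ℝ (μ := μ)]
      refine integral_congr_ae ?_
      filter_upwards [h2] with ω hω
      rw [mul_self_eq_zero.1 hω, mul_zero]
    simp_rw [Finset.mul_sum] at h3
    have h4 : ∀ k, Integrable (fun ω => x i ω * (d k * y k ω)) μ := fun k =>
      (hx i).integrable_mul ((hy k).const_mul (d k))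
    rw [integral_finsetSum _ fun k _ => h4 k] at h3
    simp only [mulVec, dotProduct, hS, Matrix.of_apply, Pi.zero_apply]
    rw [← h3]
    refine Finset.sum_congr rfl fun k _ => ?_
    rw [← integral_mul_const]
    exact integral_congr_ae (Filter.Eventually.of_forall fun ω => by simp only; ring)
  have hN : C * (1 - pinv C * C) = 0 := by
    rw [Matrix.mul_sub, Matrix.mul_one, ← Matrix.mul_assoc, (pinv_spec C).mul_mul_left, sub_self]
  have hSN : S * (1 - pinv C * C) = 0 := by
    ext i j
    have h := hker ((1 - pinv C * C).col j) (by
      ext k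
      exact congrFun (congrFun hN k) j)
    exact congrFun h i
  rw [Matrix.mul_sub, Matrix.mul_one, sub_eq_zero, ← Matrix.mul_assoc] at hSN
  exact hSN.symm

/-- The action of a matrix as a continuous linear map. -/
noncomputable def actL {ι κ : Type*} [Fintype ι] [Fintype κ] (M : Matrix ι κ ℝ) :
    EuclideanSpace ℝ κ →L[ℝ] EuclideanSpace ℝ ι :=
  LinearMap.toContinuousLinearMap
    { toFun := act M
      map_add' := fun x y => by ext i; simp [act, mulVec_add]
      map_smul' := fun c x => by ext i; simp [act, mulVec_smul] }

@[simp]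
theorem actL_apply {ι κ : Type*} [Fintype ι] [Fintype κ] (M : Matrix ι κ ℝ)
    (x : EuclideanSpace ℝ κ) : actL M x = act M x := rfl

@[fun_prop]
theorem measurable_act {ι κ : Type*} [Fintype ι] [Fintype κ] (M : Matrix ι κ ℝ) :
    Measurable (act M) := (actL M).continuous.measurable

/-- Vanishing mixed second moments. -/
def Uncorr {E F : Type*} [NormedAddCommGroup E] [NormedSpace ℝ E] [NormedAddCommGroup F]
    [NormedSpace ℝ F] (μ : Measure Ω) (U : Ω → E) (Y : Ω → F) : Prop :=
  ∀ (ℓ₁ : E →L[ℝ] ℝ) (ℓ₂ : F →L[ℝ] ℝ), ∫ ω, ℓ₁ (U ω) * ℓ₂ (Y ω) ∂μ = 0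

variable {E F : Type*} [NormedAddCommGroup E] [NormedSpace ℝ E] [FiniteDimensional ℝ E]
  [MeasurableSpace E] [BorelSpace E] [NormedAddCommGroup F] [NormedSpace ℝ F]
  [FiniteDimensional ℝ F] [MeasurableSpace F] [BorelSpace F]

theorem indepFun_of_uncorr {U : Ω → E} {Y : Ω → F} (h : HasGaussianLaw (fun ω => (U ω, Y ω)) μ)
    (hU0 : ∫ ω, U ω ∂μ = 0) (hUY : Uncorr μ U Y) : IndepFun U Y μ := by
  have : CompleteSpace E := FiniteDimensional.complete ℝ E
  have : CompleteSpace F := FiniteDimensional.complete ℝ F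
  have : ProperSpace E := FiniteDimensional.proper ℝ E
  have : ProperSpace F := FiniteDimensional.proper ℝ F
  refine h.indepFun_of_covariance_strongDual fun ℓ₁ ℓ₂ => ?_
  have h1 : ∫ ω, ℓ₁ (U ω) ∂μ = 0 := by
    rw [ContinuousLinearMap.integral_comp_comm ℓ₁ h.fst.integrable, hU0, map_zero]
  have h2 : μ[ℓ₁ ∘ U] = 0 := h1
  have h3 : μ[(ℓ₁ ∘ U) * (ℓ₂ ∘ Y)] = 0 := hUY ℓ₁ ℓ₂
  rw [covariance_eq_sub (h.fst.map ℓ₁).memLp_two (h.snd.map ℓ₂).memLp_two, h2, h3]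
  simp

theorem hasGaussianLaw_eval {ι : Type*} [Fintype ι] {U : Ω → EuclideanSpace ℝ ι}
    (h : HasGaussianLaw U μ) (i : ι) : MemLp (fun ω => U ω i) 2 μ :=
  (h.map_fun (EuclideanSpace.proj i)).memLp_two

/-- The residual of the Moore–Penrose regression is independent of the regressor. -/
theorem indepFun_sub_act_pinv {ι κ : Type*} [Fintype ι] [Fintype κ] [DecidableEq κ]
    {U : Ω → EuclideanSpace ℝ ι} {Y : Ω → EuclideanSpace ℝ κ}
    (h : HasGaussianLaw (fun ω => (U ω, Y ω)) μ) (hU0 : ∫ ω, U ω ∂μ = 0)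
    (hY0 : ∫ ω, Y ω ∂μ = 0) :
    IndepFun (fun ω => U ω - act ((Matrix.of fun i j => ∫ ω, U ω i * Y ω j ∂μ) *
      pinv (secondMoment μ fun j ω => Y ω j)) (Y ω)) Y μ := by
  set S : Matrix ι κ ℝ := Matrix.of fun i j => ∫ ω, U ω i * Y ω j ∂μ with hS
  set C := secondMoment μ fun j ω => Y ω j with hC
  have hU := hasGaussianLaw_eval h.fst
  have hY := hasGaussianLaw_eval h.snd
  let L : EuclideanSpace ℝ ι × EuclideanSpace ℝ κ →L[ℝ]
      EuclideanSpace ℝ ι × EuclideanSpace ℝ κ :=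
    (ContinuousLinearMap.fst ℝ _ _ - (actL (S * pinv C)).comp (ContinuousLinearMap.snd ℝ _ _)).prod
      (ContinuousLinearMap.snd ℝ _ _)
  have hL : HasGaussianLaw (fun ω => (U ω - act (S * pinv C) (Y ω), Y ω)) μ := h.map_fun L
  refine indepFun_of_uncorr hL ?_ ?_
  · have hi : Integrable (fun ω => act (S * pinv C) (Y ω)) μ :=
      (actL (S * pinv C)).integrable_comp h.snd.integrable
    rw [integral_sub h.fst.integrable hi, hU0, zero_sub]
    have := ContinuousLinearMap.integral_comp_comm (actL (S * pinv C)) h.snd.integrable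
    rw [hY0, map_zero] at this
    rw [neg_eq_zero]
    exact this
  · have key : ∀ i j, ∫ ω, (U ω - act (S * pinv C) (Y ω)) i * Y ω j ∂μ = 0 := fun i j => by
      have h1 : ∀ ω, (U ω - act (S * pinv C) (Y ω)) i * Y ω j =
          U ω i * Y ω j - ∑ k, (S * pinv C) i k * (Y ω k * Y ω j) := fun ω => by
        simp only [PiLp.sub_apply, act, mulVec, dotProduct, sub_mul, Finset.sum_mul]
        congr 1
        exact Finset.sum_congr rfl fun k _ => by ring
      have h2 : ∀ k, Integrable (fun ω => (S * pinv C) i k * (Y ω k * Y ω j)) μ := fun k =>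
        ((hY k).integrable_mul (hY j)).const_mul _
      have h4 : Integrable (fun ω => U ω i * Y ω j) μ := (hU i).integrable_mul (hY j)
      simp_rw [h1]
      rw [integral_sub h4 (integrable_finsetSum _ fun k _ => h2 k),
        integral_finsetSum _ fun k _ => h2 k]
      simp_rw [integral_const_mul]
      have h3 := congrFun (congrFun (crossMoment_mul_pinv_mul hU hY) i) j
      rw [sub_eq_zero]
      exact h3.symm
    have hRi : ∀ i, MemLp (fun ω => (U ω - act (S * pinv C) (Y ω)) i) 2 μ :=
      hasGaussianLaw_eval hL.fst
    classical
    intro ℓ₁ ℓ₂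
    have e1 : ∀ z : EuclideanSpace ℝ ι, ℓ₁ z = ∑ i, z i * ℓ₁ (EuclideanSpace.single i 1) := fun z => by
      conv_lhs => rw [← (EuclideanSpace.basisFun ι ℝ).sum_repr z]
      simp
    have e2 : ∀ z : EuclideanSpace ℝ κ, ℓ₂ z = ∑ i, z i * ℓ₂ (EuclideanSpace.single i 1) := fun z => by
      conv_lhs => rw [← (EuclideanSpace.basisFun κ ℝ).sum_repr z]
      simp
    have e3 : ∀ ω, ℓ₁ (U ω - act (S * pinv C) (Y ω)) * ℓ₂ (Y ω) = ∑ i, ∑ j,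
        ((U ω - act (S * pinv C) (Y ω)) i * Y ω j) *
          (ℓ₁ (EuclideanSpace.single i 1) * ℓ₂ (EuclideanSpace.single j 1)) := fun ω => by
      rw [e1, e2, Finset.sum_mul_sum]
      exact Finset.sum_congr rfl fun i _ => Finset.sum_congr rfl fun j _ => by ring
    simp_rw [e3]
    have e4 : ∀ i j, Integrable (fun ω => ((U ω - act (S * pinv C) (Y ω)) i * Y ω j) *
          (ℓ₁ (EuclideanSpace.single i 1) * ℓ₂ (EuclideanSpace.single j 1))) μ := fun i j =>
      ((hRi i).integrable_mul (hY j)).mul_const _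
    rw [integral_finsetSum _ fun i _ => integrable_finsetSum _ fun j _ => e4 i j]
    refine Finset.sum_eq_zero fun i _ => ?_
    rw [integral_finsetSum _ fun j _ => e4 i j]
    refine Finset.sum_eq_zero fun j _ => ?_
    rw [integral_mul_const, key, zero_mul]

/-- Linear regression of a Gaussian vector on another one. -/
theorem exists_regression {U : Ω → E} {Y : Ω → F} (h : HasGaussianLaw (fun ω => (U ω, Y ω)) μ)
    (hU0 : ∫ ω, U ω ∂μ = 0) (hY0 : ∫ ω, Y ω ∂μ = 0) :
    ∃ T : F →L[ℝ] E, IndepFun (fun ω => U ω - T (Y ω)) Y μ := by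
  have : CompleteSpace E := FiniteDimensional.complete ℝ E
  have : CompleteSpace F := FiniteDimensional.complete ℝ F
  have : ProperSpace E := FiniteDimensional.proper ℝ E
  have : ProperSpace F := FiniteDimensional.proper ℝ F
  let e : E ≃L[ℝ] EuclideanSpace ℝ (Fin (Module.finrank ℝ E)) := toEuclidean
  let f : F ≃L[ℝ] EuclideanSpace ℝ (Fin (Module.finrank ℝ F)) := toEuclidean
  let ef : E × F →L[ℝ] EuclideanSpace ℝ (Fin (Module.finrank ℝ E)) ×
      EuclideanSpace ℝ (Fin (Module.finrank ℝ F)) :=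
    (e : E →L[ℝ] EuclideanSpace ℝ (Fin (Module.finrank ℝ E))).prodMap
      (f : F →L[ℝ] EuclideanSpace ℝ (Fin (Module.finrank ℝ F)))
  have h' : HasGaussianLaw (fun ω => (e (U ω), f (Y ω))) μ := h.map_fun ef
  have hind := indepFun_sub_act_pinv h'
    (by rw [ContinuousLinearEquiv.integral_comp_comm, hU0, map_zero])
    (by rw [ContinuousLinearEquiv.integral_comp_comm, hY0, map_zero])
  set M := (Matrix.of fun i j => ∫ ω, e (U ω) i * f (Y ω) j ∂μ) *
      pinv (secondMoment μ fun j ω => f (Y ω) j)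
  refine ⟨(e.symm : _ →L[ℝ] E).comp ((actL M).comp (f : F →L[ℝ] _)), ?_⟩
  have h2 := hind.comp (φ := e.symm) (ψ := f.symm) e.symm.continuous.measurable
    f.symm.continuous.measurable
  convert! h2 using 1
  · ext ω; simp
  · ext ω; simp

/-- Conditional expectation given `Y` of a vector with residual independent of `Y`. -/
theorem condExp_eq_of_indepFun_sub {δ : Type*} [MeasurableSpace δ] {U : Ω → E} {Y : Ω → δ}
    (hU : Integrable U μ) (hUm : Measurable U) (hY : Measurable Y) {T : δ → E} (hT : Measurable T)
    (hTi : Integrable (fun ω => T (Y ω)) μ)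
    (h : IndepFun (fun ω => U ω - T (Y ω)) Y μ) (h0 : ∫ ω, (U ω - T (Y ω)) ∂μ = 0) :
    μ[U | MeasurableSpace.comap Y inferInstance] =ᵐ[μ] fun ω => T (Y ω) := by
  have : CompleteSpace E := FiniteDimensional.complete ℝ E
  have : ProperSpace E := FiniteDimensional.proper ℝ E
  have hle : MeasurableSpace.comap Y inferInstance ≤ (inferInstance : MeasurableSpace Ω) :=
    hY.comap_le
  have hRm : Measurable fun ω => U ω - T (Y ω) := by fun_prop
  have h1 : μ[fun ω => U ω - T (Y ω) | MeasurableSpace.comap Y inferInstance] =ᵐ[μ]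
      fun _ => ∫ ω, (U ω - T (Y ω)) ∂μ :=
    condExp_indep_eq hRm.comap_le hle
      (comap_measurable (fun ω => U ω - T (Y ω))).stronglyMeasurable h
  have h2 : μ[fun ω => T (Y ω) | MeasurableSpace.comap Y inferInstance] = fun ω => T (Y ω) :=
    condExp_of_stronglyMeasurable hle (hT.comp (comap_measurable Y)).stronglyMeasurable hTi
  have h3 := condExp_add (hU.sub hTi) hTi (MeasurableSpace.comap Y inferInstance)
  have h4 : U - (fun ω => T (Y ω)) + (fun ω => T (Y ω)) = U := by ext ω; simp
  rw [h4, h2] at h3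
  filter_upwards [h1, h3] with ω h1 h3
  rw [h3, Pi.add_apply]
  have h5 : (μ[U - fun ω => T (Y ω) | MeasurableSpace.comap Y inferInstance]) ω = 0 := by
    rw [← h0, ← h1]; rfl
  rw [h5, zero_add]

/-- Centred Gaussian laws are determined by second moments. -/
theorem isGaussian_ext {μ ν : Measure E} [IsGaussian μ] [IsGaussian ν] (hμ : ∫ x, x ∂μ = 0)
    (hν : ∫ x, x ∂ν = 0) (h : ∀ ℓ : E →L[ℝ] ℝ, ∫ x, ℓ x ^ 2 ∂μ = ∫ x, ℓ x ^ 2 ∂ν) : μ = ν := by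
  have : CompleteSpace E := FiniteDimensional.complete ℝ E
  have : ProperSpace E := FiniteDimensional.proper ℝ E
  refine Measure.ext_of_charFunDual (funext fun ℓ => ?_)
  have key : ∀ (ρ : Measure E) [IsGaussian ρ], ∫ x, x ∂ρ = 0 →
      charFunDual ρ ℓ = Complex.exp (- ((∫ x, ℓ x ^ 2 ∂ρ : ℝ) : ℂ) / 2) := fun ρ _ h0 => by
    have h1 : ∫ x, ℓ x ∂ρ = 0 := by
      have := ContinuousLinearMap.integral_comp_comm ℓ (IsGaussian.integrable_id (μ := ρ))
      simp only [id_eq] at this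
      rw [this, h0, map_zero]
    have h2 : Var[ℓ; ρ] = ∫ x, ℓ x ^ 2 ∂ρ := by
      rw [variance_eq_sub (IsGaussian.memLp_dual ρ ℓ 2 (by norm_num)), h1]
      simp
    rw [IsGaussian.charFunDual_eq, h2]
    have h3 : ρ[fun x => (ℓ x : ℂ)] = ((∫ x, ℓ x ∂ρ : ℝ) : ℂ) := integral_complex_ofReal
    rw [h3, h1]
    simp [neg_div]
  rw [key μ hμ, key ν hν, h]

end Regression

/-- `U` is almost surely a linear function of `ξ`. -/
def LinearOf {Ω E F : Type*} [MeasurableSpace Ω] [NormedAddCommGroup E] [NormedSpace ℝ E]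
    [NormedAddCommGroup F] [NormedSpace ℝ F] (μ : Measure Ω) (ξ : Ω → E) (U : Ω → F) : Prop :=
  ∃ L : E →L[ℝ] F, U =ᵐ[μ] fun ω => L (ξ ω)

namespace LinearOf

variable {Ω E F F' : Type*} [MeasurableSpace Ω] [NormedAddCommGroup E] [NormedSpace ℝ E]
    [NormedAddCommGroup F] [NormedSpace ℝ F] [NormedAddCommGroup F'] [NormedSpace ℝ F']
    {μ : Measure Ω} {ξ : Ω → E} {U : Ω → F} {U' : Ω → F'}

theorem of_map (L : E →L[ℝ] F) : LinearOf μ ξ fun ω => L (ξ ω) := ⟨L, Filter.EventuallyEq.refl _ _⟩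

theorem congr (h : LinearOf μ ξ U) {U₂ : Ω → F} (hU : U₂ =ᵐ[μ] U) : LinearOf μ ξ U₂ :=
  let ⟨L, hL⟩ := h; ⟨L, hU.trans hL⟩

theorem map (h : LinearOf μ ξ U) (M : F →L[ℝ] F') : LinearOf μ ξ fun ω => M (U ω) := by
  obtain ⟨L, hL⟩ := h
  refine ⟨M.comp L, ?_⟩
  filter_upwards [hL] with ω hω
  rw [hω]; rfl

theorem prodMk (h : LinearOf μ ξ U) (h' : LinearOf μ ξ U') :
    LinearOf μ ξ fun ω => (U ω, U' ω) := by
  obtain ⟨L, hL⟩ := h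
  obtain ⟨L', hL'⟩ := h'
  refine ⟨L.prod L', ?_⟩
  filter_upwards [hL, hL'] with ω h1 h2
  rw [h1, h2]; rfl

theorem refl : LinearOf μ ξ ξ := of_map (ContinuousLinearMap.id ℝ E)

theorem fst (h : LinearOf μ ξ fun ω => (U ω, U' ω)) : LinearOf μ ξ U :=
  h.map (ContinuousLinearMap.fst ℝ F F')

theorem snd (h : LinearOf μ ξ fun ω => (U ω, U' ω)) : LinearOf μ ξ U' :=
  h.map (ContinuousLinearMap.snd ℝ F F')

theorem add (h : LinearOf μ ξ U) {U₂ : Ω → F} (h' : LinearOf μ ξ U₂) :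
    LinearOf μ ξ fun ω => U ω + U₂ ω :=
  (h.prodMk h').map (ContinuousLinearMap.fst ℝ F F + ContinuousLinearMap.snd ℝ F F)

theorem sub (h : LinearOf μ ξ U) {U₂ : Ω → F} (h' : LinearOf μ ξ U₂) :
    LinearOf μ ξ fun ω => U ω - U₂ ω :=
  (h.prodMk h').map (ContinuousLinearMap.fst ℝ F F - ContinuousLinearMap.snd ℝ F F)

theorem trans {E' : Type*} [NormedAddCommGroup E'] [NormedSpace ℝ E'] {ζ : Ω → E'}
    (h : LinearOf μ ξ U) (h' : LinearOf μ ζ ξ) : LinearOf μ ζ U := by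
  obtain ⟨L, hL⟩ := h
  exact (h'.map L).congr hL

variable [MeasurableSpace E] [BorelSpace E] [MeasurableSpace F] [BorelSpace F]

theorem hasGaussianLaw (h : LinearOf μ ξ U) (hξ : HasGaussianLaw ξ μ) : HasGaussianLaw U μ :=
  let ⟨L, hL⟩ := h; (hξ.map_fun L).congr hL.symm

theorem integral_eq_zero [CompleteSpace E] [CompleteSpace F] (h : LinearOf μ ξ U)
    (hξ : Integrable ξ μ) (h0 : ∫ ω, ξ ω ∂μ = 0) :
    ∫ ω, U ω ∂μ = 0 := by
  obtain ⟨L, hL⟩ := h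
  rw [integral_congr_ae hL, ContinuousLinearMap.integral_comp_comm L hξ, h0, map_zero]

theorem indepFun_right {G : Type*} [MeasurableSpace G] {V : Ω → G} (h : LinearOf μ ξ U)
    (hV : IndepFun V ξ μ) : IndepFun V U μ := by
  obtain ⟨L, hL⟩ := h
  exact (hV.comp measurable_id L.continuous.measurable).congr (Filter.EventuallyEq.refl _ _) hL.symm

end LinearOf


/-! ### Segments of processes -/

section Segments

variable {Ω E : Type*}

/-- Initial part of a segment. -/
def segInit {a s t : ℕ} (h : s ≤ t) (x : Finset.Icc a t → E) : Finset.Icc a s → E :=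
  fun r => x ⟨r, Finset.Icc_subset_Icc_right h r.2⟩

/-- A segment with one more value appended. -/
def segSnoc {a t : ℕ} (p : (Finset.Icc a t → E) × E) : Finset.Icc a (t + 1) → E := fun r =>
  if h : (r : ℕ) ≤ t then p.1 ⟨r, Finset.mem_Icc.2 ⟨(Finset.mem_Icc.1 r.2).1, h⟩⟩ else p.2

theorem segSnoc_seg (X : ℕ → Ω → E) (a t : ℕ) (ω : Ω) :
    segSnoc (seg X a t ω, X (t + 1) ω) = seg X a (t + 1) ω := by
  funext r
  simp only [segSnoc, seg]
  split_ifs with h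
  · rfl
  · have : (r : ℕ) = t + 1 := by
      have := (Finset.mem_Icc.1 r.2).2
      omega
    rw [this]

variable [MeasurableSpace E]

theorem measurable_seg [MeasurableSpace Ω] {X : ℕ → Ω → E} {a b : ℕ}
    (h : ∀ t ∈ Finset.Icc a b, Measurable (X t)) : Measurable (seg X a b) :=
  measurable_pi_lambda _ fun t => h t t.2

theorem measurable_seg_of_le [MeasurableSpace Ω] {X : ℕ → Ω → E} {a b c : ℕ} (hbc : b ≤ c)
    (h : ∀ t ∈ Finset.Icc a c, Measurable (X t)) : Measurable (seg X a b) :=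
  measurable_seg fun t ht => h t (Finset.Icc_subset_Icc_right hbc ht)

@[fun_prop]
theorem measurable_segInit {a s t : ℕ} (h : s ≤ t) :
    Measurable (segInit h : (Finset.Icc a t → E) → (Finset.Icc a s → E)) :=
  measurable_pi_lambda _ fun _ => measurable_pi_apply _

@[fun_prop]
theorem measurable_segSnoc {a t : ℕ} :
    Measurable (segSnoc : (Finset.Icc a t → E) × E → Finset.Icc a (t + 1) → E) := by
  refine measurable_pi_lambda _ fun r => ?_
  by_cases h : (r : ℕ) ≤ t
  · simp only [segSnoc, h, dite_true]
    fun_prop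
  · simp only [segSnoc, h, dite_false]
    fun_prop

end Segments

theorem LinearOf.pi {Ω E ι : Type*} [Fintype ι] {F : ι → Type*} [MeasurableSpace Ω]
    [NormedAddCommGroup E] [NormedSpace ℝ E] [∀ i, NormedAddCommGroup (F i)]
    [∀ i, NormedSpace ℝ (F i)] {μ : Measure Ω} {ξ : Ω → E} {U : ∀ i, Ω → F i}
    (h : ∀ i, LinearOf μ ξ (U i)) : LinearOf μ ξ fun ω i => U i ω := by
  choose L hL using h
  refine ⟨ContinuousLinearMap.pi L, ?_⟩
  filter_upwards [ae_all_iff.2 hL] with ω hω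
  funext i
  exact hω i

theorem LinearOf.seg {Ω E F : Type*} [MeasurableSpace Ω]
    [NormedAddCommGroup E] [NormedSpace ℝ E] [NormedAddCommGroup F]
    [NormedSpace ℝ F] {μ : Measure Ω} {ξ : Ω → E} {U : ℕ → Ω → F} {a b : ℕ}
    (h : ∀ r ∈ Finset.Icc a b, LinearOf μ ξ (U r)) : LinearOf μ ξ (seg U a b) :=
  LinearOf.pi (U := fun r : Finset.Icc a b => U r) fun r => h r r.2

theorem LinearOf.of_seg {Ω E F : Type*} [MeasurableSpace Ω]
    [NormedAddCommGroup E] [NormedSpace ℝ E] [NormedAddCommGroup F]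
    [NormedSpace ℝ F] {μ : Measure Ω} {ξ : Ω → E} {U : ℕ → Ω → F} {a b r : ℕ}
    (h : LinearOf μ ξ (JointNRDF.seg U a b)) (hr : r ∈ Finset.Icc a b) : LinearOf μ ξ (U r) :=
  h.map (ContinuousLinearMap.proj (R := ℝ) (φ := fun _ : Finset.Icc a b => F) ⟨r, hr⟩)

section Estimates

variable {Ω : Type*} [MeasurableSpace Ω] {μ : Measure Ω} [IsProbabilityMeasure μ]
variable {E F : Type*} [NormedAddCommGroup E] [NormedSpace ℝ E] [FiniteDimensional ℝ E]
  [MeasurableSpace E] [BorelSpace E] [NormedAddCommGroup F] [NormedSpace ℝ F]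
  [FiniteDimensional ℝ F] [MeasurableSpace F] [BorelSpace F]

/-- The conditional mean of a centred Gaussian pair is linear, with independent residual. -/
theorem exists_condExp_eq {U : Ω → E} {Y : Ω → F} (h : HasGaussianLaw (fun ω => (U ω, Y ω)) μ)
    (hU : Measurable U) (hY : Measurable Y) (hU0 : ∫ ω, U ω ∂μ = 0) (hY0 : ∫ ω, Y ω ∂μ = 0) :
    ∃ T : F →L[ℝ] E, μ[U | MeasurableSpace.comap Y inferInstance] =ᵐ[μ] (fun ω => T (Y ω)) ∧
      IndepFun (fun ω => U ω - T (Y ω)) Y μ := by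
  have : CompleteSpace E := FiniteDimensional.complete ℝ E
  have : CompleteSpace F := FiniteDimensional.complete ℝ F
  have : ProperSpace E := FiniteDimensional.proper ℝ E
  have : ProperSpace F := FiniteDimensional.proper ℝ F
  obtain ⟨T, hT⟩ := exists_regression h hU0 hY0
  have hTi : Integrable (fun ω => T (Y ω)) μ := T.integrable_comp h.snd.integrable
  refine ⟨T, condExp_eq_of_indepFun_sub h.fst.integrable hU hY T.continuous.measurable hTi hT ?_, hT⟩
  rw [integral_sub h.fst.integrable hTi, hU0, zero_sub, neg_eq_zero,
    ContinuousLinearMap.integral_comp_comm T h.snd.integrable, hY0, map_zero]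

theorem condExp_indepFun {U : Ω → E} {δ : Type*} [MeasurableSpace δ] {Y : Ω → δ}
    (hU : Measurable U) (hY : Measurable Y) (hU0 : ∫ ω, U ω ∂μ = 0) (h : IndepFun U Y μ) :
    μ[U | MeasurableSpace.comap Y inferInstance] =ᵐ[μ] 0 := by
  have : CompleteSpace E := FiniteDimensional.complete ℝ E
  have : ProperSpace E := FiniteDimensional.proper ℝ E
  have := condExp_indep_eq hU.comap_le hY.comap_le
    (comap_measurable U).stronglyMeasurable h
  rw [hU0] at this
  exact this

theorem integral_prod_eq_zero {U : Ω → E} {Y : Ω → F} (hU : Integrable U μ) (hY : Integrable Y μ)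
    (hU0 : ∫ ω, U ω ∂μ = 0) (hY0 : ∫ ω, Y ω ∂μ = 0) : ∫ ω, (U ω, Y ω) ∂μ = 0 := by
  have : CompleteSpace E := FiniteDimensional.complete ℝ E
  have : CompleteSpace F := FiniteDimensional.complete ℝ F
  rw [integral_pair hU hY, hU0, hY0]; rfl

theorem map_prod_of_indepFun {α β γ : Type*} [MeasurableSpace α] [MeasurableSpace β]
    [MeasurableSpace γ] {Z : Ω → α} {V : Ω → β} (hZ : Measurable Z) (hV : Measurable V)
    (h : IndepFun Z V μ) {φ : α × β → γ} (hφ : Measurable φ) :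
    μ.map (fun ω => (Z ω, φ (Z ω, V ω))) =
      μ.map Z ⊗ₘ (Kernel.id ×ₖ Kernel.const α (μ.map V)).map φ := by
  have := Measure.isProbabilityMeasure_map (μ := μ) hZ.aemeasurable
  have := Measure.isProbabilityMeasure_map (μ := μ) hV.aemeasurable
  have h1 := (indepFun_iff_map_prod_eq_prod_map_map hZ.aemeasurable hV.aemeasurable).1 h
  have h2 : μ.map (fun ω => (Z ω, φ (Z ω, V ω))) =
      (μ.map fun ω => (Z ω, V ω)).map (fun p => (p.1, φ p)) := by
    rw [Measure.map_map (by fun_prop) (by fun_prop)]; rfl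
  rw [h2, h1]
  refine Measure.ext_of_lintegral _ fun f hf => ?_
  rw [MeasureTheory.lintegral_map hf (by fun_prop), lintegral_prod _ (by fun_prop),
    Measure.lintegral_compProd hf]
  refine lintegral_congr fun a => ?_
  rw [Kernel.map_apply _ hφ, MeasureTheory.lintegral_map (by fun_prop) hφ, Kernel.prod_apply,
    Kernel.id_apply, Kernel.const_apply, Measure.dirac_prod,
    MeasureTheory.lintegral_map (f := fun p : α × β => f (a, φ p)) (by fun_prop)
      measurable_prodMk_left]

theorem id_prod_const_map_apply {α β γ : Type*} [MeasurableSpace α] [MeasurableSpace β]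
    [MeasurableSpace γ] (ν : Measure β) [IsProbabilityMeasure ν] {φ : α × β → γ}
    (hφ : Measurable φ) (a : α) :
    (Kernel.id ×ₖ Kernel.const α ν).map φ a = ν.map fun v => φ (a, v) := by
  rw [Kernel.map_apply _ hφ, Kernel.prod_apply, Kernel.id_apply, Kernel.const_apply,
    Measure.dirac_prod, Measure.map_map hφ (by fun_prop)]
  rfl

theorem multivariateGaussian_eq_map {ι : Type*} [Fintype ι] [DecidableEq ι]
    (m : EuclideanSpace ℝ ι) (Q : Matrix ι ι ℝ) :
    multivariateGaussian m Q = (multivariateGaussian 0 Q).map fun v => m + v := by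
  rw [multivariateGaussian, multivariateGaussian, Measure.map_map (by fun_prop) (by fun_prop)]
  congr 1
  funext x
  simp

theorem integral_eq_zero_of_map {ι : Type*} [Fintype ι] [DecidableEq ι] {U : Ω → EuclideanSpace ℝ ι}
    (hU : Measurable U) {Q : Matrix ι ι ℝ} (h : μ.map U = multivariateGaussian 0 Q) :
    ∫ ω, U ω ∂μ = 0 := by
  have h1 := integral_map (μ := μ) hU.aemeasurable (f := fun x => x) (by fun_prop)
  rw [← h1, h, integral_id_multivariateGaussian]

theorem hasGaussianLaw_of_map {ι : Type*} [Fintype ι] [DecidableEq ι] {U : Ω → EuclideanSpace ℝ ι}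
    {Q : Matrix ι ι ℝ} (h : μ.map U = multivariateGaussian 0 Q) : HasGaussianLaw U μ := by
  have : IsGaussian (μ.map U) := by rw [h]; infer_instance
  exact IsGaussian.hasGaussianLaw

end Estimates


/-! ### The driving noise of a realization -/

section Driver

variable {Ω : Type*} [MeasurableSpace Ω] {μ : Measure Ω} [IsProbabilityMeasure μ]
  {p₁ p₂ q₁ q₂ n : ℕ}

/-- The primitive variables `(X_1, W_2, …, W_s)`, `(V_1, …, V_t)`. -/
def driver (X : ℕ → Ω → Vec p₁ p₂) (W : ℕ → Ω → Vec q₁ q₂) (V : ℕ → Ω → Vec p₁ p₂) (s t : ℕ)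
    (ω : Ω) : (Vec p₁ p₂ × (Finset.Icc 2 s → Vec q₁ q₂)) × (Finset.Icc 1 t → Vec p₁ p₂) :=
  ((X 1 ω, seg W 2 s ω), seg V 1 t ω)

theorem indepFun_seg_succ {E : Type*} [MeasurableSpace E] {U : ℕ → Ω → E} {a n t : ℕ}
    (hU : ∀ r ∈ Finset.Icc a n, Measurable (U r)) (h : iIndepFun (fun s : Finset.Icc a n => U s) μ)
    (ht : t + 1 ∈ Finset.Icc a n) : IndepFun (U (t + 1)) (seg U a t) μ := by
  classical
  have hle : t ≤ n := by have := Finset.mem_Icc.1 ht; omega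
  let S : Finset (Finset.Icc a n) := {⟨t + 1, ht⟩}
  let T : Finset (Finset.Icc a n) := Finset.univ.filter fun r => (r : ℕ) ≤ t
  have hST : Disjoint S T := by
    rw [Finset.disjoint_left]
    intro r hr hr'
    rw [Finset.mem_singleton.1 hr] at hr'
    have := (Finset.mem_filter.1 hr').2
    simp at this
  have h1 := h.indepFun_finset S T hST fun r => hU r r.2
  have hm : Measurable fun x : S → E => x ⟨⟨t + 1, ht⟩, Finset.mem_singleton_self _⟩ :=
    measurable_pi_apply _
  exact h1.comp (φ := fun x => x ⟨⟨t + 1, ht⟩, Finset.mem_singleton_self _⟩)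
    (ψ := fun x (r : Finset.Icc a t) =>
      x ⟨⟨r, Finset.Icc_subset_Icc_right hle r.2⟩,
        Finset.mem_filter.2 ⟨Finset.mem_univ _, (Finset.mem_Icc.1 r.2).2⟩⟩)
    hm (by fun_prop)

variable {X : ℕ → Ω → Vec p₁ p₂} {W : ℕ → Ω → Vec q₁ q₂} {V : ℕ → Ω → Vec p₁ p₂}

theorem linearOf_driver_X {s t : ℕ} : LinearOf μ (driver X W V s t) (X 1) :=
  (LinearOf.refl (μ := μ) (ξ := driver X W V s t)).fst.fst

theorem linearOf_driver_W {r s t : ℕ} (hr : r ∈ Finset.Icc 2 s) :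
    LinearOf μ (driver X W V s t) (W r) :=
  (LinearOf.refl (μ := μ) (ξ := driver X W V s t)).fst.snd.of_seg hr

theorem linearOf_driver_V {r s t : ℕ} (hr : r ∈ Finset.Icc 1 t) :
    LinearOf μ (driver X W V s t) (V r) :=
  (LinearOf.refl (μ := μ) (ξ := driver X W V s t)).snd.of_seg hr

theorem linearOf_driver_driver {s t s' t' : ℕ} (hs : s ≤ s') (ht : t ≤ t') :
    LinearOf μ (driver X W V s' t') (driver X W V s t) :=
  (linearOf_driver_X.prodMk (LinearOf.seg fun _ hr =>
    linearOf_driver_W (Finset.Icc_subset_Icc_right hs hr))).prodMk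
    (LinearOf.seg fun _ hr => linearOf_driver_V (Finset.Icc_subset_Icc_right ht hr))

variable {A : ℕ → SqMat p₁ p₂} {B : ℕ → Matrix (Fin p₁ ⊕ Fin p₂) (Fin q₁ ⊕ Fin q₂) ℝ}
  {QX : SqMat p₁ p₂} {QW : ℕ → SqMat q₁ q₂} {H QV : ℕ → SqMat p₁ p₂} {Y : ℕ → Ω → Vec p₁ p₂}

section Source

variable (hn : 1 ≤ n) (hM : IsGaussMarkov μ n A B QX QW X W)
include hn hM

theorem IsGaussMarkov.hasGaussianLaw_pair : HasGaussianLaw (fun ω => (X 1 ω, seg W 2 n ω)) μ := by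
  refine hM.indep_X_W.hasGaussianLaw (hasGaussianLaw_of_map hM.law_X) ?_
  exact hM.indep_W.hasGaussianLaw fun s => hasGaussianLaw_of_map (hM.law_W s s.2)

theorem IsGaussMarkov.integral_pair_eq_zero : ∫ ω, (X 1 ω, seg W 2 n ω) ∂μ = 0 := by
  have h := hM.hasGaussianLaw_pair hn
  refine integral_prod_eq_zero h.fst.integrable h.snd.integrable
    (integral_eq_zero_of_map (hM.measurable_X 1 (Finset.mem_Icc.2 ⟨le_rfl, hn⟩)) hM.law_X) ?_
  funext s
  rw [eval_integral fun s => (h.snd.eval s).integrable]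
  exact integral_eq_zero_of_map (hM.measurable_W s s.2) (hM.law_W s s.2)

theorem IsGaussMarkov.linearOf_pair {t : ℕ} (ht : t ∈ Finset.Icc 1 n) :
    LinearOf μ (fun ω => (X 1 ω, seg W 2 t ω)) (X t) := by
  obtain ⟨h1, h2⟩ := Finset.mem_Icc.1 ht
  clear ht
  induction t, h1 using Nat.le_induction with
  | base => exact LinearOf.refl.fst
  | succ t ht ih =>
    have h0 : LinearOf μ (fun ω => (X 1 ω, seg W 2 (t + 1) ω))
      (fun ω => (X 1 ω, seg W 2 (t + 1) ω)) := LinearOf.refl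
    have h3 : LinearOf μ (fun ω => (X 1 ω, seg W 2 (t + 1) ω)) (X t) :=
      (ih (by omega)).trans (h0.fst.prodMk (LinearOf.seg fun r hr =>
        h0.snd.of_seg (Finset.Icc_subset_Icc_right (Nat.le_succ t) hr)))
    have h4 : LinearOf μ (fun ω => (X 1 ω, seg W 2 (t + 1) ω)) (W (t + 1)) :=
      h0.snd.of_seg (Finset.mem_Icc.2 ⟨by omega, le_rfl⟩)
    exact ((h3.map (actL (A t))).add (h4.map (actL (B t)))).congr
      (hM.recursion t (Finset.mem_Icc.2 ⟨ht, by omega⟩))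

theorem IsGaussMarkov.linearOf_driver {r s t : ℕ} (hr : r ∈ Finset.Icc 1 s) (hs : s ≤ n) :
    LinearOf μ (driver X W V s t) (X r) :=
  (hM.linearOf_pair hn (Finset.Icc_subset_Icc_right hs hr)).trans
    (linearOf_driver_X.prodMk (LinearOf.seg fun _ hu =>
      linearOf_driver_W (Finset.Icc_subset_Icc_right (Finset.mem_Icc.1 hr).2 hu)))

theorem IsGaussMarkov.indepFun_W {t : ℕ} (ht : t + 1 ∈ Finset.Icc 2 n) :
    IndepFun (W (t + 1)) (fun ω => (X 1 ω, seg W 2 t ω)) μ := by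
  have htn : t ≤ n := by have := (Finset.mem_Icc.1 ht).2; omega
  have hWt : Measurable (seg W 2 t) := measurable_seg_of_le htn hM.measurable_W
  have hX1 := hM.measurable_X 1 (Finset.mem_Icc.2 ⟨le_rfl, hn⟩)
  have h1 := indepFun_seg_succ hM.measurable_W hM.indep_W ht
  have h2 : IndepFun (fun ω => (W (t + 1) ω, seg W 2 t ω)) (X 1) μ :=
    hM.indep_X_W.symm.comp (φ := fun v => (v ⟨t + 1, ht⟩, segInit htn v)) (by fun_prop)
      measurable_id
  exact (indepFun_prodMk_of_indepFun (hM.measurable_W _ ht).aemeasurable hWt.aemeasurable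
    hX1.aemeasurable h1 h2).comp measurable_id measurable_swap

end Source

/-- `V_t ∼ N(0, QV_t)`, and `V_1, …, V_n` are independent of one another and, jointly, of
`(X_1, W_2, …, W_n)`. -/
structure IsNoise (μ : Measure Ω) (n : ℕ) (QV : ℕ → SqMat p₁ p₂) (X : ℕ → Ω → Vec p₁ p₂)
    (W : ℕ → Ω → Vec q₁ q₂) (V : ℕ → Ω → Vec p₁ p₂) : Prop where
  measurable_V : ∀ t ∈ Finset.Icc 1 n, Measurable (V t)
  posSemidef_QV : ∀ t ∈ Finset.Icc 1 n, (QV t).PosSemidef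
  law_V : ∀ t ∈ Finset.Icc 1 n, μ.map (V t) = multivariateGaussian 0 (QV t)
  indep_V : iIndepFun (fun (s : Finset.Icc 1 n) => V s) μ
  indep_V_XW : IndepFun (seg V 1 n) (fun ω => (X 1 ω, seg W 2 n ω)) μ

theorem IsRealization.isNoise (hR : IsRealization μ n H QV X W V Y) : IsNoise μ n QV X W V :=
  ⟨hR.measurable_V, hR.posSemidef_QV, hR.law_V, hR.indep_V, hR.indep_V_XW⟩

section Noise

variable (hn : 1 ≤ n) (hM : IsGaussMarkov μ n A B QX QW X W) (hV : IsNoise μ n QV X W V)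
include hn hM hV

theorem IsNoise.hasGaussianLaw_driver : HasGaussianLaw (driver X W V n n) μ := by
  refine hV.indep_V_XW.symm.hasGaussianLaw (hM.hasGaussianLaw_pair hn) ?_
  exact hV.indep_V.hasGaussianLaw fun s => hasGaussianLaw_of_map (hV.law_V s s.2)

theorem IsNoise.integral_driver : ∫ ω, driver X W V n n ω ∂μ = 0 := by
  have h := hV.hasGaussianLaw_driver hn hM
  refine integral_prod_eq_zero h.fst.integrable h.snd.integrable (hM.integral_pair_eq_zero hn) ?_
  funext s
  rw [eval_integral fun s => (h.snd.eval s).integrable]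
  exact integral_eq_zero_of_map (hV.measurable_V s s.2) (hV.law_V s s.2)

theorem IsNoise.hasGaussianLaw_of_linearOf {F : Type*} [NormedAddCommGroup F]
    [NormedSpace ℝ F] [MeasurableSpace F] [BorelSpace F] {U : Ω → F}
    (h : LinearOf μ (driver X W V n n) U) : HasGaussianLaw U μ :=
  h.hasGaussianLaw (hV.hasGaussianLaw_driver hn hM)

theorem IsNoise.integral_eq_zero_of_linearOf {F : Type*} [NormedAddCommGroup F]
    [NormedSpace ℝ F] [CompleteSpace F] [MeasurableSpace F] [BorelSpace F] {U : Ω → F}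
    (h : LinearOf μ (driver X W V n n) U) : ∫ ω, U ω ∂μ = 0 :=
  h.integral_eq_zero (hV.hasGaussianLaw_driver hn hM).integrable (hV.integral_driver hn hM)

theorem IsNoise.indepFun_V {t : ℕ} (ht : t + 1 ∈ Finset.Icc 1 n) :
    IndepFun (V (t + 1)) (driver X W V n t) μ := by
  have htn : t ≤ n := by have := (Finset.mem_Icc.1 ht).2; omega
  have hV1 := hV.measurable_V _ ht
  have hVt : Measurable (seg V 1 t) := measurable_seg_of_le htn hV.measurable_V
  have hX1 := hM.measurable_X 1 (Finset.mem_Icc.2 ⟨le_rfl, hn⟩)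
  have hW : Measurable (seg W 2 n) := measurable_seg hM.measurable_W
  have h1 := indepFun_seg_succ hV.measurable_V hV.indep_V ht
  have h2 : IndepFun (fun ω => (V (t + 1) ω, seg V 1 t ω)) (fun ω => (X 1 ω, seg W 2 n ω)) μ :=
    hV.indep_V_XW.comp (φ := fun v => (v ⟨t + 1, ht⟩, segInit htn v)) (by fun_prop) measurable_id
  exact (indepFun_prodMk_of_indepFun hV1.aemeasurable hVt.aemeasurable
    (hX1.prodMk hW).aemeasurable h1 h2).comp measurable_id measurable_swap

theorem IsNoise.indepFun_W {t : ℕ} (ht : t + 1 ∈ Finset.Icc 2 n) :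
    IndepFun (W (t + 1)) (driver X W V t n) μ := by
  have htn : t ≤ n := by have := (Finset.mem_Icc.1 ht).2; omega
  have hW1 := hM.measurable_W _ ht
  have hWt : Measurable (seg W 2 t) := measurable_seg_of_le htn hM.measurable_W
  have hX1 := hM.measurable_X 1 (Finset.mem_Icc.2 ⟨le_rfl, hn⟩)
  have hVm : Measurable (seg V 1 n) := measurable_seg hV.measurable_V
  refine indepFun_prodMk_of_indepFun hW1.aemeasurable (hX1.prodMk hWt).aemeasurable
    hVm.aemeasurable (hM.indepFun_W hn ht) ?_
  exact hV.indep_V_XW.symm.comp (φ := fun p => (p.2 ⟨t + 1, ht⟩, (p.1, segInit htn p.2)))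
    (by fun_prop) measurable_id

end Noise

section Realization

variable (hn : 1 ≤ n) (hM : IsGaussMarkov μ n A B QX QW X W) (hR : IsRealization μ n H QV X W V Y)
include hn hM hR

theorem IsRealization.linearOf_Y {t : ℕ} (ht : t ≤ n) :
    ∀ r ∈ Finset.Icc 1 t, LinearOf μ (driver X W V t t) (Y r) := by
  induction t with
  | zero => intro r hr; simp at hr
  | succ t ih =>
    have ih' := ih (by omega)
    have hD : LinearOf μ (driver X W V (t + 1) (t + 1)) (driver X W V t t) :=
      linearOf_driver_driver (Nat.le_succ t) (Nat.le_succ t)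
    have hDn : LinearOf μ (driver X W V n n) (driver X W V (t + 1) (t + 1)) :=
      linearOf_driver_driver ht ht
    have ht1 : t + 1 ∈ Finset.Icc 1 (t + 1) := Finset.mem_Icc.2 ⟨by omega, le_rfl⟩
    have ht1n : t + 1 ∈ Finset.Icc 1 n := Finset.mem_Icc.2 ⟨by omega, ht⟩
    have hX : LinearOf μ (driver X W V (t + 1) (t + 1)) (X (t + 1)) :=
      hM.linearOf_driver hn ht1 ht
    have hY : LinearOf μ (driver X W V (t + 1) (t + 1)) (seg Y 1 t) :=
      (LinearOf.seg ih').trans hD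
    intro r hr
    rcases (Finset.mem_Icc.1 hr).2.lt_or_eq with hlt | rfl
    · exact (ih' r (Finset.mem_Icc.2 ⟨(Finset.mem_Icc.1 hr).1, by omega⟩)).trans hD
    obtain ⟨T, hT, -⟩ := exists_condExp_eq
      (hR.isNoise.hasGaussianLaw_of_linearOf hn hM ((hX.prodMk hY).trans hDn))
      (hM.measurable_X _ ht1n) (measurable_seg_of_le (by omega) hR.measurable_Y)
      (hR.isNoise.integral_eq_zero_of_linearOf hn hM (hX.trans hDn))
      (hR.isNoise.integral_eq_zero_of_linearOf hn hM (hY.trans hDn))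
    have hE : LinearOf μ (driver X W V (t + 1) (t + 1)) (est μ X Y (t + 1) t) :=
      (hY.map T).congr hT
    refine LinearOf.congr ?_ (hR.realization _ ht1n)
    exact ((hX.map (actL (H (t + 1)))).add (hE.sub (hE.map (actL (H (t + 1)))))).add
      (linearOf_driver_V ht1)

end Realization

end Driver


section Channel

variable {Ω : Type*} [MeasurableSpace Ω] {μ : Measure Ω} [IsProbabilityMeasure μ]

/-- If `Y` is obtained from `(Z, g(X))` through a memoryless channel, then `X` may be replaced
by `g(X)` in `I(X; Y | Z)`. -/
theorem condMutualInfo_eq_of_channel {α β γ δ ε : Type*} [MeasurableSpace α] [StandardBorelSpace α]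
    [Nonempty α] [MeasurableSpace β] [StandardBorelSpace β] [Nonempty β] [MeasurableSpace γ]
    [MeasurableSpace δ] [StandardBorelSpace δ] [Nonempty δ] [MeasurableSpace ε]
    [StandardBorelSpace ε] [Nonempty ε] {X : Ω → α} {Y : Ω → β} {Z : Ω → δ} {V : Ω → γ}
    (hX : Measurable X) (hY : Measurable Y) (hZ : Measurable Z) (hV : Measurable V) {g : α → ε}
    (hg : Measurable g) (hind : IndepFun V (fun ω => (Z ω, X ω)) μ) {φ : (δ × ε) × γ → β}
    (hφ : Measurable φ) (hYφ : Y =ᵐ[μ] fun ω => φ ((Z ω, g (X ω)), V ω)) :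
    condMutualInfo μ X Y Z = condMutualInfo μ (fun ω => g (X ω)) Y Z := by
  have := Measure.isProbabilityMeasure_map (μ := μ) hV.aemeasurable
  have hgX : Measurable fun ω => g (X ω) := by fun_prop
  have h0 : condMutualInfo μ X Y (fun ω => (Z ω, g (X ω))) = 0 := by
    have := Kernel.IsMarkovKernel.map ((Kernel.id : Kernel (δ × ε) _) ×ₖ
      Kernel.const (δ × ε) (μ.map V)) hφ
    refine condMutualInfo_eq_zero μ hX hY (by fun_prop)
      ((Kernel.id ×ₖ Kernel.const (δ × ε) (μ.map V)).map φ) ?_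
    have hind' : IndepFun (fun ω => ((Z ω, g (X ω)), X ω)) V μ :=
      (hind.comp (φ := id) (ψ := fun p => ((p.1, g p.2), p.2)) measurable_id (by fun_prop)).symm
    have h1 := map_prod_of_indepFun (μ := μ) (by fun_prop) hV hind'
      (φ := fun p : ((δ × ε) × α) × γ => φ (p.1.1, p.2)) (by fun_prop)
    have h2 : (Kernel.id ×ₖ Kernel.const ((δ × ε) × α) (μ.map V)).map
        (fun p : ((δ × ε) × α) × γ => φ (p.1.1, p.2)) =
        ((Kernel.id ×ₖ Kernel.const (δ × ε) (μ.map V)).map φ).prodMkRight α := by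
      refine Kernel.ext fun p => ?_
      rw [id_prod_const_map_apply _ (by fun_prop), Kernel.prodMkRight_apply,
        id_prod_const_map_apply _ hφ]
    rw [← h2, ← h1]
    refine Measure.map_congr ?_
    filter_upwards [hYφ] with ω hω
    rw [hω]
  have h1 := condMutualInfo_prod_eq_add μ hY hgX hX hZ
  rw [condMutualInfo_comm μ hY hX (by fun_prop), h0, add_zero] at h1
  rw [condMutualInfo_comm μ hX hY hZ, condMutualInfo_comm μ hgX hY hZ, ← h1]
  exact le_antisymm
    (condMutualInfo_le_right μ hY (by fun_prop) hZ (h := fun p => p.2.2) (by fun_prop)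
      (Filter.EventuallyEq.refl _ _))
    (condMutualInfo_le_right μ hY hX hZ (h := fun p => (g p.2, p.2)) (by fun_prop)
      (Filter.EventuallyEq.refl _ _))

end Channel

/-! ### Components -/

/-- `comp₁` as a continuous linear map. -/
noncomputable def comp₁L (p₁ p₂ : ℕ) : Vec p₁ p₂ →L[ℝ] EuclideanSpace ℝ (Fin p₁) :=
  LinearMap.toContinuousLinearMap
    { toFun := comp₁, map_add' := fun _ _ => rfl, map_smul' := fun _ _ => rfl }

/-- `comp₂` as a continuous linear map. -/
noncomputable def comp₂L (p₁ p₂ : ℕ) : Vec p₁ p₂ →L[ℝ] EuclideanSpace ℝ (Fin p₂) :=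
  LinearMap.toContinuousLinearMap
    { toFun := comp₂, map_add' := fun _ _ => rfl, map_smul' := fun _ _ => rfl }

@[simp]
theorem comp₁L_apply {p₁ p₂ : ℕ} (x : Vec p₁ p₂) : comp₁L p₁ p₂ x = comp₁ x := rfl

@[simp]
theorem comp₂L_apply {p₁ p₂ : ℕ} (x : Vec p₁ p₂) : comp₂L p₁ p₂ x = comp₂ x := rfl

theorem vec_ext {p₁ p₂ : ℕ} {x y : Vec p₁ p₂} (h₁ : comp₁ x = comp₁ y) (h₂ : comp₂ x = comp₂ y) :
    x = y := by
  ext (i | i)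
  · exact congrArg (fun z : EuclideanSpace ℝ (Fin p₁) => z i) h₁
  · exact congrArg (fun z : EuclideanSpace ℝ (Fin p₂) => z i) h₂

theorem act_sub_matrix {ι κ : Type*} [Fintype κ] (M N : Matrix ι κ ℝ) (x : EuclideanSpace ℝ κ) :
    act (M - N) x = act M x - act N x := by
  ext i
  simp [act, sub_mulVec]

theorem act_one {ι : Type*} [Fintype ι] [DecidableEq ι] (x : EuclideanSpace ℝ ι) :
    act (1 : Matrix ι ι ℝ) x = x := by
  ext i
  simp [act]

theorem mul_pinv_of_isUnit {ι : Type*} [Fintype ι] [DecidableEq ι] {M : Matrix ι ι ℝ}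
    (h : IsUnit M) : M * pinv M = 1 := by
  have h1 := (pinv_spec M).mul_mul_left
  exact h.mul_right_cancel (by rw [h1, one_mul])

theorem estEqReproduction_iff {Ω : Type*} [MeasurableSpace Ω] {μ : Measure Ω}
    [IsProbabilityMeasure μ] {p₁ p₂ : ℕ} {X Y : ℕ → Ω → Vec p₁ p₂} {t : ℕ}
    (hX : Integrable (X t) μ) : EstEqReproduction μ X Y t ↔ est μ X Y t t =ᵐ[μ] Y t := by
  have h1 := (comp₁L p₁ p₂).comp_condExp_comm hX (m := sigma Y t)
  have h2 := (comp₂L p₁ p₂).comp_condExp_comm hX (m := sigma Y t)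
  constructor
  · rintro ⟨e1, e2⟩
    filter_upwards [h1.trans e1, h2.trans e2] with ω a b
    exact vec_ext a b
  · intro h
    constructor
    · refine Filter.EventuallyEq.trans h1.symm ?_
      filter_upwards [h] with ω hω
      exact congrArg comp₁ hω
    · refine Filter.EventuallyEq.trans h2.symm ?_
      filter_upwards [h] with ω hω
      exact congrArg comp₂ hω

section Realization

variable {Ω : Type*} [MeasurableSpace Ω] {μ : Measure Ω} [IsProbabilityMeasure μ]
  {p₁ p₂ q₁ q₂ n : ℕ} {X : ℕ → Ω → Vec p₁ p₂} {W : ℕ → Ω → Vec q₁ q₂} {V : ℕ → Ω → Vec p₁ p₂}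
  {A : ℕ → SqMat p₁ p₂} {B : ℕ → Matrix (Fin p₁ ⊕ Fin p₂) (Fin q₁ ⊕ Fin q₂) ℝ}
  {QX : SqMat p₁ p₂} {QW : ℕ → SqMat q₁ q₂} {H QV : ℕ → SqMat p₁ p₂} {Y : ℕ → Ω → Vec p₁ p₂}

theorem measurable_est {t s : ℕ} (hY : Measurable (seg Y 1 s)) : Measurable (est μ X Y t s) :=
  (stronglyMeasurable_condExp.mono hY.comap_le).measurable

theorem prevEst_succ (s : ℕ) : prevEst μ X Y (s + 1) = if s = 0 then 0 else est μ X Y s s := by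
  simp [prevEst]

theorem measurable_prevEst {s : ℕ} (hY : Measurable (seg Y 1 s)) :
    Measurable (prevEst μ X Y (s + 1)) := by
  rw [prevEst_succ]
  split_ifs
  · exact measurable_zero
  · exact measurable_est hY

variable (hn : 1 ≤ n) (hM : IsGaussMarkov μ n A B QX QW X W) (hR : IsRealization μ n H QV X W V Y)

include hR in
theorem IsRealization.measurable_segY {t : ℕ} (ht : t ≤ n) : Measurable (seg Y 1 t) :=
  measurable_seg_of_le ht hR.measurable_Y

include hn hM hR

theorem IsRealization.linearOf_segX {t : ℕ} (ht : t ≤ n) :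
    LinearOf μ (driver X W V n n) (seg X 1 t) :=
  LinearOf.seg fun _ hr => hM.linearOf_driver hn (Finset.Icc_subset_Icc_right ht hr) le_rfl

theorem IsRealization.linearOf_segY {t : ℕ} (ht : t ≤ n) :
    LinearOf μ (driver X W V n t) (seg Y 1 t) :=
  (LinearOf.seg (hR.linearOf_Y hn hM ht)).trans (linearOf_driver_driver ht le_rfl)

theorem IsRealization.linearOf_segY' {t : ℕ} (ht : t ≤ n) :
    LinearOf μ (driver X W V n n) (seg Y 1 t) :=
  (hR.linearOf_segY hn hM ht).trans (linearOf_driver_driver le_rfl ht)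

theorem IsRealization.isGaussian {t : ℕ} (ht : t ≤ n) :
    IsGaussian (μ.map fun ω => (seg X 1 t ω, seg Y 1 t ω)) :=
  (hR.isNoise.hasGaussianLaw_of_linearOf hn hM
    ((hR.linearOf_segX hn hM ht).prodMk (hR.linearOf_segY' hn hM ht))).isGaussian_map

theorem IsRealization.integrable_X {t : ℕ} (ht : t ∈ Finset.Icc 1 n) : Integrable (X t) μ :=
  (hR.isNoise.hasGaussianLaw_of_linearOf hn hM (hM.linearOf_driver hn ht le_rfl)).integrable

theorem IsRealization.exists_est_eq {t s : ℕ} (ht : t ∈ Finset.Icc 1 n) (hs : s ≤ n) :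
    ∃ T : (Finset.Icc 1 s → Vec p₁ p₂) →L[ℝ] Vec p₁ p₂,
      est μ X Y t s =ᵐ[μ] fun ω => T (seg Y 1 s ω) := by
  have hX := hM.linearOf_driver hn ht le_rfl (W := W) (V := V) (t := n)
  have hY := hR.linearOf_segY' hn hM hs
  obtain ⟨T, hT, -⟩ := exists_condExp_eq
      (hR.isNoise.hasGaussianLaw_of_linearOf hn hM (hX.prodMk hY))
      (hM.measurable_X _ ht) (hR.measurable_segY hs)
      (hR.isNoise.integral_eq_zero_of_linearOf hn hM hX)
      (hR.isNoise.integral_eq_zero_of_linearOf hn hM hY)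
  exact ⟨T, hT⟩

theorem IsRealization.exists_prevEst_eq {s : ℕ} (hs : s ≤ n) :
    ∃ T : (Finset.Icc 1 s → Vec p₁ p₂) →L[ℝ] Vec p₁ p₂,
      prevEst μ X Y (s + 1) =ᵐ[μ] fun ω => T (seg Y 1 s ω) := by
  rw [prevEst_succ]
  split_ifs with h
  · exact ⟨0, Filter.EventuallyEq.refl _ _⟩
  · exact hR.exists_est_eq hn hM (Finset.mem_Icc.2 ⟨by omega, hs⟩) hs

theorem IsRealization.est_succ_eq {s : ℕ} (hs : s + 1 ≤ n) :
    ∀ᵐ ω ∂μ, est μ X Y (s + 1) s ω = act (A s) (prevEst μ X Y (s + 1) ω) := by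
  rw [prevEst_succ]
  have hYs := hR.measurable_segY (t := s) (by omega)
  split_ifs with h
  · subst h
    have hX1 : 1 ∈ Finset.Icc 1 n := Finset.mem_Icc.2 ⟨le_rfl, hn⟩
    have hseg : seg Y 1 0 = fun _ => fun r => absurd r.2 (by simp) := by
      funext ω r
      exact absurd r.2 (by simp)
    have := condExp_indepFun (μ := μ) (hM.measurable_X 1 hX1) hYs
      (hR.isNoise.integral_eq_zero_of_linearOf hn hM linearOf_driver_X)
      (by rw [hseg]; exact indepFun_const_right _ _)
    filter_upwards [this] with ω hω
    refine Eq.trans hω ?_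
    exact ((actL (A 0)).map_zero).symm
  · have hs1 : s ∈ Finset.Icc 1 n := Finset.mem_Icc.2 ⟨by omega, by omega⟩
    have hWs : s + 1 ∈ Finset.Icc 2 n := Finset.mem_Icc.2 ⟨by omega, by omega⟩
    have hind : IndepFun (act (B s) ∘ W (s + 1)) (seg Y 1 s) μ :=
      (((LinearOf.seg (hR.linearOf_Y hn hM (by omega))).trans
        (linearOf_driver_driver le_rfl (by omega))).indepFun_right
          (hR.isNoise.indepFun_W hn hM hWs)).comp (measurable_act _) measurable_id
    have hBW := (linearOf_driver_W hWs (μ := μ) (X := X) (W := W) (V := V) (t := n)).map (actL (B s))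
    have e1 := condExp_indepFun (μ := μ) ((measurable_act (B s)).comp (hM.measurable_W _ hWs)) hYs
      (hR.isNoise.integral_eq_zero_of_linearOf hn hM hBW) hind
    have hXi := hR.integrable_X hn hM hs1
    have e2 := (actL (A s)).comp_condExp_comm hXi (m := sigma Y s)
    have hAi : Integrable (actL (A s) ∘ X s) μ := (actL (A s)).integrable_comp hXi
    have hBi : Integrable (act (B s) ∘ W (s + 1)) μ :=
      (hR.isNoise.hasGaussianLaw_of_linearOf hn hM hBW).integrable
    have e3 := condExp_add hAi hBi (sigma Y s)
    have e4 : μ[X (s + 1) | sigma Y s] =ᵐ[μ]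
        μ[actL (A s) ∘ X s + act (B s) ∘ W (s + 1) | sigma Y s] :=
      condExp_congr_ae (hM.recursion s (Finset.mem_Icc.2 ⟨by omega, by omega⟩))
    filter_upwards [e1, e2, e3, e4] with ω a b c d
    refine d.trans ?_
    rw [c, Pi.add_apply, a, ← b]
    simp [est]

omit hn hM in
theorem IsRealization.eq_second_form {s : ℕ} (hs : s + 1 ≤ n) :
    ∀ᵐ ω ∂μ, Y (s + 1) ω = act (H (s + 1)) (X (s + 1) ω) +
          act (1 - H (s + 1)) (est μ X Y (s + 1) s ω) + V (s + 1) ω := by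
  filter_upwards [hR.realization (s + 1) (Finset.mem_Icc.2 ⟨by omega, hs⟩)] with ω hω
  rw [hω, feedback, act_sub_matrix, act_one]
  rfl

theorem IsRealization.exists_channel {s : ℕ} (hs : s + 1 ≤ n) :
    ∃ T : (Finset.Icc 1 s → Vec p₁ p₂) →L[ℝ] Vec p₁ p₂,
      prevEst μ X Y (s + 1) =ᵐ[μ] (fun ω => T (seg Y 1 s ω)) ∧
      ∀ᵐ ω ∂μ, Y (s + 1) ω = act (H (s + 1)) (X (s + 1) ω) +
        act (1 - H (s + 1)) (act (A s) (T (seg Y 1 s ω))) + V (s + 1) ω := by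
  obtain ⟨T, hT⟩ := hR.exists_prevEst_eq hn hM (s := s) (by omega)
  refine ⟨T, hT, ?_⟩
  filter_upwards [hT, hR.eq_second_form hs, hR.est_succ_eq hn hM hs] with ω a b c
  rw [b, c, a]

theorem IsRealization.indepFun_V_seg {s : ℕ} (hs : s + 1 ≤ n) :
    IndepFun (V (s + 1)) (fun ω => (seg Y 1 s ω, seg X 1 n ω)) μ := by
  have hs1 : s + 1 ∈ Finset.Icc 1 n := Finset.mem_Icc.2 ⟨by omega, hs⟩
  refine LinearOf.indepFun_right ?_ (hR.isNoise.indepFun_V hn hM hs1)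
  exact (hR.linearOf_segY hn hM (by omega)).prodMk
    (LinearOf.seg fun _ hr => hM.linearOf_driver hn hr le_rfl)

theorem IsRealization.condDistrib_eq {s : ℕ} (hs : s + 1 ≤ n) :
    ∀ᵐ ω ∂μ, condDistrib (Y (s + 1)) (fun ω' => (seg Y 1 s ω', X (s + 1) ω')) μ
            (seg Y 1 s ω, X (s + 1) ω) =
          testChannel (H (s + 1)) (QV (s + 1)) (A s) (prevEst μ X Y (s + 1) ω) (X (s + 1) ω) := by
  have hs1 : s + 1 ∈ Finset.Icc 1 n := Finset.mem_Icc.2 ⟨by omega, hs⟩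
  obtain ⟨T, hT, hYe⟩ := hR.exists_channel hn hM hs
  have hZ : Measurable fun ω => (seg Y 1 s ω, X (s + 1) ω) :=
    (hR.measurable_segY (by omega)).prodMk (hM.measurable_X _ hs1)
  have hV := hR.measurable_V _ hs1
  have := Measure.isProbabilityMeasure_map (μ := μ) hV.aemeasurable
  have hind : IndepFun (fun ω => (seg Y 1 s ω, X (s + 1) ω)) (V (s + 1)) μ :=
    ((hR.indepFun_V_seg hn hM hs).comp (φ := id) (ψ := fun p => (p.1, p.2 ⟨s + 1, hs1⟩))
      measurable_id (by fun_prop)).symm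
  let φ : ((Finset.Icc 1 s → Vec p₁ p₂) × Vec p₁ p₂) × Vec p₁ p₂ → Vec p₁ p₂ := fun p =>
    act (H (s + 1)) p.1.2 + act (1 - H (s + 1)) (act (A s) (T p.1.1)) + p.2
  have hφ : Measurable φ := by
    have := T.continuous.measurable
    fun_prop
  have h1 := map_prod_of_indepFun (μ := μ) hZ hV hind hφ
  have h2 : μ.map (fun ω => ((seg Y 1 s ω, X (s + 1) ω), Y (s + 1) ω)) =
      μ.map (fun ω => (seg Y 1 s ω, X (s + 1) ω)) ⊗ₘ
        (Kernel.id ×ₖ Kernel.const _ (μ.map (V (s + 1)))).map φ := by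
    rw [← h1]
    refine Measure.map_congr ?_
    filter_upwards [hYe] with ω hω
    rw [hω]
  have := Kernel.IsMarkovKernel.map ((Kernel.id : Kernel ((Finset.Icc 1 s → Vec p₁ p₂) ×
    Vec p₁ p₂) _) ×ₖ Kernel.const _ (μ.map (V (s + 1)))) hφ
  have h3 := condDistrib_ae_eq_of_measure_eq_compProd _ (hR.measurable_Y _ hs1).aemeasurable h2
  filter_upwards [ae_of_ae_map hZ.aemeasurable h3, hT] with ω a b
  rw [a, id_prod_const_map_apply _ hφ, hR.law_V _ hs1, b, testChannel,
    multivariateGaussian_eq_map (_ + _)]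

theorem IsRealization.condMutualInfo_seg_eq {s : ℕ} (hs : s + 1 ≤ n) :
    condMutualInfo μ (seg X 1 (s + 1)) (Y (s + 1)) (seg Y 1 s) =
      condMutualInfo μ (X (s + 1)) (Y (s + 1)) (seg Y 1 s) := by
  have hs1 : s + 1 ∈ Finset.Icc 1 n := Finset.mem_Icc.2 ⟨by omega, hs⟩
  obtain ⟨T, -, hYe⟩ := hR.exists_channel hn hM hs
  have hind : IndepFun (V (s + 1)) (fun ω => (seg Y 1 s ω, seg X 1 (s + 1) ω)) μ :=
    (hR.indepFun_V_seg hn hM hs).comp (φ := id)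
      (ψ := fun p : (Finset.Icc 1 s → Vec p₁ p₂) × (Finset.Icc 1 n → Vec p₁ p₂) =>
        (p.1, segInit hs p.2)) measurable_id (by fun_prop)
  refine condMutualInfo_eq_of_channel (X := seg X 1 (s + 1)) (V := V (s + 1))
    (measurable_seg_of_le hs hM.measurable_X) (hR.measurable_Y _ hs1)
    (hR.measurable_segY (by omega)) (hR.measurable_V _ hs1)
    (g := fun x => x ⟨s + 1, Finset.mem_Icc.2 ⟨by omega, le_rfl⟩⟩) (measurable_pi_apply _)
    hind (φ := fun p =>
      act (H (s + 1)) p.1.2 + act (1 - H (s + 1)) (act (A s) (T p.1.1)) + p.2) ?_ hYe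
  have := T.continuous.measurable
  fun_prop

theorem IsRealization.exists_est_eq_update {s : ℕ} (hs : s + 1 ≤ n) :
    ∃ h : (Finset.Icc 1 s → Vec p₁ p₂) × Vec p₁ p₂ → Vec p₁ p₂, Measurable h ∧
      est μ X Y (s + 1) (s + 1) =ᵐ[μ] fun ω => h (seg Y 1 s ω, Y (s + 1) ω) := by
  have hs1 : s + 1 ∈ Finset.Icc 1 n := Finset.mem_Icc.2 ⟨by omega, hs⟩
  obtain ⟨T, hT⟩ := hR.exists_est_eq hn hM hs1 hs
  refine ⟨fun p => T (segSnoc p), T.continuous.measurable.comp measurable_segSnoc, ?_⟩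
  filter_upwards [hT] with ω hω
  rw [hω, segSnoc_seg]

theorem IsRealization.condMutualInfo_prevEst {s : ℕ} (hs : s + 1 ≤ n) {β : Type*}
    [MeasurableSpace β] [StandardBorelSpace β] [Nonempty β] {U : Ω → β} (hU : Measurable U) :
    condMutualInfo μ (X (s + 1)) U (seg Y 1 s) =
      condMutualInfo μ (X (s + 1)) U (fun ω => (seg Y 1 s ω, prevEst μ X Y (s + 1) ω)) := by
  have hs1 : s + 1 ∈ Finset.Icc 1 n := Finset.mem_Icc.2 ⟨by omega, hs⟩
  have hYs := hR.measurable_segY (t := s) (by omega)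
  obtain ⟨T, hT⟩ := hR.exists_prevEst_eq hn hM (s := s) (by omega)
  exact condMutualInfo_congr_cond μ (hM.measurable_X _ hs1) hU hYs
    (hYs.prodMk (measurable_prevEst hYs)) (φ := fun z => (z, T z)) (ψ := Prod.fst)
    (measurable_id.prodMk T.continuous.measurable) measurable_fst
    ((Filter.EventuallyEq.refl _ _).prodMk hT) (Filter.EventuallyEq.refl _ _)

theorem IsRealization.condMutualInfo_est {s : ℕ} (hs : s + 1 ≤ n) {β : Type*}
    [MeasurableSpace β] [StandardBorelSpace β] [Nonempty β] {U : Ω → β} (hU : Measurable U) :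
    condMutualInfo μ (X (s + 1)) U (seg Y 1 s) =
      condMutualInfo μ (X (s + 1)) U (fun ω => (seg Y 1 s ω, est μ X Y (s + 1) s ω)) := by
  have hs1 : s + 1 ∈ Finset.Icc 1 n := Finset.mem_Icc.2 ⟨by omega, hs⟩
  have hYs := hR.measurable_segY (t := s) (by omega)
  obtain ⟨T, hT⟩ := hR.exists_est_eq hn hM hs1 (s := s) (by omega)
  exact condMutualInfo_congr_cond μ (hM.measurable_X _ hs1) hU hYs
    (hYs.prodMk (measurable_est hYs)) (φ := fun z => (z, T z)) (ψ := Prod.fst)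
    (measurable_id.prodMk T.continuous.measurable) measurable_fst
    ((Filter.EventuallyEq.refl _ _).prodMk hT) (Filter.EventuallyEq.refl _ _)

theorem IsRealization.condMutualInfo_prod_est {s : ℕ} (hs : s + 1 ≤ n) :
    condMutualInfo μ (X (s + 1)) (fun ω => (Y (s + 1) ω, est μ X Y (s + 1) (s + 1) ω))
      (seg Y 1 s) = condMutualInfo μ (X (s + 1)) (Y (s + 1)) (seg Y 1 s) := by
  have hs1 : s + 1 ∈ Finset.Icc 1 n := Finset.mem_Icc.2 ⟨by omega, hs⟩
  have hYs := hR.measurable_segY (t := s) (by omega)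
  have hY := hR.measurable_Y _ hs1
  have hE : Measurable (est μ X Y (s + 1) (s + 1)) := measurable_est (hR.measurable_segY hs)
  obtain ⟨h, hm, he⟩ := hR.exists_est_eq_update hn hM hs
  exact le_antisymm
    (condMutualInfo_le_right μ (hM.measurable_X _ hs1) hY hYs (h := fun p => (p.2, h p))
      (by fun_prop) ((Filter.EventuallyEq.refl _ _).prodMk he))
    (condMutualInfo_le_right μ (hM.measurable_X _ hs1) (hY.prodMk hE) hYs (h := fun p => p.2.1)
      (by fun_prop) (Filter.EventuallyEq.refl _ _))

theorem IsRealization.condMutualInfo_prevEst_eq_prod_est {s : ℕ} (hs : s + 1 ≤ n) :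
    condMutualInfo μ (X (s + 1)) (Y (s + 1))
        (fun ω => (seg Y 1 s ω, prevEst μ X Y (s + 1) ω)) =
      condMutualInfo μ (X (s + 1)) (fun ω => (Y (s + 1) ω, est μ X Y (s + 1) (s + 1) ω))
        (fun ω => (seg Y 1 s ω, est μ X Y (s + 1) s ω)) := by
  have hY := hR.measurable_Y _ (Finset.mem_Icc.2 ⟨by omega, hs⟩)
  rw [← hR.condMutualInfo_prevEst hn hM hs hY, ← hR.condMutualInfo_est hn hM hs
    (hY.prodMk (measurable_est (hR.measurable_segY hs))), hR.condMutualInfo_prod_est hn hM hs]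

theorem IsRealization.condMutualInfo_prod_est_eq_add {s : ℕ} (hs : s + 1 ≤ n) :
    condMutualInfo μ (X (s + 1)) (fun ω => (Y (s + 1) ω, est μ X Y (s + 1) (s + 1) ω))
      (fun ω => (seg Y 1 s ω, est μ X Y (s + 1) s ω)) =
    condMutualInfo μ (X (s + 1)) (Y (s + 1))
        (fun ω => (seg Y 1 s ω, prevEst μ X Y (s + 1) ω, est μ X Y (s + 1) (s + 1) ω)) +
      condMutualInfo μ (X (s + 1)) (est μ X Y (s + 1) (s + 1))
        (fun ω => (seg Y 1 s ω, prevEst μ X Y (s + 1) ω)) := by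
  have hs1 : s + 1 ∈ Finset.Icc 1 n := Finset.mem_Icc.2 ⟨by omega, hs⟩
  have hX := hM.measurable_X _ hs1
  have hYs := hR.measurable_segY (t := s) (by omega)
  have hY := hR.measurable_Y _ hs1
  have hE : Measurable (est μ X Y (s + 1) (s + 1)) := measurable_est (hR.measurable_segY hs)
  have hP : Measurable (prevEst μ X Y (s + 1)) := measurable_prevEst hYs
  rw [← hR.condMutualInfo_est hn hM hs (hY.prodMk hE),
    hR.condMutualInfo_prevEst hn hM hs (hY.prodMk hE)]
  have h1 : condMutualInfo μ (X (s + 1)) (fun ω => (Y (s + 1) ω, est μ X Y (s + 1) (s + 1) ω))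
      (fun ω => (seg Y 1 s ω, prevEst μ X Y (s + 1) ω)) =
    condMutualInfo μ (X (s + 1)) (fun ω => (est μ X Y (s + 1) (s + 1) ω, Y (s + 1) ω))
      (fun ω => (seg Y 1 s ω, prevEst μ X Y (s + 1) ω)) :=
    le_antisymm
      (condMutualInfo_le_right μ hX (hE.prodMk hY) (hYs.prodMk hP) (h := fun p => p.2.swap)
        (by fun_prop) (Filter.EventuallyEq.refl _ _))
      (condMutualInfo_le_right μ hX (hY.prodMk hE) (hYs.prodMk hP) (h := fun p => p.2.swap)
        (by fun_prop) (Filter.EventuallyEq.refl _ _))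
  rw [h1, condMutualInfo_prod_eq_add μ hX hE hY (hYs.prodMk hP), add_comm]
  congr 1
  have : StandardBorelSpace (((Finset.Icc 1 s → Vec p₁ p₂) × Vec p₁ p₂) × Vec p₁ p₂) :=
    StandardBorelSpace.prod
  have : StandardBorelSpace ((Finset.Icc 1 s → Vec p₁ p₂) × Vec p₁ p₂ × Vec p₁ p₂) :=
    StandardBorelSpace.prod
  exact condMutualInfo_congr_cond μ hX hY ((hYs.prodMk hP).prodMk hE) (hYs.prodMk (hP.prodMk hE))
    (φ := fun p => (p.1.1, p.1.2, p.2)) (ψ := fun p => ((p.1, p.2.1), p.2.2)) (by fun_prop)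
    (by fun_prop) (Filter.EventuallyEq.refl _ _) (Filter.EventuallyEq.refl _ _)

theorem IsRealization.condMutualInfo_est_le {s : ℕ} (hs : s + 1 ≤ n) :
    condMutualInfo μ (X (s + 1)) (est μ X Y (s + 1) (s + 1))
        (fun ω => (seg Y 1 s ω, est μ X Y (s + 1) s ω)) ≤
      condMutualInfo μ (seg X 1 (s + 1)) (Y (s + 1)) (seg Y 1 s) := by
  have hs1 : s + 1 ∈ Finset.Icc 1 n := Finset.mem_Icc.2 ⟨by omega, hs⟩
  have hE : Measurable (est μ X Y (s + 1) (s + 1)) := measurable_est (hR.measurable_segY hs)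
  obtain ⟨h, hm, he⟩ := hR.exists_est_eq_update hn hM hs
  rw [← hR.condMutualInfo_est hn hM hs hE, hR.condMutualInfo_seg_eq hn hM hs]
  exact condMutualInfo_le_right μ (hM.measurable_X _ hs1) (hR.measurable_Y _ hs1)
    (hR.measurable_segY (by omega)) hm he

theorem IsRealization.condMutualInfo_eq_of_est_eq {s : ℕ} (hs : s + 1 ≤ n)
    (h : est μ X Y (s + 1) (s + 1) =ᵐ[μ] Y (s + 1)) :
    condMutualInfo μ (seg X 1 (s + 1)) (Y (s + 1)) (seg Y 1 s) =
    condMutualInfo μ (X (s + 1)) (est μ X Y (s + 1) (s + 1))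
        (fun ω => (seg Y 1 s ω, est μ X Y (s + 1) s ω)) := by
  have hE : Measurable (est μ X Y (s + 1) (s + 1)) := measurable_est (hR.measurable_segY hs)
  rw [← hR.condMutualInfo_est hn hM hs hE, hR.condMutualInfo_seg_eq hn hM hs]
  exact condMutualInfo_congr μ (Filter.EventuallyEq.refl _ _) h.symm (Filter.EventuallyEq.refl _ _)

/-- The measurement update of the Kalman filter. -/
theorem IsRealization.est_eq_kalmanUpdate {s : ℕ} (hs : s + 1 ≤ n) :
    est μ X Y (s + 1) (s + 1) =ᵐ[μ] kalmanUpdate μ X Y (s + 1) := by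
  have hs1 : s + 1 ∈ Finset.Icc 1 n := Finset.mem_Icc.2 ⟨by omega, hs⟩
  have hXm := hM.measurable_X _ hs1
  have hYm := hR.measurable_Y _ hs1
  have hYs := hR.measurable_segY (t := s) (by omega)
  have hX := hM.linearOf_driver hn hs1 le_rfl (W := W) (V := V) (t := n)
  have hY := (hR.linearOf_segY' hn hM le_rfl).of_seg hs1
  have hZ := hR.linearOf_segY' hn hM (t := s) (by omega)
  obtain ⟨T, hT, hind⟩ := exists_condExp_eq
      (hR.isNoise.hasGaussianLaw_of_linearOf hn hM ((hX.prodMk hY).prodMk hZ)) (hXm.prodMk hYm) hYs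
      (hR.isNoise.integral_eq_zero_of_linearOf hn hM (hX.prodMk hY))
      (hR.isNoise.integral_eq_zero_of_linearOf hn hM hZ)
  have hpair : Integrable (fun ω => (X (s + 1) ω, Y (s + 1) ω)) μ :=
    (hR.isNoise.hasGaussianLaw_of_linearOf hn hM (hX.prodMk hY)).integrable
  set Z := seg Y 1 s with hZdef
  let Tx := (ContinuousLinearMap.fst ℝ (Vec p₁ p₂) (Vec p₁ p₂)).comp T
  let Ty := (ContinuousLinearMap.snd ℝ (Vec p₁ p₂) (Vec p₁ p₂)).comp T
  have hTxm : Measurable Tx := Tx.continuous.measurable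
  have hTym : Measurable Ty := Ty.continuous.measurable
  have hEX : μ[X (s + 1) | sigma Y s] =ᵐ[μ] fun ω => Tx (Z ω) := by
    have := (ContinuousLinearMap.fst ℝ (Vec p₁ p₂) (Vec p₁ p₂)).comp_condExp_comm hpair
      (m := sigma Y s)
    filter_upwards [this, hT] with ω a b
    exact a.symm.trans (congrArg Prod.fst b)
  have hEY : μ[Y (s + 1) | sigma Y s] =ᵐ[μ] fun ω => Ty (Z ω) := by
    have := (ContinuousLinearMap.snd ℝ (Vec p₁ p₂) (Vec p₁ p₂)).comp_condExp_comm hpair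
      (m := sigma Y s)
    filter_upwards [this, hT] with ω a b
    exact a.symm.trans (congrArg Prod.snd b)
  let a : Ω → Vec p₁ p₂ := fun ω => X (s + 1) ω - Tx (Z ω)
  let b : Ω → Vec p₁ p₂ := fun ω => Y (s + 1) ω - Ty (Z ω)
  have ham : Measurable a := by fun_prop
  have hbm : Measurable b := by fun_prop
  have hab : IndepFun (fun ω => (a ω, b ω)) Z μ := hind
  have hablin : LinearOf μ (driver X W V n n) fun ω => (a ω, b ω) :=
    (hX.prodMk hY).sub (hZ.map T)
  have hG : HasGaussianLaw (fun ω => (a ω, b ω)) μ := hR.isNoise.hasGaussianLaw_of_linearOf hn hM hablin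
  have ha0 : ∫ ω, a ω ∂μ = 0 := hR.isNoise.integral_eq_zero_of_linearOf hn hM hablin.fst
  have hb0 : ∫ ω, b ω ∂μ = 0 := hR.isNoise.integral_eq_zero_of_linearOf hn hM hablin.snd
  set S : SqMat p₁ p₂ := Matrix.of fun i j => ∫ ω, a ω i * b ω j ∂μ with hS
  set C : SqMat p₁ p₂ := secondMoment μ fun j ω => b ω j with hC
  have hconst : ∀ f : Vec p₁ p₂ × Vec p₁ p₂ → ℝ, Measurable f →
      μ[fun ω => f (a ω, b ω) | sigma Y s] =ᵐ[μ] fun _ => ∫ ω, f (a ω, b ω) ∂μ := fun f hf => by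
    have hm : Measurable fun ω => f (a ω, b ω) := by fun_prop
    exact condExp_indep_eq hm.comap_le hYs.comap_le
      (comap_measurable fun ω => f (a ω, b ω)).stronglyMeasurable
      (hab.comp (ψ := id) hf measurable_id)
  have hcovXY : condCov μ (sigma Y s) (X (s + 1)) (Y (s + 1)) =ᵐ[μ] fun _ => S := by
    have h1 : ∀ i j, ∀ᵐ ω ∂μ, condCov μ (sigma Y s) (X (s + 1)) (Y (s + 1)) ω i j = S i j := by
      intro i j
      have h2 := hconst (fun p => p.1 i * p.2 j) (by fun_prop)
      have h3 : μ[fun ω' => (X (s + 1) ω' i - (μ[X (s + 1) | sigma Y s]) ω' i) *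
          (Y (s + 1) ω' j - (μ[Y (s + 1) | sigma Y s]) ω' j) | sigma Y s] =ᵐ[μ]
          μ[fun ω => a ω i * b ω j | sigma Y s] := by
        refine condExp_congr_ae ?_
        filter_upwards [hEX, hEY] with ω c d
        rw [c, d]; rfl
      exact h3.trans h2
    filter_upwards [ae_all_iff.2 fun i => ae_all_iff.2 (h1 i)] with ω hω
    ext i j
    exact hω i j
  have hcovYY : condCov μ (sigma Y s) (Y (s + 1)) (Y (s + 1)) =ᵐ[μ] fun _ => C := by
    have h1 : ∀ i j, ∀ᵐ ω ∂μ, condCov μ (sigma Y s) (Y (s + 1)) (Y (s + 1)) ω i j = C i j := by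
      intro i j
      have h2 := hconst (fun p => p.2 i * p.2 j) (by fun_prop)
      have h3 : μ[fun ω' => (Y (s + 1) ω' i - (μ[Y (s + 1) | sigma Y s]) ω' i) *
          (Y (s + 1) ω' j - (μ[Y (s + 1) | sigma Y s]) ω' j) | sigma Y s] =ᵐ[μ]
          μ[fun ω => b ω i * b ω j | sigma Y s] := by
        refine condExp_congr_ae ?_
        filter_upwards [hEY] with ω d
        rw [d]; rfl
      exact h3.trans h2
    filter_upwards [ae_all_iff.2 fun i => ae_all_iff.2 (h1 i)] with ω hω
    ext i j
    exact hω i j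
  have hres := indepFun_sub_act_pinv hG ha0 hb0
  let ρ : Ω → Vec p₁ p₂ := fun ω => a ω - act (S * pinv C) (b ω)
  have hρ : IndepFun ρ b μ := hres
  have hρm : Measurable ρ := by fun_prop
  have hρb : IndepFun (fun ω => (ρ ω, b ω)) Z μ :=
    hab.comp (φ := fun p => (p.1 - act (S * pinv C) p.2, p.2)) (by fun_prop) measurable_id
  have hρ2 : IndepFun ρ (fun ω => (b ω, Z ω)) μ :=
    indepFun_prodMk_of_indepFun hρm.aemeasurable hbm.aemeasurable hYs.aemeasurable hρ hρb
  have hρ3 : IndepFun ρ (seg Y 1 (s + 1)) μ := by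
    have := hρ2.comp (φ := id) (ψ := fun p => segSnoc (p.2, p.1 + Ty p.2)) measurable_id
      (by fun_prop)
    convert! this using 1
    funext ω
    simp only [Function.comp, b, sub_add_cancel]
    rw [hZdef, segSnoc_seg]
  let Φ : (Finset.Icc 1 (s + 1) → Vec p₁ p₂) → Vec p₁ p₂ := fun y =>
    Tx (segInit (Nat.le_succ s) y) + act (S * pinv C)
      (y ⟨s + 1, Finset.mem_Icc.2 ⟨by omega, le_rfl⟩⟩ - Ty (segInit (Nat.le_succ s) y))
  have hΦm : Measurable Φ := by fun_prop
  have hΦ : ∀ ω, X (s + 1) ω - Φ (seg Y 1 (s + 1) ω) = ρ ω := fun ω => by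
    simp only [Φ, ρ, a, b]
    rw [sub_sub]; rfl
  have hlinρ : LinearOf μ (driver X W V n n) ρ :=
    hablin.fst.sub (hablin.snd.map (actL (S * pinv C)))
  have hΦi : Integrable (fun ω => Φ (seg Y 1 (s + 1) ω)) μ :=
    (hR.isNoise.hasGaussianLaw_of_linearOf hn hM
      ((hZ.map Tx).add (hablin.snd.map (actL (S * pinv C))))).integrable
  have hest := condExp_eq_of_indepFun_sub (hR.integrable_X hn hM hs1) hXm (hR.measurable_segY hs)
    hΦm hΦi (by simp_rw [hΦ]; exact hρ3)
    (by simp_rw [hΦ]; exact hR.isNoise.integral_eq_zero_of_linearOf hn hM hlinρ)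
  filter_upwards [hest, hcovXY, hcovYY, hEX, hEY] with ω e1 e2 e3 e4 e5
  refine e1.trans ?_
  simp only [kalmanUpdate, est, Nat.add_sub_cancel]
  rw [e2, e3, e4, e5]
  rfl

theorem IsRealization.properties :
      ∀ t ∈ Finset.Icc 1 n,
        -- joint Gaussianity of `(X^t, Y^t)`
        IsGaussian (μ.map fun ω => (seg X 1 t ω, seg Y 1 t ω)) ∧
        -- the second form of the realization
        (∀ᵐ ω ∂μ, Y t ω = act (H t) (X t ω) +
          act (1 - H t) (est μ X Y t (t - 1) ω) + V t ω) ∧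
        -- prediction from the preceding estimate
        (∀ᵐ ω ∂μ, est μ X Y t (t - 1) ω =
          act (A (t - 1)) (prevEst μ X Y t ω)) ∧
        -- (a)(i): the test channel
        (∀ᵐ ω ∂μ, condDistrib (Y t) (fun ω' => (seg Y 1 (t - 1) ω', X t ω')) μ
            (seg Y 1 (t - 1) ω, X t ω) =
          testChannel (H t) (QV t) (A (t - 1))
            (prevEst μ X Y t ω) (X t ω)) ∧
        -- (a)(ii): the identities for the pay-off
        condMutualInfo μ (seg X 1 t) (Y t) (seg Y 1 (t - 1)) =
          condMutualInfo μ (X t) (Y t) (seg Y 1 (t - 1)) ∧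
        condMutualInfo μ (X t) (Y t) (seg Y 1 (t - 1)) =
          condMutualInfo μ (X t) (Y t)
            (fun ω => (seg Y 1 (t - 1) ω, prevEst μ X Y t ω)) ∧
        condMutualInfo μ (X t) (Y t)
            (fun ω => (seg Y 1 (t - 1) ω, prevEst μ X Y t ω)) =
          condMutualInfo μ (X t) (fun ω => (Y t ω, est μ X Y t t ω))
            (fun ω => (seg Y 1 (t - 1) ω, est μ X Y t (t - 1) ω)) ∧
        condMutualInfo μ (X t) (fun ω => (Y t ω, est μ X Y t t ω))
            (fun ω => (seg Y 1 (t - 1) ω, est μ X Y t (t - 1) ω)) =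
          condMutualInfo μ (X t) (Y t)
            (fun ω => (seg Y 1 (t - 1) ω, prevEst μ X Y t ω,
              est μ X Y t t ω)) +
          condMutualInfo μ (X t) (est μ X Y t t)
            (fun ω => (seg Y 1 (t - 1) ω, prevEst μ X Y t ω)) ∧
        -- the lower bound
        condMutualInfo μ (X t) (est μ X Y t t)
            (fun ω => (seg Y 1 (t - 1) ω, est μ X Y t (t - 1) ω)) ≤
          condMutualInfo μ (seg X 1 t) (Y t)
            (seg Y 1 (t - 1)) ∧
        -- and a sufficient condition for equality in it
        (EstEqReproduction μ X Y t →
          condMutualInfo μ (seg X 1 t) (Y t)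
              (seg Y 1 (t - 1)) =
            condMutualInfo μ (X t) (est μ X Y t t)
              (fun ω => (seg Y 1 (t - 1) ω, est μ X Y t (t - 1) ω))) ∧
        -- (b): the update identity, and its sufficiency
        est μ X Y t t =ᵐ[μ] kalmanUpdate μ X Y t ∧
        (kalmanUpdate μ X Y t =ᵐ[μ] Y t → EstEqReproduction μ X Y t) ∧
        -- (b): Conditions 1 and 2
        ((∀ᵐ ω ∂μ, IsUnit (condCov μ (sigma Y (t - 1)) (Y t) (Y t) ω)) →
          condCov μ (sigma Y (t - 1)) (X t) (Y t) =ᵐ[μ]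
            condCov μ (sigma Y (t - 1)) (Y t) (Y t) →
          μ[X t | sigma Y (t - 1)] =ᵐ[μ] μ[Y t | sigma Y (t - 1)] →
          est μ X Y t t =ᵐ[μ] kalmanUpdate μ X Y t ∧
            kalmanUpdate μ X Y t =ᵐ[μ] Y t) := by
  intro t ht
  obtain ⟨s, rfl⟩ : ∃ s, t = s + 1 := ⟨t - 1, by have := (Finset.mem_Icc.1 ht).1; omega⟩
  have hs := (Finset.mem_Icc.1 ht).2
  have hk := hR.est_eq_kalmanUpdate hn hM hs
  have hiff := estEqReproduction_iff (Y := Y) (hR.integrable_X hn hM ht)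
  refine ⟨hR.isGaussian hn hM hs, hR.eq_second_form hs, hR.est_succ_eq hn hM hs,
    hR.condDistrib_eq hn hM hs, hR.condMutualInfo_seg_eq hn hM hs,
    hR.condMutualInfo_prevEst hn hM hs (hR.measurable_Y _ ht),
    hR.condMutualInfo_prevEst_eq_prod_est hn hM hs,
    hR.condMutualInfo_prod_est_eq_add hn hM hs, hR.condMutualInfo_est_le hn hM hs,
    fun h => hR.condMutualInfo_eq_of_est_eq hn hM hs (hiff.1 h), hk,
    fun h => hiff.2 (hk.trans h), fun hu hc hm => ⟨hk, ?_⟩⟩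
  filter_upwards [hu, hc, hm] with ω h1 h2 h3
  simp only [kalmanUpdate, est]
  rw [h2, mul_pinv_of_isUnit h1, act_one, h3, add_sub_cancel]

end Realization


/-! ### Directed information under nonanticipation -/

section Directed

variable {Ω : Type*} [MeasurableSpace Ω] (μ : Measure Ω) [IsProbabilityMeasure μ]
  {E : Type*} [MeasurableSpace E] [StandardBorelSpace E] [Nonempty E]

theorem seg_one_zero_eq_const (Y : ℕ → Ω → E) :
    seg Y 1 0 = fun _ r => absurd r.2 (by simp) := by
  funext ω r
  exact absurd r.2 (by simp)

theorem condMutualInfo_seg_zero {α β : Type*} [MeasurableSpace α] [StandardBorelSpace α]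
    [Nonempty α] [MeasurableSpace β] [StandardBorelSpace β] [Nonempty β] {X : Ω → α} {U : Ω → β}
    {Y : ℕ → Ω → E} (hX : Measurable X) (hU : Measurable U) :
    condMutualInfo μ X U (seg Y 1 0) =
      InformationTheory.klDiv (μ.map fun ω => (X ω, U ω)) ((μ.map X).prod (μ.map U)) := by
  rw [seg_one_zero_eq_const Y]
  exact condMutualInfo_of_indepFun μ hX hU measurable_const (indepFun_const_right _ _)

/-- The chain rule along a process. -/
theorem sum_condMutualInfo_eq {α : Type*} [MeasurableSpace α] [StandardBorelSpace α]
    [Nonempty α] {X : Ω → α} {Y : ℕ → Ω → E} {n : ℕ} (hX : Measurable X)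
    (hY : ∀ t ∈ Finset.Icc 1 n, Measurable (Y t)) {s : ℕ} (hs : s ≤ n) :
    ∑ t ∈ Finset.Icc 1 s, condMutualInfo μ X (Y t) (seg Y 1 (t - 1)) =
      condMutualInfo μ X (seg Y 1 s) (seg Y 1 0) := by
  have hY0 : Measurable (seg Y 1 0) := measurable_seg_of_le (Nat.zero_le n) hY
  induction s with
  | zero =>
    rw [condMutualInfo_comp_self μ hX hY0 (g := fun z => z) measurable_id]
    simp
  | succ s ih =>
    have hYs : Measurable (seg Y 1 s) := measurable_seg_of_le (by omega) hY
    have hYs1 : Measurable (seg Y 1 (s + 1)) := measurable_seg_of_le hs hY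
    have hYt := hY (s + 1) (Finset.mem_Icc.2 ⟨by omega, hs⟩)
    rw [Finset.sum_Icc_succ_top (by omega), ih (by omega)]
    have h1 := condMutualInfo_prod_eq_add μ hX hYs hYt hY0
    have h2 : condMutualInfo μ X (Y (s + 1)) (fun ω => (seg Y 1 0 ω, seg Y 1 s ω)) =
        condMutualInfo μ X (Y (s + 1)) (seg Y 1 s) :=
      (condMutualInfo_congr_cond μ hX hYt hYs (hY0.prodMk hYs)
        (φ := fun z => (segInit (Nat.zero_le s) z, z)) (ψ := Prod.snd) (by fun_prop) measurable_snd
        (Filter.EventuallyEq.refl _ _) (Filter.EventuallyEq.refl _ _)).symm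
    rw [h2] at h1
    rw [Nat.add_sub_cancel, ← h1]
    refine le_antisymm
      (condMutualInfo_le_right μ hX hYs1 hY0
        (h := fun p => (segInit (Nat.le_succ s) p.2,
          p.2 ⟨s + 1, Finset.mem_Icc.2 ⟨by omega, le_rfl⟩⟩)) (by fun_prop)
        (Filter.EventuallyEq.refl _ _))
      (condMutualInfo_le_right μ hX (hYs.prodMk hYt) hY0 (h := fun p => segSnoc p.2)
        (by fun_prop) (Filter.Eventually.of_forall fun ω => (segSnoc_seg Y 1 s ω).symm))

/-- A channel which only sees `ψ(U)` is also a channel from `ψ(U)`. -/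
theorem map_comp_eq_compProd {α β γ : Type*} [MeasurableSpace α] [MeasurableSpace β]
    [MeasurableSpace γ] {U : Ω → α} {Y : Ω → β} (hU : Measurable U) (hY : Measurable Y)
    {κ : Kernel α β} [IsMarkovKernel κ] {η : Kernel γ β} [IsMarkovKernel η]
    (h : μ.map (fun ω => (U ω, Y ω)) = μ.map U ⊗ₘ κ) {ψ : α → γ} (hψ : Measurable ψ)
    (hη : ∀ u, η (ψ u) = κ u) :
    μ.map (fun ω => (ψ (U ω), Y ω)) = (μ.map fun ω => ψ (U ω)) ⊗ₘ η := by
  have := Measure.isProbabilityMeasure_map (μ := μ) hU.aemeasurable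
  have := Measure.isProbabilityMeasure_map (μ := μ) (hψ.comp hU).aemeasurable
  have e := congrArg (Measure.map (Prod.map ψ id)) h
  rw [Measure.map_map (by fun_prop) (by fun_prop)] at e
  refine Eq.trans e ?_
  have e2 : (μ.map fun ω => ψ (U ω)) = (μ.map U).map ψ := by
    rw [Measure.map_map hψ hU]; rfl
  rw [e2]
  have := Measure.isProbabilityMeasure_map (μ := μ.map U) hψ.aemeasurable
  refine Measure.ext_of_lintegral _ fun f hf => ?_
  rw [MeasureTheory.lintegral_map hf (by fun_prop), Measure.lintegral_compProd (by fun_prop),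
    Measure.lintegral_compProd hf, MeasureTheory.lintegral_map
      (Measurable.lintegral_kernel_prod_right' hf) hψ]
  refine lintegral_congr fun u => ?_
  rw [hη]; rfl

/-- `Y^t` is conditionally independent of `X^n` given `X^t`, for each `t < n`. -/
def Nonanticipative (n : ℕ) (X Y : ℕ → Ω → E) : Prop :=
  ∀ (t : ℕ) (ht : t ≤ n), t ∈ Finset.Icc 1 (n - 1) →
    ∃ κ : Kernel (Finset.Icc 1 t → E) (Finset.Icc 1 t → E), IsMarkovKernel κ ∧
      μ.map (fun ω => (seg X 1 n ω, seg Y 1 t ω)) =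
        μ.map (seg X 1 n) ⊗ₘ κ.comap (segInit ht) (measurable_segInit ht)

variable {μ}

theorem nonanticipative_iff {n : ℕ} {X Y : ℕ → Ω → E} (hX : ∀ t ∈ Finset.Icc 1 n, Measurable (X t))
    (hY : ∀ t ∈ Finset.Icc 1 n, Measurable (Y t)) :
    Nonanticipative μ n X Y ↔ ∀ t ∈ Finset.Icc 1 (n - 1), ∀ᵐ ω ∂μ,
      condDistrib (seg Y 1 t) (seg X 1 n) μ (seg X 1 n ω) =
        condDistrib (seg Y 1 t) (seg X 1 t) μ (seg X 1 t ω) := by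
  have hXn : Measurable (seg X 1 n) := measurable_seg hX
  constructor
  · intro h t ht
    have htn : t ≤ n := by have := (Finset.mem_Icc.1 ht).2; omega
    have hXt : Measurable (seg X 1 t) := measurable_seg_of_le htn hX
    have hYt : Measurable (seg Y 1 t) := measurable_seg_of_le htn hY
    obtain ⟨κ, hκ, h1⟩ := h t htn ht
    have h2 : μ.map (fun ω => (seg X 1 t ω, seg Y 1 t ω)) = μ.map (seg X 1 t) ⊗ₘ κ :=
      map_comp_eq_compProd μ hXn hYt h1 (measurable_segInit htn) fun _ => rfl
    have h3 := ae_of_ae_map hXn.aemeasurable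
      (condDistrib_ae_eq_of_measure_eq_compProd _ hYt.aemeasurable h1)
    have h4 := ae_of_ae_map hXt.aemeasurable
      (condDistrib_ae_eq_of_measure_eq_compProd _ hYt.aemeasurable h2)
    filter_upwards [h3, h4] with ω a b
    rw [a, b]; rfl
  · intro h t htn ht
    have hYt : Measurable (seg Y 1 t) := measurable_seg_of_le htn hY
    have hXt : Measurable (seg X 1 t) := measurable_seg_of_le htn hX
    refine ⟨condDistrib (seg Y 1 t) (seg X 1 t) μ, inferInstance, ?_⟩
    have := Measure.isProbabilityMeasure_map (μ := μ) hXn.aemeasurable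
    rw [← compProd_map_condDistrib hYt.aemeasurable]
    refine Measure.ext_of_lintegral _ fun f hf => ?_
    rw [Measure.lintegral_compProd hf, Measure.lintegral_compProd hf,
      MeasureTheory.lintegral_map (Measurable.lintegral_kernel_prod_right' hf) hXn,
      MeasureTheory.lintegral_map (Measurable.lintegral_kernel_prod_right' hf) hXn]
    refine lintegral_congr_ae ?_
    filter_upwards [h t ht] with ω hω
    rw [hω]; rfl

theorem Nonanticipative.condMutualInfo_eq {n : ℕ} {X Y : ℕ → Ω → E}
    (hX : ∀ t ∈ Finset.Icc 1 n, Measurable (X t))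
    (hY : ∀ t ∈ Finset.Icc 1 n, Measurable (Y t)) (h : Nonanticipative μ n X Y) {t : ℕ}
    (ht : t ∈ Finset.Icc 1 n) :
    condMutualInfo μ (seg X 1 n) (Y t) (seg Y 1 (t - 1)) =
      condMutualInfo μ (seg X 1 t) (Y t) (seg Y 1 (t - 1)) := by
  obtain ⟨s, rfl⟩ : ∃ s, t = s + 1 := ⟨t - 1, by have := (Finset.mem_Icc.1 ht).1; omega⟩
  have hs := (Finset.mem_Icc.1 ht).2
  rcases hs.eq_or_lt with rfl | hlt
  · rfl
  have hXn : Measurable (seg X 1 n) := measurable_seg hX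
  have hXt : Measurable (seg X 1 (s + 1)) := measurable_seg_of_le hs hX
  have hYs : Measurable (seg Y 1 s) := measurable_seg_of_le (by omega) hY
  have hYt : Measurable (seg Y 1 (s + 1)) := measurable_seg_of_le hs hY
  have hY1 := hY _ ht
  obtain ⟨κ, hκ, h1⟩ := h (s + 1) hs (Finset.mem_Icc.2 ⟨by omega, by omega⟩)
  have h2 : condMutualInfo μ (seg X 1 n) (seg Y 1 (s + 1)) (seg X 1 (s + 1)) = 0 := by
    refine condMutualInfo_eq_zero μ hXn hYt hXt κ ?_
    exact map_comp_eq_compProd μ hXn hYt h1 (ψ := fun x => (segInit hs x, x)) (by fun_prop)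
      fun _ => rfl
  have h3 : condMutualInfo μ (seg X 1 n) (fun ω => (seg Y 1 s ω, Y (s + 1) ω))
      (seg X 1 (s + 1)) = 0 :=
    le_antisymm (h2 ▸ condMutualInfo_le_right μ hXn hYt hXt
        (h := fun p => (segInit (Nat.le_succ s) p.2,
          p.2 ⟨s + 1, Finset.mem_Icc.2 ⟨by omega, le_rfl⟩⟩)) (by fun_prop)
        (Filter.EventuallyEq.refl _ _)) zero_le
  rw [condMutualInfo_prod_eq_add μ hXn hYs hY1 hXt, add_eq_zero] at h3
  have h4 := h3.2
  rw [condMutualInfo_prod_swap μ hXn hY1 hXt hYs, condMutualInfo_comm μ hXn hY1 (by fun_prop)] at h4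
  have h5 := condMutualInfo_prod_eq_add μ hY1 hXt hXn hYs
  rw [h4, add_zero] at h5
  rw [Nat.add_sub_cancel, condMutualInfo_comm μ hXn hY1 hYs, condMutualInfo_comm μ hXt hY1 hYs,
    ← h5]
  exact le_antisymm
    (condMutualInfo_le_right μ hY1 (hXt.prodMk hXn) hYs (h := fun p => p.2.2) (by fun_prop)
      (Filter.EventuallyEq.refl _ _))
    (condMutualInfo_le_right μ hY1 hXn hYs (h := fun p => (segInit hs p.2, p.2)) (by fun_prop)
      (Filter.EventuallyEq.refl _ _))

/-- A variable independent of `Z` is independent of the output of a channel driven by `Z`. -/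
theorem indepFun_of_map_eq_compProd {α β γ : Type*} [MeasurableSpace α] [MeasurableSpace β]
    [MeasurableSpace γ] {Z : Ω → α} {D : Ω → β} {Y : Ω → γ} (hZ : Measurable Z)
    (hD : Measurable D) (hY : Measurable Y) (κ : Kernel α γ) [IsMarkovKernel κ]
    (h : μ.map (fun ω => ((Z ω, D ω), Y ω)) = (μ.map fun ω => (Z ω, D ω)) ⊗ₘ κ.prodMkRight β)
    (hDZ : IndepFun Z D μ) : IndepFun D Y μ := by
  have := Measure.isProbabilityMeasure_map (μ := μ) hZ.aemeasurable
  have := Measure.isProbabilityMeasure_map (μ := μ) hD.aemeasurable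
  have := Measure.isProbabilityMeasure_map (μ := μ) hY.aemeasurable
  rw [indepFun_iff_map_prod_eq_prod_map_map hD.aemeasurable hY.aemeasurable]
  rw [(indepFun_iff_map_prod_eq_prod_map_map hZ.aemeasurable hD.aemeasurable).1 hDZ] at h
  have key : ∀ g : (α × β) × γ → ℝ≥0∞, Measurable g → ∫⁻ ω, g ((Z ω, D ω), Y ω) ∂μ =
      ∫⁻ d, ∫⁻ z, ∫⁻ y, g ((z, d), y) ∂κ z ∂μ.map Z ∂μ.map D := fun g hg => by
    have h1 : ∫⁻ ω, g ((Z ω, D ω), Y ω) ∂μ =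
        ∫⁻ p, g p ∂μ.map (fun ω => ((Z ω, D ω), Y ω)) := by
      rw [MeasureTheory.lintegral_map hg (by fun_prop)]
    rw [h1, h, Measure.lintegral_compProd hg, lintegral_prod_symm _
      (Measurable.lintegral_kernel_prod_right' (κ := κ.prodMkRight β) hg).aemeasurable]
    rfl
  refine Measure.ext_of_lintegral _ fun f hf => ?_
  rw [MeasureTheory.lintegral_map hf (by fun_prop), lintegral_prod _ hf.aemeasurable,
    key (fun p => f (p.1.2, p.2)) (by fun_prop)]
  refine lintegral_congr fun d => ?_
  rw [MeasureTheory.lintegral_map (by fun_prop) hY, key (fun p => f (d, p.2)) (by fun_prop)]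
  simp

theorem indepFun_map_iff {Ω' α β : Type*} [MeasurableSpace Ω'] [MeasurableSpace α]
    [MeasurableSpace β] {h : Ω → Ω'} (hh : Measurable h) {f : Ω' → α} {g : Ω' → β}
    (hf : Measurable f) (hg : Measurable g) :
    IndepFun f g (μ.map h) ↔ IndepFun (f ∘ h) (g ∘ h) μ := by
  have := Measure.isProbabilityMeasure_map (μ := μ) hh.aemeasurable
  rw [indepFun_iff_map_prod_eq_prod_map_map hf.aemeasurable hg.aemeasurable,
    indepFun_iff_map_prod_eq_prod_map_map (hf.comp hh).aemeasurable (hg.comp hh).aemeasurable,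
    Measure.map_map (by fun_prop) hh, Measure.map_map hf hh, Measure.map_map hg hh]
  rfl

theorem payoff_eq_klDiv {p₁ p₂ n : ℕ} {X Y : ℕ → Ω → Vec p₁ p₂}
    (hX : ∀ t ∈ Finset.Icc 1 n, Measurable (X t))
    (hY : ∀ t ∈ Finset.Icc 1 n, Measurable (Y t)) (h : Nonanticipative μ n X Y) :
    payoff n μ X Y = InformationTheory.klDiv (μ.map fun ω => (seg X 1 n ω, seg Y 1 n ω))
      ((μ.map (seg X 1 n)).prod (μ.map (seg Y 1 n))) := by
  rw [← condMutualInfo_seg_zero μ (Y := Y) (measurable_seg hX) (measurable_seg hY),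
    ← sum_condMutualInfo_eq μ (measurable_seg hX) hY le_rfl, payoff]
  exact Finset.sum_congr rfl fun t ht => (h.condMutualInfo_eq hX hY ht).symm

end Directed


/-! ### Second moments of admissible laws -/

/-- Scalar coordinates of a trajectory. -/
abbrev Idx (n p₁ p₂ : ℕ) : Type := Finset.Icc 1 n × (Fin p₁ ⊕ Fin p₂)

/-- The scalar coordinates of a process. -/
def coords {Ω : Type*} {p₁ p₂ : ℕ} (n : ℕ) (X : ℕ → Ω → Vec p₁ p₂) (k : Idx n p₁ p₂) (ω : Ω) : ℝ :=
  X k.1 ω k.2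

/-- The mean squared error, as a function of the second moments, of the coordinates in the range
of `f`. -/
noncomputable def cost {n p₁ p₂ p : ℕ} (f : Fin p → Fin p₁ ⊕ Fin p₂)
    (K : Matrix (Idx n p₁ p₂ ⊕ Idx n p₁ p₂) (Idx n p₁ p₂ ⊕ Idx n p₁ p₂) ℝ) : ℝ :=
  (1 / (n : ℝ)) * ∑ t : Finset.Icc 1 n, ∑ i, (K (.inl (t, f i)) (.inl (t, f i)) -
    2 * K (.inl (t, f i)) (.inr (t, f i)) + K (.inr (t, f i)) (.inr (t, f i)))

/-- Second moment matrices with prescribed source block `S` which satisfy the linear consequences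
of nonanticipation and the fidelity criteria. -/
def momentSet {n p₁ p₂ : ℕ} (A : ℕ → SqMat p₁ p₂) (S : Matrix (Idx n p₁ p₂) (Idx n p₁ p₂) ℝ)
    (Δ₁ Δ₂ : ℝ≥0) : Set (Matrix (Idx n p₁ p₂ ⊕ Idx n p₁ p₂) (Idx n p₁ p₂ ⊕ Idx n p₁ p₂) ℝ) :=
  {K | (∀ a b, K a b = K b a) ∧ (∀ v, 0 ≤ v ⬝ᵥ K *ᵥ v) ∧ (∀ a b, K (.inl a) (.inl b) = S a b) ∧
    (∀ t t' r : Finset.Icc 1 n, (t' : ℕ) = t + 1 → (r : ℕ) ≤ t → ∀ i j,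
      K (.inl (t', i)) (.inr (r, j)) = ∑ k, A t i k * K (.inl (t, k)) (.inr (r, j))) ∧
    cost Sum.inl K ≤ Δ₁ ∧ cost Sum.inr K ≤ Δ₂}

section Quadratic

variable {ι : Type*} [Fintype ι] [DecidableEq ι] {K : Matrix ι ι ℝ}

theorem quadratic_single_add_single (hs : ∀ a b, K a b = K b a) (a b : ι) (c d : ℝ) :
    (Pi.single a c + Pi.single b d) ⬝ᵥ K *ᵥ (Pi.single a c + Pi.single b d) =
      c ^ 2 * K a a + 2 * c * d * K a b + d ^ 2 * K b b := by
  simp only [mulVec_add, dotProduct_add, add_dotProduct, single_dotProduct, mulVec_single,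
    Pi.smul_apply, Matrix.col_apply, MulOpposite.smul_eq_mul_unop, MulOpposite.unop_op]
  rw [hs b a]
  ring

theorem quadratic_nonneg (hs : ∀ a b, K a b = K b a) (hK : ∀ v, 0 ≤ v ⬝ᵥ K *ᵥ v) (a b : ι)
    (c d : ℝ) : 0 ≤ c ^ 2 * K a a + 2 * c * d * K a b + d ^ 2 * K b b := by
  rw [← quadratic_single_add_single hs]
  exact hK _

end Quadratic

section MomentSet

variable {n p₁ p₂ : ℕ} {A : ℕ → SqMat p₁ p₂} {S : Matrix (Idx n p₁ p₂) (Idx n p₁ p₂) ℝ}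
  {Δ₁ Δ₂ : ℝ≥0}

theorem isClosed_momentSet : IsClosed (momentSet A S Δ₁ Δ₂) := by
  simp only [momentSet, Set.ofPred_and, Set.ofPred_forall]
  refine IsClosed.inter ?_ (IsClosed.inter ?_ (IsClosed.inter ?_ (IsClosed.inter ?_
    (IsClosed.inter ?_ ?_))))
  · exact isClosed_iInter fun a => isClosed_iInter fun b =>
      isClosed_eq (by fun_prop) (by fun_prop)
  · exact isClosed_iInter fun v => isClosed_le (by fun_prop) (by fun_prop)
  · exact isClosed_iInter fun a => isClosed_iInter fun b =>
      isClosed_eq (by fun_prop) (by fun_prop)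
  · exact isClosed_iInter fun t => isClosed_iInter fun t' => isClosed_iInter fun r =>
      isClosed_iInter fun _ => isClosed_iInter fun _ => isClosed_iInter fun i =>
      isClosed_iInter fun j => isClosed_eq (by fun_prop) (by fun_prop)
  · exact isClosed_le (by unfold cost; fun_prop) (by fun_prop)
  · exact isClosed_le (by unfold cost; fun_prop) (by fun_prop)

theorem diag_le_of_cost_le {p : ℕ} (hn : 1 ≤ n) {f : Fin p → Fin p₁ ⊕ Fin p₂}
    {K : Matrix (Idx n p₁ p₂ ⊕ Idx n p₁ p₂) (Idx n p₁ p₂ ⊕ Idx n p₁ p₂) ℝ} {Δ : ℝ}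
    (hs : ∀ a b, K a b = K b a) (hK : ∀ v, 0 ≤ v ⬝ᵥ K *ᵥ v) (hc : cost f K ≤ Δ)
    (t : Finset.Icc 1 n) (i : Fin p) :
    K (.inr (t, f i)) (.inr (t, f i)) ≤ 2 * K (.inl (t, f i)) (.inl (t, f i)) + 2 * (n * Δ) := by
  have hn' : (0 : ℝ) < n := by exact_mod_cast hn
  have h0 : ∀ (t : Finset.Icc 1 n) (i : Fin p), 0 ≤ K (.inl (t, f i)) (.inl (t, f i)) -
      2 * K (.inl (t, f i)) (.inr (t, f i)) + K (.inr (t, f i)) (.inr (t, f i)) := fun t i => by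
    have := quadratic_nonneg hs hK (.inl (t, f i)) (.inr (t, f i)) 1 (-1)
    linarith
  have h1 : K (.inl (t, f i)) (.inl (t, f i)) -
      2 * K (.inl (t, f i)) (.inr (t, f i)) + K (.inr (t, f i)) (.inr (t, f i)) ≤ n * Δ := by
    have h2 : n * cost f K = ∑ t : Finset.Icc 1 n, ∑ i, (K (.inl (t, f i)) (.inl (t, f i)) -
        2 * K (.inl (t, f i)) (.inr (t, f i)) + K (.inr (t, f i)) (.inr (t, f i))) := by
      rw [cost, ← mul_assoc, mul_one_div_cancel hn'.ne', one_mul]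
    refine le_trans ?_ (h2 ▸ mul_le_mul_of_nonneg_left hc hn'.le)
    refine le_trans (Finset.single_le_sum (fun i _ => h0 t i) (Finset.mem_univ i)) ?_
    exact Finset.single_le_sum (f := fun t => ∑ i, (K (.inl (t, f i)) (.inl (t, f i)) -
        2 * K (.inl (t, f i)) (.inr (t, f i)) + K (.inr (t, f i)) (.inr (t, f i))))
      (fun t _ => Finset.sum_nonneg fun i _ => h0 t i) (Finset.mem_univ t)
  have := quadratic_nonneg hs hK (.inl (t, f i)) (.inr (t, f i)) 2 (-1)
  linarith

theorem isCompact_momentSet (hn : 1 ≤ n) : IsCompact (momentSet A S Δ₁ Δ₂) := by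
  obtain ⟨M, hM⟩ : ∃ M : ℝ, ∀ a, S a a ≤ M :=
    ⟨∑ a, |S a a|, fun a => (le_abs_self _).trans
      (Finset.single_le_sum (f := fun a => |S a a|) (fun _ _ => abs_nonneg _) (Finset.mem_univ a))⟩
  set R : ℝ := |M| + (2 * |M| + 2 * (n * Δ₁) + 2 * (n * Δ₂)) with hR
  refine IsCompact.of_isClosed_subset
    (isCompact_univ_pi fun _ => isCompact_univ_pi fun _ => isCompact_Icc (a := -R) (b := R))
    isClosed_momentSet ?_
  rintro K ⟨hs, hK, hS, -, h1, h2⟩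
  have hn0 : (0 : ℝ) ≤ n := Nat.cast_nonneg n
  have hnΔ₁ : 0 ≤ n * (Δ₁ : ℝ) := by positivity
  have hnΔ₂ : 0 ≤ n * (Δ₂ : ℝ) := by positivity
  have hdiag : ∀ a, K a a ≤ R := by
    rintro (a | ⟨t, i | i⟩)
    · rw [hS]
      have := hM a
      have := le_abs_self M
      linarith [abs_nonneg M]
    · have := diag_le_of_cost_le hn hs hK h1 t i
      have := hM (t, Sum.inl i)
      rw [hS] at *
      have := le_abs_self M
      linarith [abs_nonneg M]
    · have := diag_le_of_cost_le hn hs hK h2 t i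
      have := hM (t, Sum.inr i)
      rw [hS] at *
      have := le_abs_self M
      linarith [abs_nonneg M]
  intro a _ b _
  have e1 := quadratic_nonneg hs hK a b 1 1
  have e2 := quadratic_nonneg hs hK a b 1 (-1)
  have := hdiag a
  have := hdiag b
  constructor <;> linarith

end MomentSet

section Admissible

variable {Ω : Type*} [MeasurableSpace Ω] {μ : Measure Ω} [IsProbabilityMeasure μ]
  {p₁ p₂ n : ℕ} {X Y : ℕ → Ω → Vec p₁ p₂}

theorem secondMoment_symm {ι : Type*} (z : ι → Ω → ℝ) (a b : ι) :
    secondMoment μ z a b = secondMoment μ z b a := by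
  simp only [secondMoment, Matrix.of_apply, mul_comm]

theorem secondMoment_nonneg {ι : Type*} [Fintype ι] {z : ι → Ω → ℝ} (hz : ∀ i, MemLp (z i) 2 μ)
    (v : ι → ℝ) : 0 ≤ v ⬝ᵥ secondMoment μ z *ᵥ v := by
  rw [← integral_sum_mul_sum hz]
  exact integral_nonneg fun ω => mul_self_nonneg _

theorem distortion_eq {p : ℕ} (f : Fin p → Fin p₁ ⊕ Fin p₂) (x y : ℕ → Vec p₁ p₂) :
    distortion n (fun t => WithLp.toLp 2 fun i => x t (f i))
      (fun t => WithLp.toLp 2 fun i => y t (f i)) =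
    (1 / (n : ℝ)) * ∑ t : Finset.Icc 1 n, ∑ i, (x t (f i) - y t (f i)) ^ 2 := by
  rw [distortion, ← Finset.sum_coe_sort]
  congr 1
  refine Finset.sum_congr rfl fun t _ => ?_
  rw [EuclideanSpace.norm_sq_eq]
  simp

theorem integral_distortion {p : ℕ} (f : Fin p → Fin p₁ ⊕ Fin p₂)
    (hX : ∀ k, MemLp (coords n X k) 2 μ) (hY : ∀ k, MemLp (coords n Y k) 2 μ) :
    ∫ ω, distortion n (fun t => WithLp.toLp 2 fun i => X t ω (f i))
      (fun t => WithLp.toLp 2 fun i => Y t ω (f i)) ∂μ =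
    cost f (secondMoment μ (Sum.elim (coords n X) (coords n Y))) := by
  simp_rw [distortion_eq f (fun t => X t _) (fun t => Y t _)]
  have hi : ∀ (t : Finset.Icc 1 n) (i : Fin p),
      Integrable (fun ω => (X t ω (f i) - Y t ω (f i)) ^ 2) μ := fun t i =>
    ((hX (t, f i)).sub (hY (t, f i))).integrable_sq
  rw [integral_const_mul, integral_finsetSum _ fun t _ => integrable_finsetSum _ fun i _ => hi t i,
    cost]
  congr 1
  refine Finset.sum_congr rfl fun t _ => ?_
  rw [integral_finsetSum _ fun i _ => hi t i]
  refine Finset.sum_congr rfl fun i _ => ?_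
  simp only [secondMoment, Matrix.of_apply, Sum.elim_inl, Sum.elim_inr]
  have h1 : Integrable (fun ω => coords n X (t, f i) ω * coords n X (t, f i) ω) μ :=
    (hX _).integrable_mul (hX _)
  have h2 : Integrable (fun ω => coords n X (t, f i) ω * coords n Y (t, f i) ω) μ :=
    (hX _).integrable_mul (hY _)
  have h3 : Integrable (fun ω => coords n Y (t, f i) ω * coords n Y (t, f i) ω) μ :=
    (hY _).integrable_mul (hY _)
  have h4 : Integrable (fun ω => coords n X (t, f i) ω * coords n X (t, f i) ω -
      2 * (coords n X (t, f i) ω * coords n Y (t, f i) ω)) μ := h1.sub (h2.const_mul 2)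
  rw [← integral_const_mul, ← integral_sub h1 (h2.const_mul 2), ← integral_add h4 h3]
  refine integral_congr_ae (Filter.Eventually.of_forall fun ω => ?_)
  simp only [coords]
  ring

theorem distortion_nonneg {p : ℕ} (x y : ℕ → EuclideanSpace ℝ (Fin p)) : 0 ≤ distortion n x y := by
  unfold distortion
  positivity

theorem memLp_sub_of_distortion {p : ℕ} (hn : 1 ≤ n) (f : Fin p → Fin p₁ ⊕ Fin p₂) {Δ : ℝ≥0}
    (hXm : ∀ t ∈ Finset.Icc 1 n, Measurable (X t)) (hYm : ∀ t ∈ Finset.Icc 1 n, Measurable (Y t))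
    (h : ∫⁻ ω, ENNReal.ofReal (distortion n (fun t => WithLp.toLp 2 fun i => X t ω (f i))
      (fun t => WithLp.toLp 2 fun i => Y t ω (f i))) ∂μ ≤ Δ) (t : Finset.Icc 1 n) (i : Fin p) :
    MemLp (fun ω => X t ω (f i) - Y t ω (f i)) 2 μ := by
  have hn' : (0 : ℝ) < n := by exact_mod_cast hn
  have hm : ∀ (t : Finset.Icc 1 n) (i : Fin p), Measurable fun ω => X t ω (f i) - Y t ω (f i) :=
    fun t i => by
      have := hXm t t.2
      have := hYm t t.2
      fun_prop
  rw [memLp_two_iff_integrable_sq (hm t i).aestronglyMeasurable]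
  have hd : Integrable (fun ω => distortion n (fun t => WithLp.toLp 2 fun i => X t ω (f i))
      (fun t => WithLp.toLp 2 fun i => Y t ω (f i))) μ := by
    refine ⟨?_, ?_⟩
    · simp_rw [distortion_eq f (fun t => X t _) (fun t => Y t _)]
      exact (Measurable.const_mul (Finset.measurable_fun_sum _ fun t _ =>
        Finset.measurable_fun_sum _ fun i _ => (hm t i).pow_const 2) _).aestronglyMeasurable
    · rw [hasFiniteIntegral_iff_ofReal (Filter.Eventually.of_forall fun ω => distortion_nonneg _ _)]
      exact h.trans_lt ENNReal.coe_lt_top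
  refine (hd.const_mul (n : ℝ)).mono' ((hm t i).pow_const 2).aestronglyMeasurable
    (Filter.Eventually.of_forall fun ω => ?_)
  rw [distortion_eq f (fun t => X t ω) (fun t => Y t ω), ← mul_assoc,
    mul_one_div_cancel hn'.ne', one_mul, Real.norm_of_nonneg (sq_nonneg _)]
  refine le_trans (Finset.single_le_sum (f := fun i => (X t ω (f i) - Y t ω (f i)) ^ 2)
    (fun i _ => sq_nonneg _) (Finset.mem_univ i)) ?_
  exact Finset.single_le_sum (f := fun t : Finset.Icc 1 n => ∑ i, (X t ω (f i) - Y t ω (f i)) ^ 2)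
    (fun t _ => Finset.sum_nonneg fun i _ => sq_nonneg _) (Finset.mem_univ t)

theorem secondMoment_mem_momentSet {A : ℕ → SqMat p₁ p₂} {Δ₁ Δ₂ : ℝ≥0}
    (hX : ∀ k, MemLp (coords n X k) 2 μ) (hY : ∀ k, MemLp (coords n Y k) 2 μ)
    (hD : ∀ t ∈ Finset.Icc 1 (n - 1),
      IndepFun (fun ω => X (t + 1) ω - act (A t) (X t ω)) (seg Y 1 t) μ)
    (hX0 : ∀ k, ∫ ω, coords n X k ω ∂μ = 0)
    (h₁ : ∫ ω, distortion n (fun t => comp₁ (X t ω)) (fun t => comp₁ (Y t ω)) ∂μ ≤ Δ₁)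
    (h₂ : ∫ ω, distortion n (fun t => comp₂ (X t ω)) (fun t => comp₂ (Y t ω)) ∂μ ≤ Δ₂) :
    secondMoment μ (Sum.elim (coords n X) (coords n Y)) ∈
      momentSet A (secondMoment μ (coords n X)) Δ₁ Δ₂ := by
  have hXY : ∀ k, MemLp (Sum.elim (coords n X) (coords n Y) k) 2 μ := by
    rintro (k | k)
    · exact hX k
    · exact hY k
  refine ⟨secondMoment_symm _, secondMoment_nonneg hXY, fun a b => rfl, ?_, ?_, ?_⟩
  · intro t t' r htt' hrt i j
    have ht : (t : ℕ) ∈ Finset.Icc 1 (n - 1) := by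
      have := Finset.mem_Icc.1 t.2
      have := Finset.mem_Icc.1 t'.2
      exact Finset.mem_Icc.2 ⟨by omega, by omega⟩
    have hr : (r : ℕ) ∈ Finset.Icc 1 (t : ℕ) := Finset.mem_Icc.2 ⟨(Finset.mem_Icc.1 r.2).1, hrt⟩
    have hind : IndepFun (fun ω => coords n X (t', i) ω - ∑ k, A t i k * coords n X (t, k) ω)
        (coords n Y (r, j)) μ := by
      have := (hD t ht).comp (φ := fun x : Vec p₁ p₂ => x i)
        (ψ := fun y : Finset.Icc 1 (t : ℕ) → Vec p₁ p₂ => y ⟨r, hr⟩ j) (by fun_prop) (by fun_prop)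
      convert! this using 1
      funext ω
      simp only [coords, Function.comp, PiLp.sub_apply, act, mulVec, dotProduct]
      rw [htt']
    have hs : MemLp (fun ω => ∑ k, A t i k * coords n X (t, k) ω) 2 μ :=
      memLp_finsetSum _ fun k _ => (hX (t, k)).const_mul _
    have h0 : ∫ ω, (coords n X (t', i) ω - ∑ k, A t i k * coords n X (t, k) ω) ∂μ = 0 := by
      rw [integral_sub ((hX _).integrable one_le_two) (hs.integrable one_le_two), hX0,
        integral_finsetSum _ fun k _ => ((hX (t, k)).integrable one_le_two).const_mul _]
      simp [integral_const_mul, hX0]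
    have h1 := hind.integral_fun_mul_eq_mul_integral
      ((hX (t', i)).sub hs).aestronglyMeasurable (hY (r, j)).aestronglyMeasurable
    rw [h0, zero_mul] at h1
    have e1 : Integrable (fun ω => coords n X (t', i) ω * coords n Y (r, j) ω) μ :=
      (hX _).integrable_mul (hY _)
    have e2 : ∀ k, Integrable (fun ω => A t i k * (coords n X (t, k) ω * coords n Y (r, j) ω)) μ :=
      fun k => ((hX _).integrable_mul (hY _)).const_mul _
    have e3 : ∀ ω, (coords n X (t', i) ω - ∑ k, A t i k * coords n X (t, k) ω) *
        coords n Y (r, j) ω = coords n X (t', i) ω * coords n Y (r, j) ω -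
          ∑ k, A t i k * (coords n X (t, k) ω * coords n Y (r, j) ω) := fun ω => by
      rw [sub_mul, Finset.sum_mul]
      simp only [mul_assoc]
    simp_rw [e3] at h1
    rw [integral_sub e1 (integrable_finsetSum _ fun k _ => e2 k),
      integral_finsetSum _ fun k _ => e2 k, sub_eq_zero] at h1
    simp_rw [integral_const_mul] at h1
    exact h1
  · rw [← integral_distortion Sum.inl hX hY]
    exact h₁
  · rw [← integral_distortion Sum.inr hX hY]
    exact h₂

end Admissible


/-! ### The lower bound -/

section LowerBound

variable {Ω : Type*} [MeasurableSpace Ω] {μ : Measure Ω} [IsProbabilityMeasure μ]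
  {p₁ p₂ q₁ q₂ n : ℕ} {X : ℕ → Ω → Vec p₁ p₂} {W : ℕ → Ω → Vec q₁ q₂}
  {A : ℕ → SqMat p₁ p₂} {B : ℕ → Matrix (Fin p₁ ⊕ Fin p₂) (Fin q₁ ⊕ Fin q₂) ℝ}
  {QX : SqMat p₁ p₂} {QW : ℕ → SqMat q₁ q₂}

section Source

variable (hn : 1 ≤ n) (hM : IsGaussMarkov μ n A B QX QW X W)
include hn hM

theorem IsGaussMarkov.linearOf_seg {t : ℕ} (ht : t ≤ n) :
    LinearOf μ (fun ω => (X 1 ω, seg W 2 t ω)) (seg X 1 t) := by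
  refine LinearOf.seg fun r hr => ?_
  have h0 : LinearOf μ (fun ω => (X 1 ω, seg W 2 t ω)) (fun ω => (X 1 ω, seg W 2 t ω)) :=
    LinearOf.refl
  exact (hM.linearOf_pair hn (Finset.Icc_subset_Icc_right ht hr)).trans
    (h0.fst.prodMk (LinearOf.seg fun u hu =>
      h0.snd.of_seg (Finset.Icc_subset_Icc_right (Finset.mem_Icc.1 hr).2 hu)))

theorem IsGaussMarkov.hasGaussianLaw_seg : HasGaussianLaw (seg X 1 n) μ :=
  (hM.linearOf_seg hn le_rfl).hasGaussianLaw (hM.hasGaussianLaw_pair hn)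

theorem IsGaussMarkov.integral_seg_eq_zero : ∫ ω, seg X 1 n ω ∂μ = 0 :=
  (hM.linearOf_seg hn le_rfl).integral_eq_zero (hM.hasGaussianLaw_pair hn).integrable
    (hM.integral_pair_eq_zero hn)

omit hn in
theorem IsGaussMarkov.innovation_ae_eq {t : ℕ} (ht : t ∈ Finset.Icc 1 (n - 1)) :
    (fun ω => X (t + 1) ω - act (A t) (X t ω)) =ᵐ[μ] fun ω => act (B t) (W (t + 1) ω) := by
  filter_upwards [hM.recursion t ht] with ω hω
  rw [hω, add_sub_cancel_left]

theorem IsGaussMarkov.indepFun_innovation {t : ℕ} (ht : t ∈ Finset.Icc 1 (n - 1)) :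
    IndepFun (fun ω => X (t + 1) ω - act (A t) (X t ω)) (seg X 1 t) μ := by
  have h := Finset.mem_Icc.1 ht
  have h1 := (hM.linearOf_seg hn (t := t) (by omega)).indepFun_right
    (hM.indepFun_W hn (t := t) (Finset.mem_Icc.2 ⟨by omega, by omega⟩))
  exact (h1.comp (measurable_act (B t)) measurable_id).congr (hM.innovation_ae_eq ht).symm
    (Filter.EventuallyEq.refl _ _)

omit hn in
theorem IsGaussMarkov.map_innovation {t : ℕ} (ht : t ∈ Finset.Icc 1 (n - 1)) :
    μ.map (fun ω => X (t + 1) ω - act (A t) (X t ω)) =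
      (multivariateGaussian 0 (QW (t + 1))).map (act (B t)) := by
  have h := Finset.mem_Icc.1 ht
  have hW : t + 1 ∈ Finset.Icc 2 n := Finset.mem_Icc.2 ⟨by omega, by omega⟩
  rw [Measure.map_congr (hM.innovation_ae_eq ht), ← hM.law_W _ hW,
    Measure.map_map (measurable_act _) (hM.measurable_W _ hW)]
  rfl

end Source

/-- Processes read off a path agree with the path. -/
theorem seg_xproc {E : Type*} [Zero E] :
    seg (xproc (n := n) (E := E)) 1 n = Prod.fst := by
  funext z t
  exact dif_pos t.2

theorem seg_yproc {E : Type*} [Zero E] :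
    seg (yproc (n := n) (E := E)) 1 n = Prod.snd := by
  funext z t
  exact dif_pos t.2

theorem measurable_coord {E : Type*} [Zero E] [MeasurableSpace E] (t : ℕ) :
    Measurable (coord t : Path n E → E) := by
  unfold coord
  split_ifs <;> fun_prop

theorem measurable_xproc {E : Type*} [Zero E] [MeasurableSpace E] (t : ℕ) :
    Measurable (xproc t : Path n E × Path n E → E) := (measurable_coord t).comp measurable_fst

theorem measurable_yproc {E : Type*} [Zero E] [MeasurableSpace E] (t : ℕ) :
    Measurable (yproc t : Path n E × Path n E → E) := (measurable_coord t).comp measurable_snd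

/-- The scalar coordinates of a path. -/
def pathCoords (x : Path n (Vec p₁ p₂)) (k : Idx n p₁ p₂) : ℝ := x k.1 k.2

theorem measurable_pathCoords :
    Measurable (pathCoords : Path n (Vec p₁ p₂) → Idx n p₁ p₂ → ℝ) := by
  unfold pathCoords
  fun_prop

theorem memLp_coords (h : HasGaussianLaw (seg X 1 n) μ) (k : Idx n p₁ p₂) :
    MemLp (coords n X k) 2 μ :=
  hasGaussianLaw_eval (h.eval (X := fun (t : Finset.Icc 1 n) ω => X t ω) k.1) k.2

theorem integral_coords (h : HasGaussianLaw (seg X 1 n) μ) (h0 : ∫ ω, seg X 1 n ω ∂μ = 0)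
    (k : Idx n p₁ p₂) : ∫ ω, coords n X k ω ∂μ = 0 := by
  let L : Path n (Vec p₁ p₂) →L[ℝ] ℝ := (EuclideanSpace.proj k.2).comp
    (ContinuousLinearMap.proj (R := ℝ) (φ := fun _ : Finset.Icc 1 n => Vec p₁ p₂) k.1)
  have := ContinuousLinearMap.integral_comp_comm L h.integrable
  rw [h0, map_zero] at this
  exact this

theorem hasGaussianLaw_coords (h : HasGaussianLaw (seg X 1 n) μ) :
    HasGaussianLaw (fun ω k => coords n X k ω) μ :=
  h.map_fun (ContinuousLinearMap.pi fun k : Idx n p₁ p₂ => (EuclideanSpace.proj k.2).comp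
    (ContinuousLinearMap.proj (R := ℝ) (φ := fun _ : Finset.Icc 1 n => Vec p₁ p₂) k.1))

theorem gmi_le_payoff (hn : 1 ≤ n) (hM : IsGaussMarkov μ n A B QX QW X W) {Δ₁ Δ₂ : ℝ≥0}
    {P : ProbabilityMeasure (Path n (Vec p₁ p₂) × Path n (Vec p₁ p₂))}
    (hP : P ∈ admissible (μ.map (seg X 1 n)) Δ₁ Δ₂) :
    ∃ K ∈ momentSet A (secondMoment μ (coords n X)) Δ₁ Δ₂,
      gmi (secondMoment μ (coords n X)) K ≤ payoff n P.toMeasure xproc yproc := by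
  obtain ⟨hPX, hna, hd₁, hd₂⟩ := hP
  set ρ : Measure (Path n (Vec p₁ p₂) × Path n (Vec p₁ p₂)) := P.toMeasure with hρ
  have hXm : Measurable (seg X 1 n) := measurable_seg hM.measurable_X
  have hxm : ∀ t ∈ Finset.Icc 1 n, Measurable
      (xproc t : Path n (Vec p₁ p₂) × Path n (Vec p₁ p₂) → _) := fun t _ => measurable_xproc t
  have hym : ∀ t ∈ Finset.Icc 1 n, Measurable
      (yproc t : Path n (Vec p₁ p₂) × Path n (Vec p₁ p₂) → _) := fun t _ => measurable_yproc t
  have hN : Nonanticipative ρ n xproc yproc := (nonanticipative_iff hxm hym).2 hna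
  have hxG : HasGaussianLaw (seg xproc 1 n) ρ := by
    rw [seg_xproc]
    have : IsGaussian (ρ.map Prod.fst) := hPX ▸ (hM.hasGaussianLaw_seg hn).isGaussian_map
    exact IsGaussian.hasGaussianLaw
  have hx2 := memLp_coords hxG
  have hx0 : ∫ z, seg xproc 1 n z ∂ρ = 0 := by
    rw [seg_xproc, ← hM.integral_seg_eq_zero hn,
      ← integral_map (f := fun x => x) (μ := ρ) measurable_fst.aemeasurable (by fun_prop), hPX,
      integral_map hXm.aemeasurable (by fun_prop)]
  have hx0' := integral_coords hxG hx0
  have hy2 : ∀ k, MemLp (coords n yproc k) 2 ρ := by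
    rintro ⟨t, i | i⟩
    · have := (hx2 (t, Sum.inl i)).sub (memLp_sub_of_distortion hn Sum.inl hxm hym hd₁ t i)
      convert! this using 1
      funext z
      simp [coords]
    · have := (hx2 (t, Sum.inr i)).sub (memLp_sub_of_distortion hn Sum.inr hxm hym hd₂ t i)
      convert! this using 1
      funext z
      simp [coords]
  have hS : secondMoment ρ (coords n xproc) = secondMoment μ (coords n X) := by
    ext a b
    have hm : Measurable fun x : Path n (Vec p₁ p₂) => pathCoords x a * pathCoords x b := by
      have := measurable_pathCoords (n := n) (p₁ := p₁) (p₂ := p₂)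
      fun_prop
    have h1 := integral_map (μ := μ) hXm.aemeasurable hm.aestronglyMeasurable
    have h2 := integral_map (μ := ρ) measurable_fst.aemeasurable hm.aestronglyMeasurable
    rw [hPX, h1, ← seg_xproc] at h2
    exact h2.symm
  have hD : ∀ t ∈ Finset.Icc 1 (n - 1),
      IndepFun (fun z => xproc (t + 1) z - act (A t) (xproc t z)) (seg yproc 1 t) ρ := by
    intro t ht
    have ht' := Finset.mem_Icc.1 ht
    have htn : t ≤ n := by omega
    obtain ⟨κ, hκ, hk⟩ := hN t htn ht
    let d : Path n (Vec p₁ p₂) → Vec p₁ p₂ := fun x => coord (t + 1) x - act (A t) (coord t x)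
    have hdm : Measurable d := by
      have := measurable_coord (n := n) (E := Vec p₁ p₂) t
      have := measurable_coord (n := n) (E := Vec p₁ p₂) (t + 1)
      fun_prop
    have h1 : IndepFun (segInit htn) d (μ.map (seg X 1 n)) := by
      rw [indepFun_map_iff hXm (by fun_prop) hdm]
      have h2 := (hM.indepFun_innovation hn ht).symm
      have h3 : d ∘ seg X 1 n = fun ω => X (t + 1) ω - act (A t) (X t ω) := by
        funext ω
        simp only [d, Function.comp, coord, seg]
        rw [dif_pos (Finset.mem_Icc.2 ⟨by omega, by omega⟩),
          dif_pos (Finset.mem_Icc.2 ⟨by omega, by omega⟩)]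
      rw [h3]
      exact h2
    rw [← hPX, indepFun_map_iff measurable_fst (by fun_prop) hdm] at h1
    have hyt : Measurable (seg (yproc (n := n) (E := Vec p₁ p₂)) 1 t) :=
      measurable_seg fun t _ => measurable_yproc t
    rw [seg_xproc] at hk
    exact indepFun_of_map_eq_compProd (Z := segInit htn ∘ Prod.fst) (D := d ∘ Prod.fst)
      (by fun_prop) (by fun_prop) hyt κ
      (map_comp_eq_compProd ρ measurable_fst hyt hk (ψ := fun x => (segInit htn x, d x))
        (by fun_prop) fun _ => rfl) h1
  have hint : ∀ {p : ℕ} {x y : ℕ → Path n (Vec p₁ p₂) × Path n (Vec p₁ p₂) →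
      EuclideanSpace ℝ (Fin p)} {Δ : ℝ≥0},
      ∫⁻ z, ENNReal.ofReal (distortion n (fun t => x t z) (fun t => y t z)) ∂ρ ≤ Δ →
      ∫ z, distortion n (fun t => x t z) (fun t => y t z) ∂ρ ≤ Δ := fun {p x y Δ} h => by
    by_cases hi : Integrable (fun z => distortion n (fun t => x t z) (fun t => y t z)) ρ
    · rw [← ofReal_integral_eq_lintegral_ofReal hi
        (Filter.Eventually.of_forall fun z => distortion_nonneg _ _)] at h
      have := ENNReal.toReal_mono ENNReal.coe_ne_top h
      rwa [ENNReal.toReal_ofReal (integral_nonneg fun z => distortion_nonneg _ _),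
        ENNReal.coe_toReal] at this
    · rw [integral_undef hi]
      exact Δ.2
  refine ⟨secondMoment ρ (Sum.elim (coords n xproc) (coords n yproc)), ?_, ?_⟩
  · rw [← hS]
    exact secondMoment_mem_momentSet hx2 hy2 hD hx0' (hint hd₁) (hint hd₂)
  · rw [payoff_eq_klDiv hxm hym hN, ← hS]
    have hcm : ∀ (Z : ℕ → Path n (Vec p₁ p₂) × Path n (Vec p₁ p₂) → Vec p₁ p₂),
        (∀ t ∈ Finset.Icc 1 n, Measurable (Z t)) → ∀ k, Measurable (coords n Z k) :=
      fun Z hZ k => by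
        have := hZ k.1 k.1.2
        unfold coords
        fun_prop
    have hxs := measurable_seg hxm
    have hys := measurable_seg hym
    have := Measure.isProbabilityMeasure_map (μ := ρ) hxs.aemeasurable
    have := Measure.isProbabilityMeasure_map (μ := ρ) hys.aemeasurable
    have := Measure.isProbabilityMeasure_map (μ := ρ) (hxs.prodMk hys).aemeasurable
    refine (gmi_le_klDiv (hcm _ hxm) (hcm _ hym) hy2 (hasGaussianLaw_coords hxG) hx0').trans ?_
    have h1 := InformationTheory.klDiv_map_le (ρ.map fun z => (seg xproc 1 n z, seg yproc 1 n z))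
      ((ρ.map (seg xproc 1 n)).prod (ρ.map (seg yproc 1 n)))
      (measurable_pathCoords.prodMap measurable_pathCoords)
    rw [Measure.map_map (measurable_pathCoords.prodMap measurable_pathCoords) (hxs.prodMk hys), ← Measure.map_prod_map _ _
      measurable_pathCoords measurable_pathCoords, Measure.map_map measurable_pathCoords hxs,
      Measure.map_map measurable_pathCoords hys] at h1
    exact h1

/-- A Gaussian second moment matrix which bounds the pay-off from below. -/
theorem exists_gmi_le_payoff (hn : 1 ≤ n) (hM : IsGaussMarkov μ n A B QX QW X W) (Δ₁ Δ₂ : ℝ≥0) :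
    ∃ K ∈ momentSet A (secondMoment μ (coords n X)) Δ₁ Δ₂,
      ∀ P ∈ admissible (μ.map (seg X 1 n)) Δ₁ Δ₂,
        gmi (secondMoment μ (coords n X)) K ≤ payoff n P.toMeasure xproc yproc := by
  have hG := hM.hasGaussianLaw_seg hn
  have h2 := memLp_coords hG
  have hne : (momentSet A (secondMoment μ (coords n X)) Δ₁ Δ₂).Nonempty :=
    ⟨_, secondMoment_mem_momentSet h2 h2 (fun t ht => hM.indepFun_innovation hn ht)
      (integral_coords hG (hM.integral_seg_eq_zero hn)) (by simp [distortion])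
      (by simp [distortion])⟩
  obtain ⟨K, hK, hmin⟩ := LowerSemicontinuousOn.exists_isMinOn hne (isCompact_momentSet hn)
    ((lowerSemicontinuous_gmi (secondMoment μ (coords n X))).lowerSemicontinuousOn _)
  refine ⟨K, hK, fun P hP => ?_⟩
  obtain ⟨K', hK', hle⟩ := gmi_le_payoff hn hM hP
  exact (hmin hK').trans hle

end LowerBound


/-! ### Innovations of a Gaussian coupling -/

theorem act_sub {ι κ : Type*} [Fintype ι] [Fintype κ] (M : Matrix ι κ ℝ)
    (x y : EuclideanSpace ℝ κ) : act M (x - y) = act M x - act M y := (actL M).map_sub x y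

theorem act_zero {ι κ : Type*} [Fintype ι] [Fintype κ] (M : Matrix ι κ ℝ) :
    act M (0 : EuclideanSpace ℝ κ) = 0 := (actL M).map_zero

section Uncorrelated

variable {Ω : Type*} [MeasurableSpace Ω] {μ : Measure Ω} [IsProbabilityMeasure μ]
variable {E E' F : Type*} [NormedAddCommGroup E] [NormedSpace ℝ E] [FiniteDimensional ℝ E]
  [MeasurableSpace E] [BorelSpace E] [NormedAddCommGroup E'] [NormedSpace ℝ E']
  [FiniteDimensional ℝ E'] [MeasurableSpace E'] [BorelSpace E'] [NormedAddCommGroup F]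
  [NormedSpace ℝ F] [FiniteDimensional ℝ F] [MeasurableSpace F] [BorelSpace F]

theorem uncorr_of_indepFun {U : Ω → E} {Y : Ω → F} (hU : Integrable U μ) (hY : Integrable Y μ)
    (hU0 : ∫ ω, U ω ∂μ = 0) (h : IndepFun U Y μ) : Uncorr μ U Y := fun ℓ₁ ℓ₂ => by
  have : CompleteSpace E := FiniteDimensional.complete ℝ E
  have h1 := (h.comp ℓ₁.continuous.measurable ℓ₂.continuous.measurable).integral_fun_mul_eq_mul_integral
    (ℓ₁.integrable_comp hU).aestronglyMeasurable (ℓ₂.integrable_comp hY).aestronglyMeasurable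
  have h2 : ∫ ω, ℓ₁ (U ω) ∂μ = 0 := by
    rw [ContinuousLinearMap.integral_comp_comm ℓ₁ hU, hU0, map_zero]
  refine h1.trans ?_
  simp only [Function.comp]
  rw [h2, zero_mul]

theorem Uncorr.prodMk {U : Ω → E} {U' : Ω → E'} {Y : Ω → F} (hU : HasGaussianLaw U μ)
    (hU' : HasGaussianLaw U' μ) (hY : HasGaussianLaw Y μ) (h : Uncorr μ U Y) (h' : Uncorr μ U' Y) :
    Uncorr μ (fun ω => (U ω, U' ω)) Y := fun ℓ₁ ℓ₂ => by
  have h1 := h (ℓ₁.comp (ContinuousLinearMap.inl ℝ E E')) ℓ₂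
  have h2 := h' (ℓ₁.comp (ContinuousLinearMap.inr ℝ E E')) ℓ₂
  have e1 : Integrable (fun ω => (ℓ₁.comp (ContinuousLinearMap.inl ℝ E E')) (U ω) * ℓ₂ (Y ω)) μ :=
    (hU.map_fun _).memLp_two.integrable_mul (hY.map_fun ℓ₂).memLp_two
  have e2 : Integrable (fun ω => (ℓ₁.comp (ContinuousLinearMap.inr ℝ E E')) (U' ω) * ℓ₂ (Y ω)) μ :=
    (hU'.map_fun _).memLp_two.integrable_mul (hY.map_fun ℓ₂).memLp_two
  have e3 : ∀ ω, ℓ₁ (U ω, U' ω) = (ℓ₁.comp (ContinuousLinearMap.inl ℝ E E')) (U ω) +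
      (ℓ₁.comp (ContinuousLinearMap.inr ℝ E E')) (U' ω) := fun ω => by
    simp [← map_add]
  simp_rw [e3, add_mul]
  rw [integral_add e1 e2, h1, h2, add_zero]

theorem integral_dual_sq {ι : Type*} [Fintype ι] [DecidableEq ι] {U : Ω → EuclideanSpace ℝ ι}
    (hU : ∀ i, MemLp (fun ω => U ω i) 2 μ) (ℓ : EuclideanSpace ℝ ι →L[ℝ] ℝ) :
    ∫ ω, ℓ (U ω) ^ 2 ∂μ = (fun i => ℓ (EuclideanSpace.single i 1)) ⬝ᵥ
      (secondMoment μ fun i ω => U ω i) *ᵥ fun i => ℓ (EuclideanSpace.single i 1) := by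
  have e1 : ∀ z : EuclideanSpace ℝ ι, ℓ z = ∑ i, ℓ (EuclideanSpace.single i 1) * z i := fun z => by
    conv_lhs => rw [← (EuclideanSpace.basisFun ι ℝ).sum_repr z]
    simp [mul_comm]
  rw [← integral_sum_mul_sum hU]
  refine integral_congr_ae (Filter.Eventually.of_forall fun ω => ?_)
  simp only [e1 (U ω)]
  ring

theorem secondMoment_multivariateGaussian {ι : Type*} [Fintype ι] [DecidableEq ι]
    {K : Matrix ι ι ℝ} (hK : K.PosSemidef) :
    (secondMoment (multivariateGaussian 0 K) fun i (x : EuclideanSpace ℝ ι) => x i) = K := by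
  have hG : HasGaussianLaw (fun x : EuclideanSpace ℝ ι => x) (multivariateGaussian 0 K) :=
    IsGaussian.hasGaussianLaw_id
  ext i j
  rw [← covariance_eval_multivariateGaussian (μ := 0) hK i j, covariance_eq_sub
    (hasGaussianLaw_eval hG i) (hasGaussianLaw_eval hG j)]
  have h0 : ∀ i, ∫ x : EuclideanSpace ℝ ι, x i ∂(multivariateGaussian 0 K) = 0 := fun i => by
    have := ContinuousLinearMap.integral_comp_comm (EuclideanSpace.proj (𝕜 := ℝ) i) hG.integrable
    rw [integral_id_multivariateGaussian, map_zero] at this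
    exact this
  simp [secondMoment, h0]

/-- A centred Gaussian vector has law `N(0, K)`, with `K` its matrix of second moments. -/
theorem map_eq_multivariateGaussian {ι : Type*} [Fintype ι] [DecidableEq ι]
    {U : Ω → EuclideanSpace ℝ ι} (hm : Measurable U) (hU : HasGaussianLaw U μ)
    (hU0 : ∫ ω, U ω ∂μ = 0) : (secondMoment μ fun i ω => U ω i).PosSemidef ∧
      μ.map U = multivariateGaussian 0 (secondMoment μ fun i ω => U ω i) := by
  set K := secondMoment μ fun i ω => U ω i with hK
  have h2 := hasGaussianLaw_eval hU
  have hps : K.PosSemidef := by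
    refine PosSemidef.of_dotProduct_mulVec_nonneg ?_ fun v => ?_
    · ext i j
      simp [hK, secondMoment, mul_comm]
    · exact secondMoment_nonneg h2 v
  have := hU.isGaussian_map
  refine ⟨hps, isGaussian_ext ?_ integral_id_multivariateGaussian fun ℓ => ?_⟩
  · rw [integral_map hm.aemeasurable (by fun_prop), hU0]
  rw [integral_map hm.aemeasurable (by fun_prop), integral_dual_sq h2,
    integral_dual_sq (U := fun x => x) (hasGaussianLaw_eval IsGaussian.hasGaussianLaw_id),
    secondMoment_multivariateGaussian hps]

end Uncorrelated

/-- A centred Gaussian coupling of `X^n` and `Y^n` in which `X_{t+1} - A_t X_t` is independent of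
the past `(X^t, Y^t)`. -/
structure GaussCoupling {Ω : Type*} [MeasurableSpace Ω] (ν : Measure Ω) {p₁ p₂ : ℕ} (n : ℕ)
    (A : ℕ → SqMat p₁ p₂) (X Y : ℕ → Ω → Vec p₁ p₂) : Prop where
  measurable_X : ∀ t ∈ Finset.Icc 1 n, Measurable (X t)
  measurable_Y : ∀ t ∈ Finset.Icc 1 n, Measurable (Y t)
  gaussian : HasGaussianLaw (fun ω => (seg X 1 n ω, seg Y 1 n ω)) ν
  integral_eq_zero : ∫ ω, (seg X 1 n ω, seg Y 1 n ω) ∂ν = 0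
  indep : ∀ t ∈ Finset.Icc 1 (n - 1),
    IndepFun (fun ω => X (t + 1) ω - act (A t) (X t ω)) (fun ω => (seg X 1 t ω, seg Y 1 t ω)) ν

/-- The prediction error `X_t - A_{t-1} X̂_{t-1|t-1}`. -/
noncomputable def innov {Ω : Type*} [MeasurableSpace Ω] (ν : Measure Ω) {p₁ p₂ : ℕ}
    (A : ℕ → SqMat p₁ p₂) (X Y : ℕ → Ω → Vec p₁ p₂) (t : ℕ) (ω : Ω) : Vec p₁ p₂ :=
  X t ω - act (A (t - 1)) (prevEst ν X Y t ω)

/-- The update `X̂_{t|t} - A_{t-1} X̂_{t-1|t-1}`. -/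
noncomputable def innovEst {Ω : Type*} [MeasurableSpace Ω] (ν : Measure Ω) {p₁ p₂ : ℕ}
    (A : ℕ → SqMat p₁ p₂) (X Y : ℕ → Ω → Vec p₁ p₂) (t : ℕ) (ω : Ω) : Vec p₁ p₂ :=
  est ν X Y t t ω - act (A (t - 1)) (prevEst ν X Y t ω)

namespace GaussCoupling

variable {Ω : Type*} [MeasurableSpace Ω] {ν : Measure Ω} [IsProbabilityMeasure ν] {p₁ p₂ n : ℕ}
  {A : ℕ → SqMat p₁ p₂} {X Y : ℕ → Ω → Vec p₁ p₂}

variable (h : GaussCoupling ν n A X Y)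
include h

theorem linearOf_X {t : ℕ} (ht : t ∈ Finset.Icc 1 n) :
    LinearOf ν (fun ω => (seg X 1 n ω, seg Y 1 n ω)) (X t) :=
  LinearOf.refl.fst.of_seg ht

theorem linearOf_segY {t : ℕ} (ht : t ≤ n) :
    LinearOf ν (fun ω => (seg X 1 n ω, seg Y 1 n ω)) (seg Y 1 t) :=
  LinearOf.seg fun _ hr => LinearOf.refl.snd.of_seg (Finset.Icc_subset_Icc_right ht hr)

theorem hasGaussianLaw {F : Type*} [NormedAddCommGroup F] [NormedSpace ℝ F] [MeasurableSpace F]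
    [BorelSpace F] {U : Ω → F} (hU : LinearOf ν (fun ω => (seg X 1 n ω, seg Y 1 n ω)) U) :
    HasGaussianLaw U ν := hU.hasGaussianLaw h.gaussian

theorem integral_linearOf {F : Type*} [NormedAddCommGroup F] [NormedSpace ℝ F] [CompleteSpace F]
    [MeasurableSpace F] [BorelSpace F] {U : Ω → F}
    (hU : LinearOf ν (fun ω => (seg X 1 n ω, seg Y 1 n ω)) U) : ∫ ω, U ω ∂ν = 0 :=
  hU.integral_eq_zero h.gaussian.integrable h.integral_eq_zero

theorem measurable_segY {t : ℕ} (ht : t ≤ n) : Measurable (seg Y 1 t) :=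
  measurable_seg_of_le ht h.measurable_Y

theorem exists_est {t : ℕ} (ht : t ∈ Finset.Icc 1 n) : LinearOf ν (seg Y 1 t) (est ν X Y t t) ∧
    IndepFun (fun ω => X t ω - est ν X Y t t ω) (seg Y 1 t) ν := by
  have htn := (Finset.mem_Icc.1 ht).2
  obtain ⟨T, hT, hi⟩ := exists_condExp_eq
    (h.hasGaussianLaw ((h.linearOf_X ht).prodMk (h.linearOf_segY htn)))
    (h.measurable_X t ht) (h.measurable_segY htn) (h.integral_linearOf (h.linearOf_X ht))
    (h.integral_linearOf (h.linearOf_segY htn))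
  refine ⟨⟨T, hT⟩, hi.congr ?_ (Filter.EventuallyEq.refl _ _)⟩
  filter_upwards [hT] with ω hω
  exact congrArg (X t ω - ·) hω.symm

theorem linearOf_est {t : ℕ} (ht : t ∈ Finset.Icc 1 n) :
    LinearOf ν (fun ω => (seg X 1 n ω, seg Y 1 n ω)) (est ν X Y t t) :=
  (h.exists_est ht).1.trans (h.linearOf_segY (Finset.mem_Icc.1 ht).2)

theorem linearOf_prevEst {s : ℕ} (hs : s ≤ n) : LinearOf ν (seg Y 1 s) (prevEst ν X Y (s + 1)) := by
  rw [prevEst_succ]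
  split_ifs with h0
  · exact ⟨0, Filter.EventuallyEq.refl _ _⟩
  · exact (h.exists_est (Finset.mem_Icc.2 ⟨by omega, hs⟩)).1

theorem measurable_innov {s : ℕ} (hs : s + 1 ≤ n) : Measurable (innov ν A X Y (s + 1)) := by
  have h1 := h.measurable_X (s + 1) (Finset.mem_Icc.2 ⟨by omega, hs⟩)
  have h2 : Measurable (prevEst ν X Y (s + 1)) :=
    measurable_prevEst (h.measurable_segY (by omega))
  unfold innov
  fun_prop

theorem measurable_innovEst {s : ℕ} (hs : s + 1 ≤ n) : Measurable (innovEst ν A X Y (s + 1)) := by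
  have h1 : Measurable (est ν X Y (s + 1) (s + 1)) := measurable_est (h.measurable_segY hs)
  have h2 : Measurable (prevEst ν X Y (s + 1)) :=
    measurable_prevEst (h.measurable_segY (by omega))
  unfold innovEst
  fun_prop

theorem linearOf_innov {s : ℕ} (hs : s + 1 ≤ n) :
    LinearOf ν (fun ω => (seg X 1 n ω, seg Y 1 n ω)) (innov ν A X Y (s + 1)) :=
  (h.linearOf_X (Finset.mem_Icc.2 ⟨by omega, hs⟩)).sub
    (((h.linearOf_prevEst (by omega)).trans (h.linearOf_segY (by omega))).map (actL (A s)))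

theorem linearOf_innovEst {s : ℕ} (hs : s + 1 ≤ n) :
    LinearOf ν (fun ω => (seg X 1 n ω, seg Y 1 n ω)) (innovEst ν A X Y (s + 1)) :=
  (h.linearOf_est (Finset.mem_Icc.2 ⟨by omega, hs⟩)).sub
    (((h.linearOf_prevEst (by omega)).trans (h.linearOf_segY (by omega))).map (actL (A s)))

omit h in
theorem innov_sub_innovEst (t : ℕ) (ω : Ω) :
    innov ν A X Y t ω - innovEst ν A X Y t ω = X t ω - est ν X Y t t ω := by
  simp [innov, innovEst]

omit h in
theorem innov_succ_succ (s : ℕ) (ω : Ω) : innov ν A X Y (s + 2) ω =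
    act (A (s + 1)) (X (s + 1) ω - est ν X Y (s + 1) (s + 1) ω) +
      (X (s + 2) ω - act (A (s + 1)) (X (s + 1) ω)) := by
  have h1 : prevEst ν X Y (s + 2) = est ν X Y (s + 1) (s + 1) := by
    rw [prevEst_succ (s + 1), if_neg (Nat.succ_ne_zero s)]
  simp only [innov, h1, act_sub, show s + 2 - 1 = s + 1 from rfl]
  simp

theorem indepFun_error_disturbance {s : ℕ} (hs : s + 2 ≤ n) :
    IndepFun (fun ω => X (s + 1) ω - est ν X Y (s + 1) (s + 1) ω)
      (fun ω => X (s + 2) ω - act (A (s + 1)) (X (s + 1) ω)) ν := by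
  have h1 := h.indep (s + 1) (Finset.mem_Icc.2 ⟨by omega, by omega⟩)
  have hs1 : s + 1 ∈ Finset.Icc 1 n := Finset.mem_Icc.2 ⟨by omega, by omega⟩
  refine IndepFun.symm (LinearOf.indepFun_right ?_ h1)
  have h0 : LinearOf ν (fun ω => (seg X 1 (s + 1) ω, seg Y 1 (s + 1) ω))
    (fun ω => (seg X 1 (s + 1) ω, seg Y 1 (s + 1) ω)) := LinearOf.refl
  exact (h0.fst.of_seg (Finset.mem_Icc.2 ⟨by omega, le_rfl⟩)).sub ((h.exists_est hs1).1.trans h0.snd)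

theorem indepFun_innov_past {s : ℕ} (hs : s + 1 ≤ n) :
    IndepFun (fun ω => (innov ν A X Y (s + 1) ω, innovEst ν A X Y (s + 1) ω)) (seg Y 1 s) ν := by
  rcases s with _ | s
  · rw [seg_one_zero_eq_const Y]
    exact indepFun_const_right _ _
  have hs1 : s + 1 ∈ Finset.Icc 1 n := Finset.mem_Icc.2 ⟨by omega, by omega⟩
  have hs2 : s + 2 ∈ Finset.Icc 1 n := Finset.mem_Icc.2 ⟨by omega, hs⟩
  have hY := h.linearOf_segY (t := s + 1) (by omega)
  have hYG := h.hasGaussianLaw hY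
  have l1 : LinearOf ν (fun ω => (seg X 1 n ω, seg Y 1 n ω))
      (fun ω => X (s + 1) ω - est ν X Y (s + 1) (s + 1) ω) :=
    (h.linearOf_X hs1).sub (h.linearOf_est hs1)
  have l2 : LinearOf ν (fun ω => (seg X 1 n ω, seg Y 1 n ω))
      (fun ω => X (s + 2) ω - act (A (s + 1)) (X (s + 1) ω)) :=
    (h.linearOf_X hs2).sub ((h.linearOf_X hs1).map (actL (A (s + 1))))
  have l3 : LinearOf ν (fun ω => (seg X 1 n ω, seg Y 1 n ω))
      (fun ω => X (s + 2) ω - est ν X Y (s + 2) (s + 2) ω) :=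
    (h.linearOf_X hs2).sub (h.linearOf_est hs2)
  have u1 : Uncorr ν (fun ω => X (s + 1) ω - est ν X Y (s + 1) (s + 1) ω) (seg Y 1 (s + 1)) :=
    uncorr_of_indepFun (h.hasGaussianLaw l1).integrable hYG.integrable (h.integral_linearOf l1)
      (h.exists_est hs1).2
  have u2 : Uncorr ν (fun ω => X (s + 2) ω - act (A (s + 1)) (X (s + 1) ω)) (seg Y 1 (s + 1)) :=
    uncorr_of_indepFun (h.hasGaussianLaw l2).integrable hYG.integrable (h.integral_linearOf l2)
      ((h.indep (s + 1) (Finset.mem_Icc.2 ⟨by omega, by omega⟩)).comp measurable_id measurable_snd)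
  have u3 : Uncorr ν (fun ω => X (s + 2) ω - est ν X Y (s + 2) (s + 2) ω) (seg Y 1 (s + 1)) :=
    uncorr_of_indepFun (h.hasGaussianLaw l3).integrable hYG.integrable (h.integral_linearOf l3)
      ((h.exists_est hs2).2.comp (ψ := segInit (Nat.le_succ (s + 1))) measurable_id (by fun_prop))
  have u := (u1.prodMk (h.hasGaussianLaw l1) (h.hasGaussianLaw l2) hYG u2).prodMk
    (h.hasGaussianLaw (l1.prodMk l2)) (h.hasGaussianLaw l3) hYG u3
  have hi := indepFun_of_uncorr (h.hasGaussianLaw (((l1.prodMk l2).prodMk l3).prodMk hY))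
    (h.integral_linearOf ((l1.prodMk l2).prodMk l3)) u
  have := hi.comp (φ := fun p => (act (A (s + 1)) p.1.1 + p.1.2,
    act (A (s + 1)) p.1.1 + p.1.2 - p.2)) (by fun_prop) measurable_id
  convert! this using 1
  funext ω
  refine Prod.ext (innov_succ_succ s ω) ?_
  simp only [Function.comp]
  rw [← innov_succ_succ, ← innov_sub_innovEst (A := A), sub_sub_cancel]

theorem indepFun_error {s : ℕ} (hs : s + 1 ≤ n) :
    IndepFun (fun ω => innov ν A X Y (s + 1) ω - innovEst ν A X Y (s + 1) ω)
      (innovEst ν A X Y (s + 1)) ν := by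
  simp_rw [innov_sub_innovEst]
  have hs1 : s + 1 ∈ Finset.Icc 1 n := Finset.mem_Icc.2 ⟨by omega, hs⟩
  refine LinearOf.indepFun_right ?_ (h.exists_est hs1).2
  have h0 : LinearOf ν (seg Y 1 (s + 1)) (seg Y 1 (s + 1)) := LinearOf.refl
  exact (h.exists_est hs1).1.sub (((h.linearOf_prevEst (by omega)).trans (LinearOf.seg fun r hr =>
    h0.of_seg (Finset.Icc_subset_Icc_right (Nat.le_succ s) hr))).map (actL (A s)))

theorem exists_gain {s : ℕ} (hs : s + 1 ≤ n) : ∃ H QV : SqMat p₁ p₂, QV.PosSemidef ∧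
    ν.map (fun ω => (innov ν A X Y (s + 1) ω, innovEst ν A X Y (s + 1) ω)) =
      ((ν.map (innov ν A X Y (s + 1))).prod (multivariateGaussian 0 QV)).map
        fun p => (p.1, act H p.1 + p.2) := by
  have l1 := h.linearOf_innov hs
  have l2 := h.linearOf_innovEst hs
  have m1 := h.measurable_innov hs
  have m2 := h.measurable_innovEst hs
  have hi := indepFun_sub_act_pinv (h.hasGaussianLaw (l2.prodMk l1)) (h.integral_linearOf l2)
    (h.integral_linearOf l1)
  set H : SqMat p₁ p₂ := (Matrix.of fun i j => ∫ ω, innovEst ν A X Y (s + 1) ω i *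
    innov ν A X Y (s + 1) ω j ∂ν) * pinv (secondMoment ν fun j ω => innov ν A X Y (s + 1) ω j)
  have l3 := l2.sub (l1.map (actL H))
  have m3 : Measurable fun ω => innovEst ν A X Y (s + 1) ω - act H (innov ν A X Y (s + 1) ω) := by
    fun_prop
  obtain ⟨hps, hlaw⟩ := map_eq_multivariateGaussian m3 (h.hasGaussianLaw l3) (h.integral_linearOf l3)
  refine ⟨H, _, hps, ?_⟩
  rw [← hlaw, ← (indepFun_iff_map_prod_eq_prod_map_map m1.aemeasurable m3.aemeasurable).1 hi.symm,
    Measure.map_map (by fun_prop) (m1.prodMk m3)]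
  congr 1
  funext ω
  simp

theorem map_innov_succ {s : ℕ} (hs : s + 2 ≤ n) : ν.map (innov ν A X Y (s + 2)) =
    ((ν.map fun ω => innov ν A X Y (s + 1) ω - innovEst ν A X Y (s + 1) ω).prod
      (ν.map fun ω => X (s + 2) ω - act (A (s + 1)) (X (s + 1) ω))).map
        fun p => act (A (s + 1)) p.1 + p.2 := by
  have m1 : Measurable fun ω => innov ν A X Y (s + 1) ω - innovEst ν A X Y (s + 1) ω :=
    (h.measurable_innov (by omega)).sub (h.measurable_innovEst (by omega))
  have m2 : Measurable fun ω => X (s + 2) ω - act (A (s + 1)) (X (s + 1) ω) := by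
    have := h.measurable_X (s + 1) (Finset.mem_Icc.2 ⟨by omega, by omega⟩)
    have := h.measurable_X (s + 2) (Finset.mem_Icc.2 ⟨by omega, by omega⟩)
    fun_prop
  have hi := h.indepFun_error_disturbance hs
  simp_rw [← innov_sub_innovEst (A := A)] at hi
  rw [← (indepFun_iff_map_prod_eq_prod_map_map m1.aemeasurable m2.aemeasurable).1 hi,
    Measure.map_map (by fun_prop) (m1.prodMk m2)]
  congr 1
  funext ω
  simp only [Function.comp]
  rw [innov_succ_succ, innov_sub_innovEst]

theorem klDiv_innov_le {s : ℕ} (hs : s + 1 ≤ n) :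
    InformationTheory.klDiv
      (ν.map fun ω => (innov ν A X Y (s + 1) ω, innovEst ν A X Y (s + 1) ω))
      ((ν.map (innov ν A X Y (s + 1))).prod (ν.map (innovEst ν A X Y (s + 1)))) ≤
    condMutualInfo ν (seg X 1 n) (Y (s + 1)) (seg Y 1 s) := by
  have hs1 : s + 1 ∈ Finset.Icc 1 n := Finset.mem_Icc.2 ⟨by omega, hs⟩
  have hYs := h.measurable_segY (t := s) (by omega)
  rw [← condMutualInfo_of_indepFun ν (h.measurable_innov hs) (h.measurable_innovEst hs) hYs
    (h.indepFun_innov_past hs)]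
  obtain ⟨T, hT⟩ := h.linearOf_prevEst (s := s) (by omega)
  obtain ⟨T', hT'⟩ := (h.exists_est hs1).1
  have hTm : Measurable T := T.continuous.measurable
  have hTm' : Measurable T' := T'.continuous.measurable
  refine condMutualInfo_le ν (measurable_seg h.measurable_X) (h.measurable_Y _ hs1) hYs
    (g := fun p => p.2 ⟨s + 1, hs1⟩ - act (A s) (T p.1))
    (h := fun p => T' (segSnoc p) - act (A s) (T p.1)) (by fun_prop) (by fun_prop) ?_ ?_
  · filter_upwards [hT] with ω hω
    simp only [innov, hω]
    rfl
  · filter_upwards [hT, hT'] with ω hω hω'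
    simp only [innovEst, hω, hω', segSnoc_seg]
    rfl

theorem sum_klDiv_innov_le : ∑ t ∈ Finset.Icc 1 n, InformationTheory.klDiv
      (ν.map fun ω => (innov ν A X Y t ω, innovEst ν A X Y t ω))
      ((ν.map (innov ν A X Y t)).prod (ν.map (innovEst ν A X Y t))) ≤
    InformationTheory.klDiv (ν.map fun ω => (seg X 1 n ω, seg Y 1 n ω))
      ((ν.map (seg X 1 n)).prod (ν.map (seg Y 1 n))) := by
  rw [← condMutualInfo_seg_zero ν (Y := Y) (measurable_seg h.measurable_X)
    (measurable_seg h.measurable_Y), ← sum_condMutualInfo_eq ν (measurable_seg h.measurable_X)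
      h.measurable_Y le_rfl]
  refine Finset.sum_le_sum fun t ht => ?_
  obtain ⟨s, rfl⟩ : ∃ s, t = s + 1 := ⟨t - 1, by have := (Finset.mem_Icc.1 ht).1; omega⟩
  exact h.klDiv_innov_le (Finset.mem_Icc.1 ht).2

/-- The conditional mean is at least as good a reproduction as `Y`. -/
theorem integral_sq_error_le {t : ℕ} (ht : t ∈ Finset.Icc 1 n) (i : Fin p₁ ⊕ Fin p₂) :
    ∫ ω, (innov ν A X Y t ω i - innovEst ν A X Y t ω i) ^ 2 ∂ν ≤ ∫ ω, (X t ω i - Y t ω i) ^ 2 ∂ν := by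
  have l1 := (h.linearOf_X ht).sub (h.linearOf_est ht)
  have l2 : LinearOf ν (seg Y 1 t) (fun ω => est ν X Y t t ω - Y t ω) :=
    (h.exists_est ht).1.sub (LinearOf.refl.of_seg (Finset.mem_Icc.2 ⟨(Finset.mem_Icc.1 ht).1, le_rfl⟩))
  have l2' := l2.trans (h.linearOf_segY (Finset.mem_Icc.1 ht).2)
  have hi := (l2.indepFun_right (h.exists_est ht).2).comp (φ := fun x : Vec p₁ p₂ => x i)
    (ψ := fun x : Vec p₁ p₂ => x i) (by fun_prop) (by fun_prop)
  set a : Ω → ℝ := fun ω => (X t ω - est ν X Y t t ω) i with ha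
  set b : Ω → ℝ := fun ω => (est ν X Y t t ω - Y t ω) i with hb
  have ha2 : MemLp a 2 ν := hasGaussianLaw_eval (h.hasGaussianLaw l1) i
  have hb2 : MemLp b 2 ν := hasGaussianLaw_eval (h.hasGaussianLaw l2') i
  have ha0 : ∫ ω, a ω ∂ν = 0 := h.integral_linearOf (l1.map (EuclideanSpace.proj i))
  have hab : ∫ ω, a ω * b ω ∂ν = 0 := by
    have := hi.integral_fun_mul_eq_mul_integral ha2.aestronglyMeasurable hb2.aestronglyMeasurable
    refine this.trans ?_
    have e : ∫ ω, ((fun x : Vec p₁ p₂ => x i) ∘ fun ω => X t ω - est ν X Y t t ω) ω ∂ν = 0 := ha0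
    rw [e, zero_mul]
  have e1 : ∀ ω, innov ν A X Y t ω i - innovEst ν A X Y t ω i = a ω := fun ω => by
    rw [ha, ← PiLp.sub_apply, innov_sub_innovEst]
  have e2 : ∀ ω, (X t ω i - Y t ω i) ^ 2 = a ω ^ 2 + 2 * (a ω * b ω) + b ω ^ 2 := fun ω => by
    simp only [ha, hb, PiLp.sub_apply]
    ring
  simp_rw [e1, e2]
  have i1 : Integrable (fun ω => a ω ^ 2) ν := ha2.integrable_sq
  have i2 : Integrable (fun ω => a ω * b ω) ν := ha2.integrable_mul hb2
  have i3 : Integrable (fun ω => b ω ^ 2) ν := hb2.integrable_sq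
  have i4 : Integrable (fun ω => a ω ^ 2 + 2 * (a ω * b ω)) ν := i1.add (i2.const_mul 2)
  rw [integral_add i4 i3, integral_add i1 (i2.const_mul 2), integral_const_mul, hab]
  have : 0 ≤ ∫ ω, b ω ^ 2 ∂ν := integral_nonneg fun ω => sq_nonneg _
  linarith

end GaussCoupling


/-! ### A realization with prescribed innovation laws -/

/-- `Y_t = H_t X_t + (1 - H_t) A_{t-1} Y_{t-1} + V_t`, started from `Y_0 = 0`. -/
def reproduction {Ω : Type*} {p₁ p₂ : ℕ} (A H : ℕ → SqMat p₁ p₂) (X V : ℕ → Ω → Vec p₁ p₂) :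
    ℕ → Ω → Vec p₁ p₂
  | 0 => fun _ => 0
  | s + 1 => fun ω => act (H (s + 1)) (X (s + 1) ω) +
      act (1 - H (s + 1)) (act (A s) (reproduction A H X V s ω)) + V (s + 1) ω

/-- `J_t` is a possible law of the pair `(X_t - A_{t-1} Y_{t-1}, Y_t - A_{t-1} Y_{t-1})`, where `Y` is
the reproduction with gains `H_t` and noise covariances `QV_t`. -/
structure IsInnovLaw {p₁ p₂ q₁ q₂ : ℕ} (n : ℕ) (A : ℕ → SqMat p₁ p₂)
    (B : ℕ → Matrix (Fin p₁ ⊕ Fin p₂) (Fin q₁ ⊕ Fin q₂) ℝ) (QX : SqMat p₁ p₂)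
    (QW : ℕ → SqMat q₁ q₂) (H QV : ℕ → SqMat p₁ p₂) (J : ℕ → Measure (Vec p₁ p₂ × Vec p₁ p₂)) :
    Prop where
  channel : ∀ s, s + 1 ≤ n → J (s + 1) = (((J (s + 1)).map Prod.fst).prod
    (multivariateGaussian 0 (QV (s + 1)))).map fun p => (p.1, act (H (s + 1)) p.1 + p.2)
  init : (J 1).map Prod.fst = multivariateGaussian 0 QX
  step : ∀ s, s + 2 ≤ n → (J (s + 2)).map Prod.fst =
    (((J (s + 1)).map fun p => p.1 - p.2).prod
      ((multivariateGaussian 0 (QW (s + 2))).map (act (B (s + 1))))).map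
        fun p => act (A (s + 1)) p.1 + p.2
  indep : ∀ s, s + 1 ≤ n → IndepFun (fun p => p.1 - p.2) Prod.snd (J (s + 1))

section Reproduction

variable {Ω : Type*} [MeasurableSpace Ω] {μ : Measure Ω} [IsProbabilityMeasure μ]
  {p₁ p₂ q₁ q₂ n : ℕ} {A : ℕ → SqMat p₁ p₂}
  {B : ℕ → Matrix (Fin p₁ ⊕ Fin p₂) (Fin q₁ ⊕ Fin q₂) ℝ}
  {QX : SqMat p₁ p₂} {QW : ℕ → SqMat q₁ q₂} {H QV : ℕ → SqMat p₁ p₂}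
  {X V : ℕ → Ω → Vec p₁ p₂} {W : ℕ → Ω → Vec q₁ q₂}
  {J : ℕ → Measure (Vec p₁ p₂ × Vec p₁ p₂)}

theorem measurable_reproduction (hX : ∀ t ∈ Finset.Icc 1 n, Measurable (X t))
    (hV : ∀ t ∈ Finset.Icc 1 n, Measurable (V t)) {t : ℕ} (ht : t ≤ n) :
    Measurable (reproduction A H X V t) := by
  induction t with
  | zero => exact measurable_const
  | succ s ih =>
    have h1 := hX (s + 1) (Finset.mem_Icc.2 ⟨by omega, ht⟩)
    have h2 := hV (s + 1) (Finset.mem_Icc.2 ⟨by omega, ht⟩)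
    have h3 := ih (by omega)
    unfold reproduction
    fun_prop

theorem reproduction_sub (s : ℕ) (ω : Ω) :
    reproduction A H X V (s + 1) ω - act (A s) (reproduction A H X V s ω) =
      act (H (s + 1)) (X (s + 1) ω - act (A s) (reproduction A H X V s ω)) + V (s + 1) ω := by
  simp only [reproduction, act_sub, act_sub_matrix, act_one]
  abel

theorem coord_seg_reproduction (s : ℕ) (ω : Ω) :
    coord s (seg (reproduction A H X V) 1 s ω) = reproduction A H X V s ω := by
  rcases s with _ | s
  · simp [coord, reproduction]
  · rw [coord, dif_pos (Finset.mem_Icc.2 ⟨by omega, le_rfl⟩)]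
    rfl

variable (hn : 1 ≤ n) (hM : IsGaussMarkov μ n A B QX QW X W) (hV : IsNoise μ n QV X W V)
include hn hM hV

theorem linearOf_reproduction {t : ℕ} (ht : t ≤ n) :
    LinearOf μ (driver X W V t t) (reproduction A H X V t) := by
  induction t with
  | zero => exact ⟨0, Filter.EventuallyEq.refl _ _⟩
  | succ s ih =>
    have h1 : LinearOf μ (driver X W V (s + 1) (s + 1)) (reproduction A H X V s) := (ih (by omega)).trans
      (linearOf_driver_driver (μ := μ) (X := X) (W := W) (V := V) (Nat.le_succ s) (Nat.le_succ s))
    have hs : s + 1 ∈ Finset.Icc 1 (s + 1) := Finset.mem_Icc.2 ⟨by omega, le_rfl⟩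
    have h2 := (hM.linearOf_driver (V := V) (t := s + 1) hn hs ht).map (actL (H (s + 1)))
    have h3 := (h1.map (actL (A s))).map (actL (1 - H (s + 1)))
    exact (h2.add h3).add (linearOf_driver_V hs)

theorem linearOf_seg_reproduction {t : ℕ} (ht : t ≤ n) :
    LinearOf μ (driver X W V t t) (seg (reproduction A H X V) 1 t) :=
  LinearOf.seg fun _ hr => (linearOf_reproduction hn hM hV ((Finset.mem_Icc.1 hr).2.trans ht)).trans
    (linearOf_driver_driver (Finset.mem_Icc.1 hr).2 (Finset.mem_Icc.1 hr).2)

variable (hJ : IsInnovLaw n A B QX QW H QV J)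
include hJ

/-- The laws of the innovations are the prescribed ones. -/
theorem reproduction_innov {s : ℕ} (hs : s + 1 ≤ n)
    (h1 : μ.map (fun ω => X (s + 1) ω - act (A s) (reproduction A H X V s ω)) =
      (J (s + 1)).map Prod.fst)
    (h2 : IndepFun (fun ω => X (s + 1) ω - act (A s) (reproduction A H X V s ω))
      (seg (reproduction A H X V) 1 s) μ) :
    μ.map (fun ω => (X (s + 1) ω - act (A s) (reproduction A H X V s ω),
      reproduction A H X V (s + 1) ω - act (A s) (reproduction A H X V s ω))) = J (s + 1) ∧
    IndepFun (fun ω => (X (s + 1) ω - act (A s) (reproduction A H X V s ω),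
      reproduction A H X V (s + 1) ω - act (A s) (reproduction A H X V s ω)))
      (seg (reproduction A H X V) 1 s) μ ∧
    IndepFun (fun ω => X (s + 1) ω - reproduction A H X V (s + 1) ω)
      (seg (reproduction A H X V) 1 (s + 1)) μ := by
  set Y := reproduction A H X V with hY
  have hs1 : s + 1 ∈ Finset.Icc 1 n := Finset.mem_Icc.2 ⟨by omega, hs⟩
  have hXm := hM.measurable_X _ hs1
  have hVm := hV.measurable_V _ hs1
  have hYm : ∀ t ≤ n, Measurable (Y t) := fun t ht =>
    measurable_reproduction hM.measurable_X hV.measurable_V ht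
  have hYs := hYm s (by omega)
  have hYs1 := hYm (s + 1) hs
  have hseg : Measurable (seg Y 1 s) :=
    measurable_seg fun t ht => hYm t ((Finset.mem_Icc.1 ht).2.trans (by omega))
  have he : Measurable fun ω => X (s + 1) ω - act (A s) (Y s ω) := by fun_prop
  have hlin : LinearOf μ (driver X W V (s + 1) s)
      (fun ω => (seg Y 1 s ω, X (s + 1) ω - act (A s) (Y s ω))) := by
    have hD := linearOf_driver_driver (μ := μ) (X := X) (W := W) (V := V) (Nat.le_succ s) (le_refl s)
    refine ((linearOf_seg_reproduction hn hM hV (by omega)).trans hD).prodMk (LinearOf.sub ?_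
      (((linearOf_reproduction hn hM hV (by omega)).trans hD).map (actL (A s))))
    exact (hM.linearOf_pair hn hs1).trans (LinearOf.refl.fst)
  have hVi : IndepFun (V (s + 1)) (fun ω => (seg Y 1 s ω, X (s + 1) ω - act (A s) (Y s ω))) μ :=
    (hlin.trans (linearOf_driver_driver hs le_rfl)).indepFun_right (hV.indepFun_V hn hM hs1)
  have hVe := hVi.comp (φ := id) (ψ := Prod.snd) measurable_id measurable_snd
  have hlaw : μ.map (fun ω => (X (s + 1) ω - act (A s) (Y s ω), Y (s + 1) ω - act (A s) (Y s ω))) =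
      J (s + 1) := by
    have e := (indepFun_iff_map_prod_eq_prod_map_map he.aemeasurable hVm.aemeasurable).1 hVe.symm
    rw [h1, hV.law_V _ hs1] at e
    rw [hJ.channel s hs, ← e, Measure.map_map (by fun_prop) (he.prodMk hVm)]
    congr 1
    funext ω
    exact Prod.ext rfl (reproduction_sub s ω)
  have hpast : IndepFun (fun ω => (X (s + 1) ω - act (A s) (Y s ω), Y (s + 1) ω - act (A s) (Y s ω)))
      (seg Y 1 s) μ := by
    have := (indepFun_prodMk_of_indepFun hseg.aemeasurable he.aemeasurable hVm.aemeasurable h2.symm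
      hVi.symm).symm.comp (φ := fun p => (p.1, act (H (s + 1)) p.1 + p.2)) (by fun_prop)
      measurable_id
    convert! this using 1
    funext ω
    exact Prod.ext rfl (reproduction_sub s ω)
  refine ⟨hlaw, hpast, ?_⟩
  have hpm : Measurable fun ω =>
      (X (s + 1) ω - act (A s) (Y s ω), Y (s + 1) ω - act (A s) (Y s ω)) := by fun_prop
  have hi := hJ.indep s hs
  rw [← hlaw, indepFun_map_iff hpm (by fun_prop) (by fun_prop)] at hi
  have h3 : IndepFun (fun ω => ((X (s + 1) ω - act (A s) (Y s ω)) - (Y (s + 1) ω - act (A s) (Y s ω)),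
      Y (s + 1) ω - act (A s) (Y s ω))) (seg Y 1 s) μ :=
    hpast.comp (φ := fun p => (p.1 - p.2, p.2)) (by fun_prop) measurable_id
  have h4 := indepFun_prodMk_of_indepFun (a := fun ω => (X (s + 1) ω - act (A s) (Y s ω)) -
    (Y (s + 1) ω - act (A s) (Y s ω))) (b := fun ω => Y (s + 1) ω - act (A s) (Y s ω))
    (by fun_prop) (by fun_prop) hseg.aemeasurable hi h3
  have h5 := h4.comp (φ := id)
    (ψ := fun p => segSnoc (p.2, p.1 + act (A s) (coord s p.2))) measurable_id
    (by have := measurable_coord (n := s) (E := Vec p₁ p₂) s; fun_prop)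
  refine h5.congr (Filter.Eventually.of_forall fun ω => ?_) (Filter.Eventually.of_forall fun ω => ?_)
  · simp
  · have : coord s (seg Y 1 s ω) = Y s ω := coord_seg_reproduction s ω
    simp only [Function.comp, this, sub_add_cancel, segSnoc_seg]

theorem reproduction_prediction {s : ℕ} (hs : s + 1 ≤ n) :
    μ.map (fun ω => X (s + 1) ω - act (A s) (reproduction A H X V s ω)) =
      (J (s + 1)).map Prod.fst ∧
    IndepFun (fun ω => X (s + 1) ω - act (A s) (reproduction A H X V s ω))
      (seg (reproduction A H X V) 1 s) μ := by
  induction s with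
  | zero =>
    refine ⟨?_, ?_⟩
    · rw [hJ.init, ← hM.law_X]
      congr 1
      funext ω
      simp [reproduction, act_zero]
    · rw [seg_one_zero_eq_const]
      exact indepFun_const_right _ _
  | succ s ih =>
    obtain ⟨ih1, ih2⟩ := ih (by omega)
    obtain ⟨hlaw, -, hi⟩ := reproduction_innov hn hM hV hJ (by omega) ih1 ih2
    set Y := reproduction A H X V with hY
    have hs1 : s + 1 ∈ Finset.Icc 1 n := Finset.mem_Icc.2 ⟨by omega, by omega⟩
    have hs2 : s + 2 ∈ Finset.Icc 1 n := Finset.mem_Icc.2 ⟨by omega, by omega⟩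
    have hw2 : s + 2 ∈ Finset.Icc 2 n := Finset.mem_Icc.2 ⟨by omega, by omega⟩
    have hXm := hM.measurable_X _ hs1
    have hWm := hM.measurable_W _ hw2
    have hYm : ∀ t ≤ n, Measurable (Y t) := fun t ht =>
      measurable_reproduction hM.measurable_X hV.measurable_V ht
    have hYs := hYm s (by omega)
    have hYs1 := hYm (s + 1) (by omega)
    have hseg : Measurable (seg Y 1 (s + 1)) :=
      measurable_seg fun t ht => hYm t ((Finset.mem_Icc.1 ht).2.trans (by omega))
    have hlin : LinearOf μ (driver X W V (s + 1) n)
        (fun ω => (seg Y 1 (s + 1) ω, X (s + 1) ω - Y (s + 1) ω)) := by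
      have hD := linearOf_driver_driver (μ := μ) (X := X) (W := W) (V := V) (le_refl (s + 1))
        (show s + 1 ≤ n by omega)
      refine LinearOf.trans ?_ hD
      exact (linearOf_seg_reproduction hn hM hV (by omega)).prodMk
        ((hM.linearOf_driver hn (Finset.mem_Icc.2 ⟨by omega, le_rfl⟩) (by omega)).sub
          (linearOf_reproduction hn hM hV (by omega)))
    have hWi := hlin.indepFun_right (hV.indepFun_W hn hM hw2)
    have hrec : (fun ω => X (s + 2) ω - act (A (s + 1)) (Y (s + 1) ω)) =ᵐ[μ] fun ω =>
        act (A (s + 1)) (X (s + 1) ω - Y (s + 1) ω) + act (B (s + 1)) (W (s + 2) ω) := by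
      filter_upwards [hM.recursion (s + 1) (Finset.mem_Icc.2 ⟨by omega, by omega⟩)] with ω hω
      rw [hω, act_sub]
      abel
    refine ⟨?_, ?_⟩
    · have hWe := hWi.comp (φ := act (B (s + 1))) (ψ := Prod.snd) (by fun_prop) measurable_snd
      have hm1 : Measurable fun ω => X (s + 1) ω - Y (s + 1) ω := by fun_prop
      have hm2 : Measurable fun ω => act (B (s + 1)) (W (s + 2) ω) := by fun_prop
      have e := (indepFun_iff_map_prod_eq_prod_map_map hm1.aemeasurable hm2.aemeasurable).1 hWe.symm
      have e1 : μ.map (fun ω => act (B (s + 1)) (W (s + 2) ω)) =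
          (multivariateGaussian 0 (QW (s + 2))).map (act (B (s + 1))) := by
        rw [← hM.law_W _ hw2, Measure.map_map (by fun_prop) hWm]
        rfl
      have e2 : μ.map (fun ω => X (s + 1) ω - Y (s + 1) ω) =
          (J (s + 1)).map fun p => p.1 - p.2 := by
        rw [← hlaw, Measure.map_map (by fun_prop) (by fun_prop)]
        congr 1
        funext ω
        simp
      rw [e1, e2] at e
      rw [hJ.step s hs, ← e, Measure.map_map (by fun_prop) (hm1.prodMk hm2), Measure.map_congr hrec]
      rfl
    · have h1 := indepFun_prodMk_of_indepFun hseg.aemeasurable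
        (b := fun ω => X (s + 1) ω - Y (s + 1) ω) (by fun_prop) hWm.aemeasurable hi.symm hWi.symm
      have h2 := h1.symm.comp (φ := fun p => act (A (s + 1)) p.1 + act (B (s + 1)) p.2)
        (by fun_prop) measurable_id
      exact h2.congr hrec.symm (Filter.EventuallyEq.refl _ _)

end Reproduction


theorem reproduction_congr {Ω Ω' : Type*} {p₁ p₂ : ℕ} (A H : ℕ → SqMat p₁ p₂)
    {X V : ℕ → Ω → Vec p₁ p₂} {X' V' : ℕ → Ω' → Vec p₁ p₂} {ω : Ω} {ω' : Ω'} {t : ℕ}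
    (hX : ∀ r ∈ Finset.Icc 1 t, X r ω = X' r ω') (hV : ∀ r ∈ Finset.Icc 1 t, V r ω = V' r ω') :
    reproduction A H X V t ω = reproduction A H X' V' t ω' := by
  induction t with
  | zero => rfl
  | succ s ih =>
    have hs : s + 1 ∈ Finset.Icc 1 (s + 1) := Finset.mem_Icc.2 ⟨by omega, le_rfl⟩
    have hle := Finset.Icc_subset_Icc_right (a := 1) (Nat.le_succ s)
    simp only [reproduction, hX _ hs, hV _ hs,
      ih (fun r hr => hX r (hle hr)) (fun r hr => hV r (hle hr))]

section Reproduction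

variable {Ω : Type*} [MeasurableSpace Ω] {μ : Measure Ω} [IsProbabilityMeasure μ]
  {p₁ p₂ q₁ q₂ n : ℕ} {A : ℕ → SqMat p₁ p₂}
  {B : ℕ → Matrix (Fin p₁ ⊕ Fin p₂) (Fin q₁ ⊕ Fin q₂) ℝ}
  {QX : SqMat p₁ p₂} {QW : ℕ → SqMat q₁ q₂} {H QV : ℕ → SqMat p₁ p₂}
  {X V : ℕ → Ω → Vec p₁ p₂} {W : ℕ → Ω → Vec q₁ q₂}
  {J : ℕ → Measure (Vec p₁ p₂ × Vec p₁ p₂)}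

variable (hn : 1 ≤ n) (hM : IsGaussMarkov μ n A B QX QW X W) (hV : IsNoise μ n QV X W V)
include hn hM hV

theorem nonanticipative_reproduction : Nonanticipative μ n X (reproduction A H X V) := by
  intro t ht _
  let Φ : Path t (Vec p₁ p₂) × Path t (Vec p₁ p₂) → Path t (Vec p₁ p₂) :=
    seg (reproduction A H xproc yproc) 1 t
  have hΦ : Measurable Φ := measurable_seg fun r hr =>
    measurable_reproduction (n := t) (fun s _ => measurable_xproc s) (fun s _ => measurable_yproc s)
      (Finset.mem_Icc.1 hr).2
  have hXn : Measurable (seg X 1 n) := measurable_seg hM.measurable_X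
  have hVt : Measurable (seg V 1 t) := measurable_seg_of_le ht hV.measurable_V
  have := Measure.isProbabilityMeasure_map (μ := μ) hVt.aemeasurable
  have hi : IndepFun (seg X 1 n) (seg V 1 t) μ :=
    ((LinearOf.seg fun r hr => (hM.linearOf_pair hn hr).trans (LinearOf.prodMk LinearOf.refl.fst
      (LinearOf.seg fun u hu => LinearOf.refl.snd.of_seg
        (Finset.Icc_subset_Icc_right (Finset.mem_Icc.1 hr).2 hu)))).indepFun_right
          hV.indep_V_XW).symm.comp (ψ := segInit ht) measurable_id (by fun_prop)
  have hY : ∀ ω, seg (reproduction A H X V) 1 t ω =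
      Φ (segInit ht (seg X 1 n ω), seg V 1 t ω) := fun ω => by
    funext r
    refine reproduction_congr A H (fun u hu => ?_) fun u hu => ?_ <;>
    · have hu' := Finset.Icc_subset_Icc_right (Finset.mem_Icc.1 r.2).2 hu
      simp only [xproc, yproc, coord, dif_pos hu']
      rfl
  have h1 := map_prod_of_indepFun hXn hVt hi (φ := fun p => Φ (segInit ht p.1, p.2)) (by fun_prop)
  refine ⟨(Kernel.id ×ₖ Kernel.const _ (μ.map (seg V 1 t))).map Φ, Kernel.IsMarkovKernel.map _ hΦ, ?_⟩
  simp_rw [hY]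
  rw [h1]
  congr 1
  refine Kernel.ext fun x => ?_
  rw [Kernel.comap_apply, id_prod_const_map_apply _ hΦ, id_prod_const_map_apply _ (by fun_prop)]

variable (hJ : IsInnovLaw n A B QX QW H QV J)
include hJ

theorem predict_reproduction {s : ℕ} (hs : s + 1 ≤ n) :
    est μ X (reproduction A H X V) (s + 1) s =ᵐ[μ]
      fun ω => act (A s) (reproduction A H X V s ω) := by
  have hs1 : s + 1 ∈ Finset.Icc 1 n := Finset.mem_Icc.2 ⟨by omega, hs⟩
  have hp := reproduction_prediction hn hM hV hJ hs
  have hYm : ∀ t ≤ n, Measurable (reproduction A H X V t) := fun t ht =>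
    measurable_reproduction hM.measurable_X hV.measurable_V ht
  have hX : LinearOf μ (driver X W V n n) (X (s + 1)) := hM.linearOf_driver hn hs1 le_rfl
  have hY : LinearOf μ (driver X W V n n) (fun ω => act (A s) (reproduction A H X V s ω)) :=
    ((linearOf_reproduction hn hM hV (by omega)).trans
      (linearOf_driver_driver (by omega) (by omega))).map (actL (A s))
  have hc := measurable_coord (n := s) (E := Vec p₁ p₂) s
  have := condExp_eq_of_indepFun_sub (Y := seg (reproduction A H X V) 1 s)
    (T := fun v => act (A s) (coord s v))
    (hV.hasGaussianLaw_of_linearOf hn hM hX).integrable (hM.measurable_X _ hs1)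
    (measurable_seg fun t ht' => hYm t ((Finset.mem_Icc.1 ht').2.trans (by omega))) (by fun_prop)
    (by simp_rw [coord_seg_reproduction]
        exact (hV.hasGaussianLaw_of_linearOf hn hM hY).integrable)
    (by simp_rw [coord_seg_reproduction]
        exact hp.2)
    (by simp_rw [coord_seg_reproduction]
        exact hV.integral_eq_zero_of_linearOf hn hM (hX.sub hY))
  simp_rw [coord_seg_reproduction] at this
  exact this

theorem isRealization_reproduction : IsRealization μ n H QV X W V (reproduction A H X V) where
  measurable_V := hV.measurable_V
  measurable_Y t ht :=
    measurable_reproduction hM.measurable_X hV.measurable_V (Finset.mem_Icc.1 ht).2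
  posSemidef_QV := hV.posSemidef_QV
  law_V := hV.law_V
  indep_V := hV.indep_V
  indep_V_XW := hV.indep_V_XW
  realization t ht := by
    obtain ⟨h1, h2⟩ := Finset.mem_Icc.1 ht
    obtain ⟨s, rfl⟩ : ∃ s, t = s + 1 := ⟨t - 1, by omega⟩
    filter_upwards [predict_reproduction hn hM hV hJ h2] with ω hω
    simp only [feedback, Nat.add_sub_cancel, hω, reproduction, act_sub_matrix, act_one]

theorem payoff_reproduction_le : payoff n μ X (reproduction A H X V) ≤
    ∑ t ∈ Finset.Icc 1 n,
      InformationTheory.klDiv (J t) (((J t).map Prod.fst).prod ((J t).map Prod.snd)) := by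
  refine Finset.sum_le_sum fun t ht => ?_
  obtain ⟨h1, hs⟩ := Finset.mem_Icc.1 ht
  obtain ⟨s, rfl⟩ : ∃ s, t = s + 1 := ⟨t - 1, by omega⟩
  have hYm : ∀ t ≤ n, Measurable (reproduction A H X V t) := fun t ht =>
    measurable_reproduction hM.measurable_X hV.measurable_V ht
  have hp := reproduction_prediction hn hM hV hJ hs
  obtain ⟨hlaw, hpast, -⟩ := reproduction_innov hn hM hV hJ hs hp.1 hp.2
  have hXm := hM.measurable_X _ ht
  have hYs := hYm s (by omega)
  have hYs1 := hYm (s + 1) hs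
  have he : Measurable fun ω => X (s + 1) ω - act (A s) (reproduction A H X V s ω) := by fun_prop
  have he' : Measurable fun ω =>
    reproduction A H X V (s + 1) ω - act (A s) (reproduction A H X V s ω) := by fun_prop
  have hseg : Measurable (seg (reproduction A H X V) 1 s) :=
    measurable_seg fun t ht' => hYm t ((Finset.mem_Icc.1 ht').2.trans (by omega))
  have hc := measurable_coord (n := s) (E := Vec p₁ p₂) s
  have e1 := congrArg (Measure.map Prod.fst) hlaw
  have e2 := congrArg (Measure.map Prod.snd) hlaw
  rw [Measure.map_map measurable_fst (he.prodMk he')] at e1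
  rw [Measure.map_map measurable_snd (he.prodMk he')] at e2
  rw [Nat.add_sub_cancel, (isRealization_reproduction hn hM hV hJ).condMutualInfo_seg_eq hn hM hs,
    ← e1, ← e2, ← hlaw]
  refine le_of_le_of_eq ?_ (condMutualInfo_of_indepFun μ he he' hseg hpast)
  refine condMutualInfo_le μ he he' hseg (g := fun p => p.2 + act (A s) (coord s p.1))
    (h := fun p => p.2 + act (A s) (coord s p.1)) (by fun_prop) (by fun_prop) ?_ ?_ <;>
  · refine Filter.Eventually.of_forall fun ω => ?_
    simp only [coord_seg_reproduction, sub_add_cancel]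

theorem integral_sq_reproduction {t : ℕ} (ht : t ∈ Finset.Icc 1 n) (i : Fin p₁ ⊕ Fin p₂) :
    ∫ ω, (X t ω i - reproduction A H X V t ω i) ^ 2 ∂μ = ∫ p, (p.1 i - p.2 i) ^ 2 ∂(J t) := by
  obtain ⟨h1, hs⟩ := Finset.mem_Icc.1 ht
  obtain ⟨s, rfl⟩ : ∃ s, t = s + 1 := ⟨t - 1, by omega⟩
  have hXm := hM.measurable_X _ ht
  have hYm : ∀ t ≤ n, Measurable (reproduction A H X V t) := fun t ht =>
    measurable_reproduction hM.measurable_X hV.measurable_V ht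
  have hYs := hYm s (by omega)
  have hYs1 := hYm (s + 1) hs
  have hp := reproduction_prediction hn hM hV hJ hs
  rw [← (reproduction_innov hn hM hV hJ hs hp.1 hp.2).1, integral_map (by fun_prop)
    (by fun_prop : Measurable fun p : Vec p₁ p₂ × Vec p₁ p₂ => (p.1 i - p.2 i) ^ 2).aestronglyMeasurable]
  simp

end Reproduction


/-! ### The canonical source -/

/-- The coordinate at time `t` of a segment (`0` outside of it). -/
def segCoord {E : Type*} [Zero E] {a b : ℕ} (t : ℕ) (x : Finset.Icc a b → E) : E :=
  if h : t ∈ Finset.Icc a b then x ⟨t, h⟩ else 0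

theorem measurable_segCoord {E : Type*} [Zero E] [MeasurableSpace E] {a b : ℕ} (t : ℕ) :
    Measurable (segCoord t : (Finset.Icc a b → E) → E) := by
  unfold segCoord
  split_ifs <;> fun_prop

theorem seg_segCoord {E Ω : Type*} [Zero E] {a b : ℕ} (x : Ω → Finset.Icc a b → E) :
    seg (fun t ω => segCoord t (x ω)) a b = x := by
  funext ω r
  exact dif_pos r.2

/-- The solution of `X_{t+1} = A_t X_t + B_t W_{t+1}` started from `X_1`. -/
def stateProc {Ω : Type*} {p₁ p₂ q₁ q₂ : ℕ} (A : ℕ → SqMat p₁ p₂)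
    (B : ℕ → Matrix (Fin p₁ ⊕ Fin p₂) (Fin q₁ ⊕ Fin q₂) ℝ) (X₁ : Ω → Vec p₁ p₂)
    (W : ℕ → Ω → Vec q₁ q₂) : ℕ → Ω → Vec p₁ p₂
  | 0 => fun _ => 0
  | 1 => X₁
  | t + 2 => fun ω => act (A (t + 1)) (stateProc A B X₁ W (t + 1) ω) +
      act (B (t + 1)) (W (t + 2) ω)

section Canonical

variable {p₁ p₂ q₁ q₂ n : ℕ} {A : ℕ → SqMat p₁ p₂}
  {B : ℕ → Matrix (Fin p₁ ⊕ Fin p₂) (Fin q₁ ⊕ Fin q₂) ℝ}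
  {QX : SqMat p₁ p₂} {QW : ℕ → SqMat q₁ q₂} {QV : ℕ → SqMat p₁ p₂}

theorem measurable_stateProc {Ω : Type*} [MeasurableSpace Ω] {X₁ : Ω → Vec p₁ p₂}
    {W : ℕ → Ω → Vec q₁ q₂} (hX : Measurable X₁) (hW : ∀ t ∈ Finset.Icc 2 n, Measurable (W t))
    {t : ℕ} (ht : t ∈ Finset.Icc 1 n) : Measurable (stateProc A B X₁ W t) := by
  obtain ⟨h1, h2⟩ := Finset.mem_Icc.1 ht
  clear ht
  induction t, h1 using Nat.le_induction with
  | base => exact hX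
  | succ t ht ih =>
    obtain ⟨s, rfl⟩ : ∃ s, t = s + 1 := ⟨t - 1, by omega⟩
    have h3 := ih (by omega)
    have h4 := hW (s + 2) (Finset.mem_Icc.2 ⟨by omega, h2⟩)
    simp only [stateProc]
    fun_prop

/-- The trajectory of the source as a function of the initial state and the disturbances. -/
def statePath (n : ℕ) (A : ℕ → SqMat p₁ p₂) (B : ℕ → Matrix (Fin p₁ ⊕ Fin p₂) (Fin q₁ ⊕ Fin q₂) ℝ) :
    Vec p₁ p₂ × (Finset.Icc 2 n → Vec q₁ q₂) → Path n (Vec p₁ p₂) :=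
  seg (stateProc A B Prod.fst fun t x => segCoord t x.2) 1 n

theorem measurable_statePath : Measurable (statePath n A B) := by
  refine measurable_seg fun t ht => measurable_stateProc (n := n) measurable_fst (fun r _ => ?_) ht
  exact (measurable_segCoord r).comp measurable_snd

section Law

variable {Ω : Type*} [MeasurableSpace Ω] {μ : Measure Ω} [IsProbabilityMeasure μ]
  {X : ℕ → Ω → Vec p₁ p₂} {W : ℕ → Ω → Vec q₁ q₂}
  (hn : 1 ≤ n) (hM : IsGaussMarkov μ n A B QX QW X W)
include hn hM

theorem IsGaussMarkov.map_pair : μ.map (fun ω => (X 1 ω, seg W 2 n ω)) =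
    (multivariateGaussian 0 QX).prod
      (Measure.pi fun s : Finset.Icc 2 n => multivariateGaussian 0 (QW s)) := by
  have hX1 := hM.measurable_X 1 (Finset.mem_Icc.2 ⟨le_rfl, hn⟩)
  have hW : Measurable (seg W 2 n) := measurable_seg hM.measurable_W
  have h := (iIndepFun_iff_map_fun_eq_pi_map fun s : Finset.Icc 2 n =>
    (hM.measurable_W s s.2).aemeasurable).1 hM.indep_W
  simp_rw [fun s : Finset.Icc 2 n => hM.law_W s s.2] at h
  rw [(indepFun_iff_map_prod_eq_prod_map_map hX1.aemeasurable hW.aemeasurable).1 hM.indep_X_W,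
    hM.law_X]
  congr 1

theorem IsGaussMarkov.ae_eq_stateProc {t : ℕ} (ht : t ∈ Finset.Icc 1 n) :
    ∀ᵐ ω ∂μ, X t ω =
      stateProc A B Prod.fst (fun t x => segCoord t x.2) t (X 1 ω, seg W 2 n ω) := by
  obtain ⟨h1, h2⟩ := Finset.mem_Icc.1 ht
  clear ht
  induction t, h1 using Nat.le_induction with
  | base => exact Filter.Eventually.of_forall fun ω => rfl
  | succ t ht ih =>
    obtain ⟨s, rfl⟩ : ∃ s, t = s + 1 := ⟨t - 1, by omega⟩
    filter_upwards [ih (by omega), hM.recursion (s + 1) (Finset.mem_Icc.2 ⟨by omega, by omega⟩)]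
      with ω h3 h4
    have h5 : segCoord (s + 2) (seg W 2 n ω) = W (s + 2) ω :=
      dif_pos (Finset.mem_Icc.2 ⟨by omega, h2⟩)
    simp only [stateProc, h4, ← h3, h5]

/-- The law of the source is determined by its parameters. -/
theorem IsGaussMarkov.map_seg : μ.map (seg X 1 n) = ((multivariateGaussian 0 QX).prod
    (Measure.pi fun s : Finset.Icc 2 n => multivariateGaussian 0 (QW s))).map (statePath n A B) := by
  have hX1 := hM.measurable_X 1 (Finset.mem_Icc.2 ⟨le_rfl, hn⟩)
  have hW : Measurable (seg W 2 n) := measurable_seg hM.measurable_W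
  rw [← hM.map_pair hn, Measure.map_map measurable_statePath (hX1.prodMk hW)]
  refine Measure.map_congr ?_
  have : ∀ᵐ ω ∂μ, ∀ t : Finset.Icc 1 n, X t ω =
      stateProc A B Prod.fst (fun t x => segCoord t x.2) t (X 1 ω, seg W 2 n ω) :=
    ae_all_iff.2 fun t => hM.ae_eq_stateProc hn t.2
  filter_upwards [this] with ω hω
  funext t
  exact hω t

end Law

/-- The space of initial states, disturbances and reproduction noises. -/
abbrev BaseSpace (n p₁ p₂ q₁ q₂ : ℕ) : Type :=
  (Vec p₁ p₂ × (Finset.Icc 2 n → Vec q₁ q₂)) × (Finset.Icc 1 n → Vec p₁ p₂)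

/-- Independent Gaussian initial state, disturbances and reproduction noises. -/
noncomputable def baseMeasure (n : ℕ) (QX : SqMat p₁ p₂) (QW : ℕ → SqMat q₁ q₂)
    (QV : ℕ → SqMat p₁ p₂) : Measure (BaseSpace n p₁ p₂ q₁ q₂) :=
  ((multivariateGaussian 0 QX).prod
    (Measure.pi fun s : Finset.Icc 2 n => multivariateGaussian 0 (QW s))).prod
    (Measure.pi fun s : Finset.Icc 1 n => multivariateGaussian 0 (QV s))

instance : IsProbabilityMeasure (baseMeasure n QX QW QV) := by
  unfold baseMeasure
  infer_instance

/-- The source on the canonical space. -/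
def baseX (A : ℕ → SqMat p₁ p₂) (B : ℕ → Matrix (Fin p₁ ⊕ Fin p₂) (Fin q₁ ⊕ Fin q₂) ℝ) (t : ℕ)
    (ω : BaseSpace n p₁ p₂ q₁ q₂) : Vec p₁ p₂ :=
  stateProc A B (fun ω : BaseSpace n p₁ p₂ q₁ q₂ => ω.1.1) (fun t ω => segCoord t ω.1.2) t ω

/-- The disturbance on the canonical space. -/
def baseW (t : ℕ) (ω : BaseSpace n p₁ p₂ q₁ q₂) : Vec q₁ q₂ := segCoord t ω.1.2

/-- The reproduction noise on the canonical space. -/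
def baseV (t : ℕ) (ω : BaseSpace n p₁ p₂ q₁ q₂) : Vec p₁ p₂ := segCoord t ω.2

theorem measurable_baseW (t : ℕ) :
    Measurable (baseW t : BaseSpace n p₁ p₂ q₁ q₂ → Vec q₁ q₂) := by
  have := measurable_segCoord (E := Vec q₁ q₂) (a := 2) (b := n) t
  unfold baseW
  fun_prop

theorem measurable_baseV (t : ℕ) :
    Measurable (baseV t : BaseSpace n p₁ p₂ q₁ q₂ → Vec p₁ p₂) := by
  have := measurable_segCoord (E := Vec p₁ p₂) (a := 1) (b := n) t
  unfold baseV
  fun_prop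

theorem map_fst_baseMeasure : (baseMeasure n QX QW QV).map Prod.fst =
    (multivariateGaussian 0 QX).prod
      (Measure.pi fun s : Finset.Icc 2 n => multivariateGaussian 0 (QW s)) := by
  rw [baseMeasure, Measure.map_fst_prod, measure_univ, one_smul]

theorem map_fst_fst_baseMeasure :
    (baseMeasure n QX QW QV).map (fun ω => ω.1.1) = multivariateGaussian 0 QX := by
  rw [show (fun ω : BaseSpace n p₁ p₂ q₁ q₂ => ω.1.1) = Prod.fst ∘ Prod.fst from rfl,
    ← Measure.map_map measurable_fst measurable_fst, map_fst_baseMeasure, Measure.map_fst_prod,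
    measure_univ, one_smul]

theorem map_fst_snd_baseMeasure : (baseMeasure n QX QW QV).map (fun ω => ω.1.2) =
    Measure.pi fun s : Finset.Icc 2 n => multivariateGaussian 0 (QW s) := by
  rw [show (fun ω : BaseSpace n p₁ p₂ q₁ q₂ => ω.1.2) = Prod.snd ∘ Prod.fst from rfl,
    ← Measure.map_map measurable_snd measurable_fst, map_fst_baseMeasure, Measure.map_snd_prod,
    measure_univ, one_smul]

theorem map_snd_baseMeasure : (baseMeasure n QX QW QV).map Prod.snd =
    Measure.pi fun s : Finset.Icc 1 n => multivariateGaussian 0 (QV s) := by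
  rw [baseMeasure, Measure.map_snd_prod, measure_univ, one_smul]

theorem map_baseW {t : ℕ} (ht : t ∈ Finset.Icc 2 n) :
    (baseMeasure n QX QW QV).map (baseW t) = multivariateGaussian 0 (QW t) := by
  have h := (measurePreserving_eval
    (fun s : Finset.Icc 2 n => multivariateGaussian 0 (QW s)) ⟨t, ht⟩).map_eq
  rw [← map_fst_snd_baseMeasure (QX := QX) (QV := QV),
    Measure.map_map (by fun_prop) (by fun_prop)] at h
  rw [← h]
  congr 1
  funext ω
  exact dif_pos ht

theorem map_baseV {t : ℕ} (ht : t ∈ Finset.Icc 1 n) :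
    (baseMeasure n QX QW QV).map (baseV t) = multivariateGaussian 0 (QV t) := by
  have h := (measurePreserving_eval
    (fun s : Finset.Icc 1 n => multivariateGaussian 0 (QV s)) ⟨t, ht⟩).map_eq
  rw [← map_snd_baseMeasure (QX := QX) (QW := QW),
    Measure.map_map (by fun_prop) (by fun_prop)] at h
  rw [← h]
  congr 1
  funext ω
  exact dif_pos ht

theorem isGaussMarkov_base (hQX : QX.PosSemidef) (hQW : ∀ t ∈ Finset.Icc 2 n, (QW t).PosSemidef) :
    IsGaussMarkov (baseMeasure n QX QW QV) n A B QX QW (baseX A B) baseW where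
  measurable_X t ht := measurable_stateProc (n := n) (by fun_prop)
    (fun r _ => measurable_baseW (n := n) r) ht
  measurable_W t _ := measurable_baseW t
  posSemidef_QX := hQX
  posSemidef_QW := hQW
  law_X := map_fst_fst_baseMeasure
  law_W t ht := map_baseW ht
  indep_W := by
    rw [iIndepFun_iff_map_fun_eq_pi_map fun s => (measurable_baseW _).aemeasurable]
    simp_rw [fun s : Finset.Icc 2 n => map_baseW (QX := QX) (QW := QW) (QV := QV) s.2]
    rw [← map_fst_snd_baseMeasure (QX := QX) (QV := QV)]
    exact congrArg (fun f => Measure.map f (baseMeasure n QX QW QV))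
      (seg_segCoord fun ω : BaseSpace n p₁ p₂ q₁ q₂ => ω.1.2)
  indep_X_W := by
    have e : seg (baseW (n := n) (p₁ := p₁) (p₂ := p₂) (q₁ := q₁) (q₂ := q₂)) 2 n =
      fun ω => ω.1.2 := seg_segCoord fun ω : BaseSpace n p₁ p₂ q₁ q₂ => ω.1.2
    have e1 : baseX (n := n) A B 1 = fun ω => ω.1.1 := rfl
    rw [e, e1, indepFun_iff_map_prod_eq_prod_map_map (by fun_prop) (by fun_prop),
      map_fst_fst_baseMeasure, map_fst_snd_baseMeasure]
    exact map_fst_baseMeasure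
  recursion t ht := by
    obtain ⟨s, rfl⟩ : ∃ s, t = s + 1 := ⟨t - 1, by have := (Finset.mem_Icc.1 ht).1; omega⟩
    exact Filter.Eventually.of_forall fun ω => rfl

theorem isNoise_base (hQV : ∀ t ∈ Finset.Icc 1 n, (QV t).PosSemidef) :
    IsNoise (baseMeasure n QX QW QV) n QV (baseX A B) baseW baseV where
  measurable_V t _ := measurable_baseV t
  posSemidef_QV := hQV
  law_V t ht := map_baseV ht
  indep_V := by
    rw [iIndepFun_iff_map_fun_eq_pi_map fun s => (measurable_baseV _).aemeasurable]
    simp_rw [fun s : Finset.Icc 1 n => map_baseV (QX := QX) (QW := QW) (QV := QV) s.2]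
    rw [← map_snd_baseMeasure (QX := QX) (QW := QW)]
    exact congrArg (fun f => Measure.map f (baseMeasure n QX QW QV))
      (seg_segCoord fun ω : BaseSpace n p₁ p₂ q₁ q₂ => ω.2)
  indep_V_XW := by
    have e : seg (baseW (n := n) (p₁ := p₁) (p₂ := p₂) (q₁ := q₁) (q₂ := q₂)) 2 n =
      fun ω => ω.1.2 := seg_segCoord fun ω : BaseSpace n p₁ p₂ q₁ q₂ => ω.1.2
    have e1 : baseX (n := n) A B 1 = fun ω => ω.1.1 := rfl
    have e2 : seg (baseV (n := n) (p₁ := p₁) (p₂ := p₂) (q₁ := q₁) (q₂ := q₂)) 1 n =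
      Prod.snd := seg_segCoord fun ω : BaseSpace n p₁ p₂ q₁ q₂ => ω.2
    rw [e, e1, e2]
    refine IndepFun.symm ((indepFun_iff_map_prod_eq_prod_map_map (f := Prod.fst) (g := Prod.snd)
      (by fun_prop) (by fun_prop)).2 ?_)
    rw [map_fst_baseMeasure, map_snd_baseMeasure]
    exact Measure.map_id

end Canonical


/-! ### The Gaussian coupling with given second moments -/

theorem exists_coeff_dual {ι κ : Type*} [Fintype ι] [DecidableEq ι] [Fintype κ] [DecidableEq κ]
    (ℓ : (κ → EuclideanSpace ℝ ι) →L[ℝ] ℝ) :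
    ∃ c : κ × ι → ℝ, ∀ x, ℓ x = ∑ k, c k * x k.1 k.2 := by
  let m : κ → EuclideanSpace ℝ ι →L[ℝ] ℝ := fun r =>
    ℓ.comp (ContinuousLinearMap.single ℝ (fun _ : κ => EuclideanSpace ℝ ι) r)
  refine ⟨fun k => m k.1 (EuclideanSpace.single k.2 1), fun x => ?_⟩
  have e1 : ∀ (r : κ) (z : EuclideanSpace ℝ ι),
      m r z = ∑ i, m r (EuclideanSpace.single i 1) * z i := fun r z => by
    conv_lhs => rw [← (EuclideanSpace.basisFun ι ℝ).sum_repr z]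
    simp [mul_comm]
  have e2 : ℓ x = ∑ r, m r (x r) := by
    conv_lhs => rw [← Finset.univ_sum_single x, map_sum]
    rfl
  rw [e2, Fintype.sum_prod_type]
  exact Finset.sum_congr rfl fun r _ => e1 r (x r)

section Uncorrelated

variable {Ω : Type*} [MeasurableSpace Ω] {μ : Measure Ω} [IsProbabilityMeasure μ]

theorem Uncorr.symm {E F : Type*} [NormedAddCommGroup E] [NormedSpace ℝ E] [NormedAddCommGroup F]
    [NormedSpace ℝ F] {U : Ω → E} {Y : Ω → F} (h : Uncorr μ U Y) : Uncorr μ Y U :=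
  fun ℓ₁ ℓ₂ => by
    simp_rw [mul_comm (ℓ₁ _)]
    exact h ℓ₂ ℓ₁

theorem uncorr_of_coord {ι ι' κ : Type*} [Fintype ι] [DecidableEq ι] [Fintype ι'] [DecidableEq ι']
    [Fintype κ] [DecidableEq κ] {U : Ω → EuclideanSpace ℝ ι} {Y : Ω → κ → EuclideanSpace ℝ ι'}
    (hU : ∀ i, MemLp (fun ω => U ω i) 2 μ) (hY : ∀ r j, MemLp (fun ω => Y ω r j) 2 μ)
    (h : ∀ i r j, ∫ ω, U ω i * Y ω r j ∂μ = 0) : Uncorr μ U Y := fun ℓ₁ ℓ₂ => by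
  obtain ⟨d, hd⟩ := exists_coeff_dual ℓ₂
  have e1 : ∀ z : EuclideanSpace ℝ ι, ℓ₁ z = ∑ i, ℓ₁ (EuclideanSpace.single i 1) * z i := fun z => by
    conv_lhs => rw [← (EuclideanSpace.basisFun ι ℝ).sum_repr z]
    simp [mul_comm]
  have e2 : ∀ ω, ℓ₁ (U ω) * ℓ₂ (Y ω) =
      ∑ i, ∑ k, ℓ₁ (EuclideanSpace.single i 1) * d k * (U ω i * Y ω k.1 k.2) := fun ω => by
    rw [e1, hd, Finset.sum_mul_sum]
    exact Finset.sum_congr rfl fun i _ => Finset.sum_congr rfl fun k _ => by ring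
  have hi : ∀ i k, Integrable
      (fun ω => ℓ₁ (EuclideanSpace.single i 1) * d k * (U ω i * Y ω k.1 k.2)) μ := fun i k =>
    ((hU i).integrable_mul (hY k.1 k.2)).const_mul _
  simp_rw [e2]
  rw [integral_finsetSum _ fun i _ => integrable_finsetSum _ fun k _ => hi i k]
  refine Finset.sum_eq_zero fun i _ => ?_
  rw [integral_finsetSum _ fun k _ => hi i k]
  refine Finset.sum_eq_zero fun k _ => ?_
  rw [integral_const_mul, h, mul_zero]

end Uncorrelated

section Coupling

variable {n p₁ p₂ : ℕ} {ι : Type*} [Fintype ι] [DecidableEq ι]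

/-- The block of coordinates `f (t, ·)`. -/
noncomputable def blockL (f : Idx n p₁ p₂ → ι) (t : Finset.Icc 1 n) :
    EuclideanSpace ℝ ι →L[ℝ] Vec p₁ p₂ :=
  LinearMap.toContinuousLinearMap
    { toFun := fun ω => WithLp.toLp 2 fun i => ω (f (t, i))
      map_add' := fun _ _ => rfl
      map_smul' := fun _ _ => rfl }

/-- The process with coordinates selected by `f`. -/
noncomputable def blockProc (f : Idx n p₁ p₂ → ι) (t : ℕ) (ω : EuclideanSpace ℝ ι) : Vec p₁ p₂ :=
  if h : t ∈ Finset.Icc 1 n then blockL f ⟨t, h⟩ ω else 0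

theorem blockProc_eq (f : Idx n p₁ p₂ → ι) {t : ℕ} (ht : t ∈ Finset.Icc 1 n) :
    blockProc f t = blockL f ⟨t, ht⟩ := by
  funext ω
  exact dif_pos ht

theorem coords_blockProc (f : Idx n p₁ p₂ → ι) (k : Idx n p₁ p₂) (ω : EuclideanSpace ℝ ι) :
    coords n (blockProc f) k ω = ω (f k) := by
  rw [coords, blockProc_eq f k.1.2]
  rfl

theorem measurable_blockProc (f : Idx n p₁ p₂ → ι) {t : ℕ} (ht : t ∈ Finset.Icc 1 n) :
    Measurable (blockProc f t) := by
  rw [blockProc_eq f ht]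
  exact (blockL f _).continuous.measurable

theorem linearOf_blockProc {ν : Measure (EuclideanSpace ℝ ι)} (f : Idx n p₁ p₂ → ι) {t : ℕ}
    (ht : t ∈ Finset.Icc 1 n) : LinearOf ν (fun ω => ω) (blockProc f t) := by
  rw [blockProc_eq f ht]
  exact LinearOf.of_map (blockL f _)

variable {K : Matrix (Idx n p₁ p₂ ⊕ Idx n p₁ p₂) (Idx n p₁ p₂ ⊕ Idx n p₁ p₂) ℝ}

theorem secondMoment_blockProc (hK : K.PosSemidef) :
    secondMoment (multivariateGaussian 0 K) (Sum.elim (coords n (blockProc Sum.inl))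
      (coords n (blockProc Sum.inr))) = K := by
  conv_rhs => rw [← secondMoment_multivariateGaussian hK]
  congr 1
  funext k ω
  rcases k with k | k <;> exact coords_blockProc _ _ _

theorem integral_coords_mul_coords (hK : K.PosSemidef) (a b : Idx n p₁ p₂ ⊕ Idx n p₁ p₂) :
    ∫ ω, Sum.elim (coords n (blockProc Sum.inl)) (coords n (blockProc Sum.inr)) a ω *
      Sum.elim (coords n (blockProc Sum.inl)) (coords n (blockProc Sum.inr)) b ω
        ∂(multivariateGaussian 0 K) = K a b :=
  congrFun (congrFun (secondMoment_blockProc hK) a) b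

theorem linearOf_seg_blockProc :
    LinearOf (multivariateGaussian 0 K) (fun ω => ω) (fun ω =>
      (seg (blockProc (n := n) (p₁ := p₁) (p₂ := p₂) Sum.inl) 1 n ω,
        seg (blockProc (n := n) (p₁ := p₁) (p₂ := p₂) Sum.inr) 1 n ω)) :=
  (LinearOf.seg fun _ ht => linearOf_blockProc Sum.inl ht).prodMk
    (LinearOf.seg fun _ ht => linearOf_blockProc Sum.inr ht)

theorem hasGaussianLaw_seg_blockProc :
    HasGaussianLaw (fun ω => (seg (blockProc (n := n) (p₁ := p₁) (p₂ := p₂) Sum.inl) 1 n ω,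
      seg (blockProc (n := n) (p₁ := p₁) (p₂ := p₂) Sum.inr) 1 n ω)) (multivariateGaussian 0 K) :=
  linearOf_seg_blockProc.hasGaussianLaw IsGaussian.hasGaussianLaw_id

theorem integral_seg_blockProc :
    ∫ ω, (seg (blockProc (n := n) (p₁ := p₁) (p₂ := p₂) Sum.inl) 1 n ω,
      seg (blockProc (n := n) (p₁ := p₁) (p₂ := p₂) Sum.inr) 1 n ω) ∂(multivariateGaussian 0 K) = 0 :=
  linearOf_seg_blockProc.integral_eq_zero
    (IsGaussian.hasGaussianLaw_id (μ := multivariateGaussian 0 K)).integrable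
    integral_id_multivariateGaussian

/-- The assembly of a path from its scalar coordinates. -/
noncomputable def pathOf (c : Idx n p₁ p₂ → ℝ) : Path n (Vec p₁ p₂) := fun t =>
  WithLp.toLp 2 fun i => c (t, i)

theorem measurable_pathOf : Measurable (pathOf : (Idx n p₁ p₂ → ℝ) → Path n (Vec p₁ p₂)) := by
  unfold pathOf
  fun_prop

theorem klDiv_blockProc_le (hK : K.PosSemidef) :
    InformationTheory.klDiv
      ((multivariateGaussian 0 K).map fun ω =>
        (seg (blockProc (n := n) (p₁ := p₁) (p₂ := p₂) Sum.inl) 1 n ω,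
          seg (blockProc (n := n) (p₁ := p₁) (p₂ := p₂) Sum.inr) 1 n ω))
      (((multivariateGaussian 0 K).map (seg (blockProc Sum.inl) 1 n)).prod
        ((multivariateGaussian 0 K).map (seg (blockProc Sum.inr) 1 n))) ≤
    gmi (secondMoment (multivariateGaussian 0 K) (coords n (blockProc Sum.inl))) K := by
  have hG := hasGaussianLaw_seg_blockProc (K := K)
  have h0 := integral_seg_blockProc (K := K)
  have i1 : ∫ ω, seg (blockProc (n := n) (p₁ := p₁) (p₂ := p₂) Sum.inl) 1 n ω
      ∂(multivariateGaussian 0 K) = 0 := by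
    have := ContinuousLinearMap.integral_comp_comm (ContinuousLinearMap.fst ℝ
      (Path n (Vec p₁ p₂)) (Path n (Vec p₁ p₂))) hG.integrable
    rw [h0, map_zero] at this
    exact this
  have i2 : ∫ ω, seg (blockProc (n := n) (p₁ := p₁) (p₂ := p₂) Sum.inr) 1 n ω
      ∂(multivariateGaussian 0 K) = 0 := by
    have := ContinuousLinearMap.integral_comp_comm (ContinuousLinearMap.snd ℝ
      (Path n (Vec p₁ p₂)) (Path n (Vec p₁ p₂))) hG.integrable
    rw [h0, map_zero] at this
    exact this
  have hm : ∀ (f : Idx n p₁ p₂ → Idx n p₁ p₂ ⊕ Idx n p₁ p₂) k,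
      Measurable (coords n (blockProc f) k) := fun f k => by
    have : coords n (blockProc f) k = fun ω => ω (f k) := funext fun ω => coords_blockProc f k ω
    rw [this]
    fun_prop
  have hG' : HasGaussianLaw (fun ω (k : Idx n p₁ p₂ ⊕ Idx n p₁ p₂) =>
      Sum.elim (coords n (blockProc Sum.inl)) (coords n (blockProc Sum.inr)) k ω)
      (multivariateGaussian 0 K) := by
    have h := (IsGaussian.hasGaussianLaw_id (μ := multivariateGaussian 0 K)).map_fun
      (ContinuousLinearMap.pi fun k => (EuclideanSpace.proj k :
        EuclideanSpace ℝ (Idx n p₁ p₂ ⊕ Idx n p₁ p₂) →L[ℝ] ℝ))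
    convert! h using 1
    funext ω k
    rcases k with k | k <;> exact coords_blockProc _ _ _
  have hle := klDiv_le_gmi (hm Sum.inl) (hm Sum.inr) hG' (integral_coords hG.fst i1)
    (integral_coords hG.snd i2)
  rw [secondMoment_blockProc hK] at hle
  refine le_trans (le_of_eq ?_) ((InformationTheory.klDiv_map_le _ _
    (measurable_pathOf.prodMap measurable_pathOf)).trans hle)
  have m1 : Measurable fun ω k => coords n (blockProc (Sum.inl : Idx n p₁ p₂ → _ ⊕ Idx n p₁ p₂)) k ω :=
    measurable_pi_lambda _ (hm Sum.inl)
  have m2 : Measurable fun ω k => coords n (blockProc (Sum.inr : Idx n p₁ p₂ → Idx n p₁ p₂ ⊕ _)) k ω :=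
    measurable_pi_lambda _ (hm Sum.inr)
  have := Measure.isProbabilityMeasure_map (μ := multivariateGaussian 0 K) m1.aemeasurable
  have := Measure.isProbabilityMeasure_map (μ := multivariateGaussian 0 K) m2.aemeasurable
  rw [Measure.map_map (measurable_pathOf.prodMap measurable_pathOf) (m1.prodMk m2),
    ← Measure.map_prod_map _ _ measurable_pathOf measurable_pathOf,
    Measure.map_map measurable_pathOf m1, Measure.map_map measurable_pathOf m2]
  rfl

variable {Ω : Type*} [MeasurableSpace Ω] {μ : Measure Ω} [IsProbabilityMeasure μ]
  {q₁ q₂ : ℕ} {X : ℕ → Ω → Vec p₁ p₂} {W : ℕ → Ω → Vec q₁ q₂}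
  {A : ℕ → SqMat p₁ p₂} {B : ℕ → Matrix (Fin p₁ ⊕ Fin p₂) (Fin q₁ ⊕ Fin q₂) ℝ}
  {QX : SqMat p₁ p₂} {QW : ℕ → SqMat q₁ q₂} {Δ₁ Δ₂ : ℝ≥0}
  (hn : 1 ≤ n) (hM : IsGaussMarkov μ n A B QX QW X W)
  (hK : K ∈ momentSet A (secondMoment μ (coords n X)) Δ₁ Δ₂)

theorem posSemidef_of_mem_momentSet {S : Matrix (Idx n p₁ p₂) (Idx n p₁ p₂) ℝ}
    (hK : K ∈ momentSet A S Δ₁ Δ₂) : K.PosSemidef :=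
  PosSemidef.of_dotProduct_mulVec_nonneg (by ext i j; simpa using hK.1 j i) fun v => hK.2.1 v

theorem secondMoment_source {S : Matrix (Idx n p₁ p₂) (Idx n p₁ p₂) ℝ}
    (hK : K ∈ momentSet A S Δ₁ Δ₂) :
    secondMoment (multivariateGaussian 0 K) (coords n (blockProc Sum.inl)) = S := by
  ext a b
  rw [← hK.2.2.1 a b]
  exact integral_coords_mul_coords (posSemidef_of_mem_momentSet hK) (Sum.inl a) (Sum.inl b)

include hn hM hK

theorem map_seg_blockProc :
    (multivariateGaussian 0 K).map (seg (blockProc Sum.inl) 1 n) = μ.map (seg X 1 n) := by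
  have hG := (hasGaussianLaw_seg_blockProc (K := K)).fst
  have hG' := hM.hasGaussianLaw_seg hn
  have hm : Measurable (seg X 1 n) := measurable_seg hM.measurable_X
  have hm' : Measurable (seg (blockProc (Sum.inl : Idx n p₁ p₂ → _ ⊕ Idx n p₁ p₂)) 1 n) :=
    measurable_seg fun t ht => measurable_blockProc _ ht
  have := hG.isGaussian_map
  have := hG'.isGaussian_map
  refine isGaussian_ext ?_ ?_ fun ℓ => ?_
  · rw [integral_map hm'.aemeasurable (by fun_prop)]
    have := ContinuousLinearMap.integral_comp_comm (ContinuousLinearMap.fst ℝ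
      (Path n (Vec p₁ p₂)) (Path n (Vec p₁ p₂)))
      (hasGaussianLaw_seg_blockProc (n := n) (p₁ := p₁) (p₂ := p₂) (K := K)).integrable
    rw [integral_seg_blockProc, map_zero] at this
    exact this
  · rw [integral_map hm.aemeasurable (by fun_prop), hM.integral_seg_eq_zero hn]
  · obtain ⟨c, hc⟩ := exists_coeff_dual ℓ
    rw [integral_map hm'.aemeasurable (by fun_prop), integral_map hm.aemeasurable (by fun_prop)]
    simp_rw [hc, sq]
    refine (integral_sum_mul_sum (memLp_coords hG) c c).trans
      (Eq.trans ?_ (integral_sum_mul_sum (memLp_coords hG') c c).symm)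
    rw [secondMoment_source hK]

theorem map_innovation_blockProc {t : ℕ} (ht : t ∈ Finset.Icc 1 (n - 1)) :
    ((multivariateGaussian 0 K).map fun ω =>
      (blockProc Sum.inl (t + 1) ω - act (A t) (blockProc Sum.inl t ω) : Vec p₁ p₂)) =
    (multivariateGaussian 0 (QW (t + 1))).map (act (B t)) := by
  have ht' := Finset.mem_Icc.1 ht
  have hm : Measurable (seg X 1 n) := measurable_seg hM.measurable_X
  have hm' : Measurable (seg (blockProc (Sum.inl : Idx n p₁ p₂ → _ ⊕ Idx n p₁ p₂)) 1 n) :=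
    measurable_seg fun t ht => measurable_blockProc _ ht
  let d : Path n (Vec p₁ p₂) → Vec p₁ p₂ := fun x =>
    x ⟨t + 1, Finset.mem_Icc.2 ⟨by omega, by omega⟩⟩ -
      act (A t) (x ⟨t, Finset.mem_Icc.2 ⟨by omega, by omega⟩⟩)
  have hd : Measurable d := by fun_prop
  have h := congrArg (Measure.map d) (map_seg_blockProc hn hM hK)
  rw [Measure.map_map hd hm, Measure.map_map hd hm'] at h
  rw [← hM.map_innovation ht]
  exact h

theorem indepFun_innovation_blockProc {t : ℕ} (ht : t ∈ Finset.Icc 1 (n - 1)) :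
    IndepFun (fun ω => (blockProc Sum.inl (t + 1) ω - act (A t) (blockProc Sum.inl t ω) : Vec p₁ p₂))
      (fun ω => seg (blockProc Sum.inl : ℕ → _ → Vec p₁ p₂) 1 t ω) (multivariateGaussian 0 K) := by
  have ht' := Finset.mem_Icc.1 ht
  have htn : t ≤ n := by omega
  have hm : Measurable (seg X 1 n) := measurable_seg hM.measurable_X
  have hm' : Measurable (seg (blockProc (Sum.inl : Idx n p₁ p₂ → _ ⊕ Idx n p₁ p₂)) 1 n) :=
    measurable_seg fun t ht => measurable_blockProc _ ht
  let d : Path n (Vec p₁ p₂) → Vec p₁ p₂ := fun x =>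
    x ⟨t + 1, Finset.mem_Icc.2 ⟨by omega, by omega⟩⟩ -
      act (A t) (x ⟨t, Finset.mem_Icc.2 ⟨by omega, by omega⟩⟩)
  have hd : Measurable d := by fun_prop
  have h := hM.indepFun_innovation hn ht
  exact (indepFun_map_iff hm' hd (measurable_segInit htn)).1
    (map_seg_blockProc hn hM hK ▸ (indepFun_map_iff hm hd (measurable_segInit htn)).2 h)

/-- The centred Gaussian law with second moments in `momentSet` is a coupling of the source. -/
theorem gaussCoupling_blockProc :
    GaussCoupling (multivariateGaussian 0 K) n A (blockProc Sum.inl) (blockProc Sum.inr) where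
  measurable_X t ht := measurable_blockProc _ ht
  measurable_Y t ht := measurable_blockProc _ ht
  gaussian := hasGaussianLaw_seg_blockProc
  integral_eq_zero := integral_seg_blockProc
  indep t ht := by
    have ht' := Finset.mem_Icc.1 ht
    have htn : t ≤ n := by omega
    have h1 : t ∈ Finset.Icc 1 n := Finset.mem_Icc.2 ⟨ht'.1, htn⟩
    have h2 : t + 1 ∈ Finset.Icc 1 n := Finset.mem_Icc.2 ⟨by omega, by omega⟩
    have hps := posSemidef_of_mem_momentSet hK
    set ν := multivariateGaussian 0 K with hν
    have hid : HasGaussianLaw (fun ω => ω) ν := IsGaussian.hasGaussianLaw_id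
    have hid0 : ∫ ω, ω ∂ν = 0 := integral_id_multivariateGaussian
    have lX : ∀ r ∈ Finset.Icc 1 n, LinearOf ν (fun ω => ω)
      (blockProc (Sum.inl : Idx n p₁ p₂ → _ ⊕ Idx n p₁ p₂) r) := fun r hr => linearOf_blockProc _ hr
    have lY : ∀ r ∈ Finset.Icc 1 n, LinearOf ν (fun ω => ω)
      (blockProc (Sum.inr : Idx n p₁ p₂ → Idx n p₁ p₂ ⊕ _) r) := fun r hr => linearOf_blockProc _ hr
    have lD := (lX _ h2).sub ((lX _ h1).map (actL (A t)))
    have lXt : LinearOf ν (fun ω => ω)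
        (seg (blockProc (Sum.inl : Idx n p₁ p₂ → _ ⊕ Idx n p₁ p₂)) 1 t) :=
      LinearOf.seg fun r hr => lX r (Finset.Icc_subset_Icc_right htn hr)
    have lYt : LinearOf ν (fun ω => ω)
        (seg (blockProc (Sum.inr : Idx n p₁ p₂ → Idx n p₁ p₂ ⊕ _)) 1 t) :=
      LinearOf.seg fun r hr => lY r (Finset.Icc_subset_Icc_right htn hr)
    have gD := lD.hasGaussianLaw hid
    have gX := lXt.hasGaussianLaw hid
    have gY := lYt.hasGaussianLaw hid
    have d0 := lD.integral_eq_zero hid.integrable hid0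
    have uX := uncorr_of_indepFun gD.integrable gX.integrable d0
      (indepFun_innovation_blockProc hn hM hK ht)
    have hcX : ∀ k, MemLp (coords n (blockProc (Sum.inl : Idx n p₁ p₂ → _ ⊕ Idx n p₁ p₂)) k) 2 ν :=
      memLp_coords (hasGaussianLaw_seg_blockProc (K := K)).fst
    have hcY : ∀ k, MemLp (coords n (blockProc (Sum.inr : Idx n p₁ p₂ → Idx n p₁ p₂ ⊕ _)) k) 2 ν :=
      memLp_coords (hasGaussianLaw_seg_blockProc (K := K)).snd
    have uY := uncorr_of_coord (hasGaussianLaw_eval gD)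
      (fun r j => hasGaussianLaw_eval (gY.eval (X := fun (r : Finset.Icc 1 t) ω =>
        blockProc (Sum.inr : Idx n p₁ p₂ → Idx n p₁ p₂ ⊕ _) r ω) r) j) fun i r j => by
      let r' : Finset.Icc 1 n := ⟨r, Finset.Icc_subset_Icc_right htn r.2⟩
      have e : ∀ ω, (blockProc (Sum.inl : Idx n p₁ p₂ → _ ⊕ Idx n p₁ p₂) (t + 1) ω -
            actL (A t) (blockProc Sum.inl t ω)) i * blockProc Sum.inr r ω j =
          coords n (blockProc Sum.inl) (⟨t + 1, h2⟩, i) ω * coords n (blockProc Sum.inr) (r', j) ω -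
          ∑ k, A t i k * (coords n (blockProc Sum.inl) (⟨t, h1⟩, k) ω *
            coords n (blockProc Sum.inr) (r', j) ω) := fun ω => by
        have e1 : (actL (A t) (blockProc (Sum.inl : Idx n p₁ p₂ → _ ⊕ Idx n p₁ p₂) t ω)) i =
            ∑ k, A t i k * coords n (blockProc Sum.inl) (⟨t, h1⟩, k) ω := rfl
        rw [PiLp.sub_apply, e1, sub_mul, Finset.sum_mul]
        simp_rw [← mul_assoc]
        rfl
      have hi : ∀ a b, Integrable (fun ω =>
          coords n (blockProc (Sum.inl : Idx n p₁ p₂ → _ ⊕ Idx n p₁ p₂)) a ω *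
            coords n (blockProc Sum.inr) b ω) ν := fun a b => (hcX a).integrable_mul (hcY b)
      refine (integral_congr_ae (Filter.Eventually.of_forall e)).trans ?_
      rw [integral_sub (hi _ _) (integrable_finsetSum _ fun k _ => (hi _ _).const_mul _),
        integral_finsetSum _ fun k _ => (hi _ _).const_mul _]
      simp_rw [integral_const_mul]
      have e2 : ∀ a b, ∫ ω, coords n (blockProc (Sum.inl : Idx n p₁ p₂ → _ ⊕ Idx n p₁ p₂)) a ω *
            coords n (blockProc Sum.inr) b ω ∂ν = K (.inl a) (.inr b) := fun a b =>
        integral_coords_mul_coords hps (Sum.inl a) (Sum.inr b)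
      simp_rw [e2]
      rw [hK.2.2.2.1 ⟨t, h1⟩ ⟨t + 1, h2⟩ r' rfl (Finset.mem_Icc.1 r.2).2 i j, sub_self]
    exact indepFun_of_uncorr ((lD.prodMk (lXt.prodMk lYt)).hasGaussianLaw hid) d0
      ((uX.symm.prodMk gX gY gD uY.symm).symm)

end Coupling


/-! ### Existence of a Gaussian minimizer -/

section Minimizer

variable {Ω : Type*} [MeasurableSpace Ω] {μ : Measure Ω} [IsProbabilityMeasure μ]
  {p₁ p₂ q₁ q₂ n : ℕ} {X : ℕ → Ω → Vec p₁ p₂} {W : ℕ → Ω → Vec q₁ q₂}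
  {A : ℕ → SqMat p₁ p₂} {B : ℕ → Matrix (Fin p₁ ⊕ Fin p₂) (Fin q₁ ⊕ Fin q₂) ℝ}
  {QX : SqMat p₁ p₂} {QW : ℕ → SqMat q₁ q₂} {Δ₁ Δ₂ : ℝ≥0}
  {K : Matrix (Idx n p₁ p₂ ⊕ Idx n p₁ p₂) (Idx n p₁ p₂ ⊕ Idx n p₁ p₂) ℝ}

/-- The law of an innovation and its estimate. -/
noncomputable def innovLaw {Ω : Type*} [MeasurableSpace Ω] (ν : Measure Ω) (A : ℕ → SqMat p₁ p₂)
    (X Y : ℕ → Ω → Vec p₁ p₂) (t : ℕ) : Measure (Vec p₁ p₂ × Vec p₁ p₂) :=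
  ν.map fun ω => (innov ν A X Y t ω, innovEst ν A X Y t ω)

section Coupling

variable {Ω' : Type*} [MeasurableSpace Ω'] {ν : Measure Ω'} [IsProbabilityMeasure ν]
  {X' Y' : ℕ → Ω' → Vec p₁ p₂} (hn : 1 ≤ n) (hM : IsGaussMarkov μ n A B QX QW X W)
  (h : GaussCoupling ν n A X' Y')
include h

theorem GaussCoupling.innovLaw_fst {s : ℕ} (hs : s + 1 ≤ n) :
    (innovLaw ν A X' Y' (s + 1)).map Prod.fst = ν.map (innov ν A X' Y' (s + 1)) := by
  rw [innovLaw, Measure.map_map measurable_fst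
    ((h.measurable_innov hs).prodMk (h.measurable_innovEst hs))]
  rfl

theorem GaussCoupling.innovLaw_snd {s : ℕ} (hs : s + 1 ≤ n) :
    (innovLaw ν A X' Y' (s + 1)).map Prod.snd = ν.map (innovEst ν A X' Y' (s + 1)) := by
  rw [innovLaw, Measure.map_map measurable_snd
    ((h.measurable_innov hs).prodMk (h.measurable_innovEst hs))]
  rfl

include hn in
theorem GaussCoupling.exists_isInnovLaw (hX : ν.map (X' 1) = multivariateGaussian 0 QX)
    (hD : ∀ t ∈ Finset.Icc 1 (n - 1), ν.map (fun ω => X' (t + 1) ω - act (A t) (X' t ω)) =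
      (multivariateGaussian 0 (QW (t + 1))).map (act (B t))) :
    ∃ H QV : ℕ → SqMat p₁ p₂, (∀ t ∈ Finset.Icc 1 n, (QV t).PosSemidef) ∧
      IsInnovLaw n A B QX QW H QV (innovLaw ν A X' Y') := by
  have hex : ∀ s : ℕ, ∃ H QV : SqMat p₁ p₂, s + 1 ≤ n → QV.PosSemidef ∧
      innovLaw ν A X' Y' (s + 1) = ((ν.map (innov ν A X' Y' (s + 1))).prod
        (multivariateGaussian 0 QV)).map fun p => (p.1, act H p.1 + p.2) := fun s => by
    by_cases hs : s + 1 ≤ n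
    · obtain ⟨H, QV, hHV⟩ := h.exists_gain hs
      exact ⟨H, QV, fun _ => hHV⟩
    · exact ⟨0, 0, fun hs' => absurd hs' hs⟩
  choose H QV hHV using hex
  refine ⟨fun t => H (t - 1), fun t => QV (t - 1), fun t ht => ?_, ?_, ?_, ?_, ?_⟩
  · have := Finset.mem_Icc.1 ht
    exact (hHV (t - 1) (by omega)).1
  · intro s hs
    rw [h.innovLaw_fst hs]
    exact (hHV s hs).2
  · rw [h.innovLaw_fst (s := 0) hn, ← hX]
    congr 1
    funext ω
    simp [innov, prevEst, act_zero]
  · intro s hs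
    rw [h.innovLaw_fst (s := s + 1) hs, h.map_innov_succ hs,
      ← hD (s + 1) (Finset.mem_Icc.2 ⟨by omega, by omega⟩), innovLaw,
      Measure.map_map (by fun_prop)
        ((h.measurable_innov (by omega)).prodMk (h.measurable_innovEst (by omega)))]
    rfl
  · intro s hs
    exact (indepFun_map_iff ((h.measurable_innov hs).prodMk (h.measurable_innovEst hs))
      (by fun_prop) measurable_snd).2 (h.indepFun_error hs)

end Coupling

theorem measurable_distortion {Ω : Type*} [MeasurableSpace Ω] {p : ℕ}
    {X Y : ℕ → Ω → EuclideanSpace ℝ (Fin p)} (hX : ∀ t ∈ Finset.Icc 1 n, Measurable (X t))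
    (hY : ∀ t ∈ Finset.Icc 1 n, Measurable (Y t)) :
    Measurable fun ω => distortion n (fun t => X t ω) (fun t => Y t ω) := by
  unfold distortion
  refine (Finset.measurable_sum _ fun t ht => ?_).const_mul _
  exact ((hX t ht).sub (hY t ht)).norm.pow_const 2

/-- A pair of processes, put on the path space. -/
theorem lintegral_distortion_map {X Y : ℕ → Ω → Vec p₁ p₂}
    (hX : ∀ t ∈ Finset.Icc 1 n, Measurable (X t)) (hY : ∀ t ∈ Finset.Icc 1 n, Measurable (Y t))
    {p : ℕ} (f : Fin p → Fin p₁ ⊕ Fin p₂) :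
    ∫⁻ z, ENNReal.ofReal (distortion n (fun t => WithLp.toLp 2 fun i => (xproc t z : Vec p₁ p₂) (f i))
      (fun t => WithLp.toLp 2 fun i => (yproc t z : Vec p₁ p₂) (f i)))
        ∂(μ.map fun ω => (seg X 1 n ω, seg Y 1 n ω)) =
    ∫⁻ ω, ENNReal.ofReal (distortion n (fun t => WithLp.toLp 2 fun i => X t ω (f i))
      (fun t => WithLp.toLp 2 fun i => Y t ω (f i))) ∂μ := by
  have hm : Measurable fun z : Path n (Vec p₁ p₂) × Path n (Vec p₁ p₂) =>
      distortion n (fun t => WithLp.toLp 2 fun i => (xproc t z : Vec p₁ p₂) (f i))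
        (fun t => WithLp.toLp 2 fun i => (yproc t z : Vec p₁ p₂) (f i)) := by
    refine measurable_distortion
      (X := fun t (z : Path n (Vec p₁ p₂) × Path n (Vec p₁ p₂)) =>
        WithLp.toLp 2 fun i => (xproc t z : Vec p₁ p₂) (f i))
      (Y := fun t (z : Path n (Vec p₁ p₂) × Path n (Vec p₁ p₂)) =>
        WithLp.toLp 2 fun i => (yproc t z : Vec p₁ p₂) (f i)) (fun t _ => ?_) fun t _ => ?_
    · have := measurable_xproc (n := n) (E := Vec p₁ p₂) t
      fun_prop
    · have := measurable_yproc (n := n) (E := Vec p₁ p₂) t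
      fun_prop
  rw [MeasureTheory.lintegral_map hm.ennreal_ofReal ((measurable_seg hX).prodMk (measurable_seg hY))]
  refine lintegral_congr fun ω => ?_
  congr 1
  unfold distortion
  congr 1
  refine Finset.sum_congr rfl fun t ht => ?_
  simp only [xproc, yproc, coord, dif_pos ht]
  rfl

/-- A realization with the same innovation laws as a coupling has no larger distortion. -/
theorem lintegral_distortion_reproduction_le {H QV : ℕ → SqMat p₁ p₂} {V : ℕ → Ω → Vec p₁ p₂}
    {Ω' : Type*} [MeasurableSpace Ω'] {ν : Measure Ω'} [IsProbabilityMeasure ν]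
    {X' Y' : ℕ → Ω' → Vec p₁ p₂} (hn : 1 ≤ n) (hM : IsGaussMarkov μ n A B QX QW X W)
    (hV : IsNoise μ n QV X W V) (h : GaussCoupling ν n A X' Y')
    (hJ : IsInnovLaw n A B QX QW H QV (innovLaw ν A X' Y')) {p : ℕ}
    (f : Fin p → Fin p₁ ⊕ Fin p₂) {Δ : ℝ≥0}
    (hΔ : cost f (secondMoment ν (Sum.elim (coords n X') (coords n Y'))) ≤ Δ) :
    ∫⁻ ω, ENNReal.ofReal (distortion n (fun t => WithLp.toLp 2 fun i => X t ω (f i))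
      (fun t => WithLp.toLp 2 fun i => reproduction A H X V t ω (f i))) ∂μ ≤ Δ := by
  have hX2 := memLp_coords (hM.hasGaussianLaw_seg hn)
  have hY2 : ∀ k, MemLp (coords n (reproduction A H X V) k) 2 μ :=
    memLp_coords (hV.hasGaussianLaw_of_linearOf hn hM (linearOf_seg_reproduction hn hM hV le_rfl))
  have hx2 := memLp_coords h.gaussian.fst
  have hy2 := memLp_coords h.gaussian.snd
  simp_rw [distortion_eq f (fun t => X t _) (fun t => reproduction A H X V t _)]
  have hi : ∀ (t : Finset.Icc 1 n) (i : Fin p),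
      Integrable (fun ω => (X t ω (f i) - reproduction A H X V t ω (f i)) ^ 2) μ := fun t i =>
    ((hX2 (t, f i)).sub (hY2 (t, f i))).integrable_sq
  have hi' : ∀ (t : Finset.Icc 1 n) (i : Fin p),
      Integrable (fun ω => (X' t ω (f i) - Y' t ω (f i)) ^ 2) ν := fun t i =>
    ((hx2 (t, f i)).sub (hy2 (t, f i))).integrable_sq
  have hs : ∀ t : Finset.Icc 1 n, Integrable
      (fun ω => ∑ i, (X t ω (f i) - reproduction A H X V t ω (f i)) ^ 2) μ := fun t =>
    integrable_finsetSum _ fun i _ => hi t i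
  rw [← ofReal_integral_eq_lintegral_ofReal ((integrable_finsetSum _ fun t _ => hs t).const_mul _)
    (Filter.Eventually.of_forall fun ω => by positivity)]
  refine ENNReal.ofReal_le_of_le_toReal (le_trans ?_ hΔ)
  rw [← integral_distortion f hx2 hy2]
  simp_rw [distortion_eq f (fun t => X' t _) (fun t => Y' t _)]
  rw [integral_const_mul, integral_const_mul, integral_finsetSum _ fun t _ => hs t,
    integral_finsetSum _ fun t _ => integrable_finsetSum _ fun i _ => hi' t i]
  refine mul_le_mul_of_nonneg_left (Finset.sum_le_sum fun t _ => ?_) (by positivity)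
  rw [integral_finsetSum _ fun i _ => hi t i, integral_finsetSum _ fun i _ => hi' t i]
  refine Finset.sum_le_sum fun i _ => ?_
  rw [integral_sq_reproduction hn hM hV hJ t.2]
  refine le_trans (le_of_eq ?_) (h.integral_sq_error_le t.2 (f i))
  obtain ⟨h1, h2⟩ := Finset.mem_Icc.1 t.2
  obtain ⟨s, hs⟩ : ∃ s, (t : ℕ) = s + 1 := ⟨t - 1, by omega⟩
  rw [hs] at h2 ⊢
  rw [innovLaw, integral_map ((h.measurable_innov h2).prodMk (h.measurable_innovEst h2)).aemeasurable
    (by fun_prop : Measurable fun p : Vec p₁ p₂ × Vec p₁ p₂ =>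
      (p.1 (f i) - p.2 (f i)) ^ 2).aestronglyMeasurable]

theorem exists_gaussian_minimizer (hn : 1 ≤ n) (hM : IsGaussMarkov μ n A B QX QW X W)
    (Δ₁ Δ₂ : ℝ≥0) : ∃ (H QV : ℕ → SqMat p₁ p₂)
      (Ω' : Type) (_ : MeasurableSpace Ω') (μ' : Measure Ω') (_ : IsProbabilityMeasure μ')
      (X' : ℕ → Ω' → Vec p₁ p₂) (W' : ℕ → Ω' → Vec q₁ q₂) (V' Y' : ℕ → Ω' → Vec p₁ p₂),
    IsGaussMarkov μ' n A B QX QW X' W' ∧ IsRealization μ' n H QV X' W' V' Y' ∧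
    ∃ P ∈ admissible (μ.map (seg X 1 n)) Δ₁ Δ₂,
      P.toMeasure = μ'.map (fun ω => (seg X' 1 n ω, seg Y' 1 n ω)) ∧
      IsGaussian P.toMeasure ∧
      payoff n P.toMeasure xproc yproc = jointNRDF (μ.map (seg X 1 n)) Δ₁ Δ₂ := by
  obtain ⟨K, hK, hmin⟩ := exists_gmi_le_payoff hn hM Δ₁ Δ₂
  have hps := posSemidef_of_mem_momentSet hK
  have hC := gaussCoupling_blockProc hn hM hK
  have h1n : 1 ∈ Finset.Icc 1 n := Finset.mem_Icc.2 ⟨le_rfl, hn⟩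
  have hlaw := map_seg_blockProc hn hM hK
  have hXm : Measurable (seg X 1 n) := measurable_seg hM.measurable_X
  have hX1 : (multivariateGaussian 0 K).map (blockProc Sum.inl 1) = multivariateGaussian 0 QX := by
    have he : Measurable fun x : Path n (Vec p₁ p₂) => x ⟨1, h1n⟩ := by fun_prop
    have := congrArg (Measure.map fun x : Path n (Vec p₁ p₂) => x ⟨1, h1n⟩) hlaw
    rw [Measure.map_map he hXm, Measure.map_map he (measurable_seg hC.measurable_X)] at this
    rw [← hM.law_X]
    exact this
  obtain ⟨H, QV, hQV, hJ⟩ := hC.exists_isInnovLaw hn hX1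
    (fun t ht => map_innovation_blockProc hn hM hK ht)
  let μ' := baseMeasure n QX QW QV
  have hM' : IsGaussMarkov μ' n A B QX QW (baseX A B) baseW :=
    isGaussMarkov_base hM.posSemidef_QX hM.posSemidef_QW
  have hV' : IsNoise μ' n QV (baseX A B) baseW baseV := isNoise_base hQV
  let Y' := reproduction A H (baseX (n := n) A B) (baseV (q₁ := q₁) (q₂ := q₂))
  have hR : IsRealization μ' n H QV (baseX A B) baseW baseV Y' :=
    isRealization_reproduction hn hM' hV' hJ
  have hN : Nonanticipative μ' n (baseX A B) Y' := nonanticipative_reproduction hn hM' hV'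
  have hX'm : Measurable (seg (baseX (n := n) A B) 1 n) := measurable_seg hM'.measurable_X
  have hY'm : Measurable (seg Y' 1 n) := measurable_seg hR.measurable_Y
  let P : ProbabilityMeasure (Path n (Vec p₁ p₂) × Path n (Vec p₁ p₂)) :=
    ⟨μ'.map (fun ω => (seg (baseX A B) 1 n ω, seg Y' 1 n ω)),
      Measure.isProbabilityMeasure_map (hX'm.prodMk hY'm).aemeasurable⟩
  have hP : P.toMeasure = μ'.map (fun ω => (seg (baseX A B) 1 n ω, seg Y' 1 n ω)) := rfl
  have hPN : Nonanticipative P.toMeasure n xproc yproc := by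
    intro t ht htn
    obtain ⟨κ, hκ, hk⟩ := hN t ht htn
    refine ⟨κ, hκ, ?_⟩
    have m1 : Measurable fun z : Path n (Vec p₁ p₂) × Path n (Vec p₁ p₂) =>
        (seg xproc 1 n z, seg yproc 1 t z) :=
      (measurable_seg fun t _ => measurable_xproc t).prodMk
        (measurable_seg fun t _ => measurable_yproc t)
    rw [hP, Measure.map_map m1 (hX'm.prodMk hY'm), seg_xproc,
      Measure.map_map measurable_fst (hX'm.prodMk hY'm)]
    refine Eq.trans ?_ hk
    congr 1
    funext ω
    refine Prod.ext rfl (funext fun r => ?_)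
    exact dif_pos (Finset.Icc_subset_Icc_right ht r.2)
  have hPa : P ∈ admissible (μ.map (seg X 1 n)) Δ₁ Δ₂ := by
    refine ⟨?_, (nonanticipative_iff (fun t _ => measurable_xproc t)
      (fun t _ => measurable_yproc t)).1 hPN, ?_, ?_⟩
    · rw [hP, Measure.map_map measurable_fst (hX'm.prodMk hY'm), hM.map_seg hn, ← hM'.map_seg hn]
      rfl
    · refine (lintegral_distortion_map hM'.measurable_X hR.measurable_Y Sum.inl).trans_le
        (lintegral_distortion_reproduction_le hn hM' hV' hC hJ Sum.inl ?_)
      rw [secondMoment_blockProc hps]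
      exact hK.2.2.2.2.1
    · refine (lintegral_distortion_map hM'.measurable_X hR.measurable_Y Sum.inr).trans_le
        (lintegral_distortion_reproduction_le hn hM' hV' hC hJ Sum.inr ?_)
      rw [secondMoment_blockProc hps]
      exact hK.2.2.2.2.2
  have hpay : payoff n P.toMeasure xproc yproc ≤ gmi (secondMoment μ (coords n X)) K := by
    have e1 : payoff n P.toMeasure xproc yproc = payoff n μ' (baseX A B) Y' := by
      rw [payoff_eq_klDiv hM'.measurable_X hR.measurable_Y hN,
        payoff_eq_klDiv (fun t _ => measurable_xproc t) (fun t _ => measurable_yproc t) hPN,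
        seg_xproc, seg_yproc, hP, Measure.map_map measurable_fst (hX'm.prodMk hY'm),
        Measure.map_map measurable_snd (hX'm.prodMk hY'm)]
      congr 1
      exact Measure.map_id
    rw [e1]
    refine (payoff_reproduction_le hn hM' hV' hJ).trans ?_
    have h2 := hC.sum_klDiv_innov_le.trans (klDiv_blockProc_le hps)
    rw [secondMoment_source hK] at h2
    refine le_of_eq_of_le (Finset.sum_congr rfl fun t ht => ?_) h2
    obtain ⟨h1, h3⟩ := Finset.mem_Icc.1 ht
    obtain ⟨s, rfl⟩ : ∃ s, t = s + 1 := ⟨t - 1, by omega⟩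
    rw [hC.innovLaw_fst h3, hC.innovLaw_snd h3]
    rfl
  refine ⟨H, QV, BaseSpace n p₁ p₂ q₁ q₂, inferInstance, μ', inferInstanceAs
    (IsProbabilityMeasure (baseMeasure n QX QW QV)), baseX A B, baseW, baseV, Y', hM', hR, P, hPa,
    hP, hR.isGaussian hn hM' le_rfl, le_antisymm ?_ ?_⟩
  · exact le_iInf₂ fun P' hP' => hpay.trans (hmin P' hP')
  · exact iInf₂_le P hPa

end Minimizer

end JointNRDF

theorem theorem3 (p₁ p₂ q₁ q₂ n : ℕ) (hn : 1 ≤ n)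
    (A : ℕ → SqMat p₁ p₂)
    (B : ℕ → Matrix (Fin p₁ ⊕ Fin p₂) (Fin q₁ ⊕ Fin q₂) ℝ)
    (QX : SqMat p₁ p₂) (QW : ℕ → SqMat q₁ q₂)
    {Ω : Type*} [MeasurableSpace Ω] (μ : Measure Ω) [IsProbabilityMeasure μ]
    (X : ℕ → Ω → Vec p₁ p₂) (W : ℕ → Ω → Vec q₁ q₂)
    (hXW : IsGaussMarkov μ n A B QX QW X W) (Δ₁ Δ₂ : ℝ≥0) :
    -- part (a): a Gaussian minimizer exists and is induced by the parametric realization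
    (∃ (H QV : ℕ → SqMat p₁ p₂)
        (Ω' : Type) (_ : MeasurableSpace Ω') (μ' : Measure Ω') (_ : IsProbabilityMeasure μ')
        (X' : ℕ → Ω' → Vec p₁ p₂) (W' : ℕ → Ω' → Vec q₁ q₂)
        (V' Y' : ℕ → Ω' → Vec p₁ p₂),
      IsGaussMarkov μ' n A B QX QW X' W' ∧
      IsRealization μ' n H QV X' W' V' Y' ∧
      ∃ P ∈ admissible (μ.map (seg X 1 n)) Δ₁ Δ₂,
        P.toMeasure =
          μ'.map (fun ω => (seg X' 1 n ω, seg Y' 1 n ω)) ∧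
        IsGaussian P.toMeasure ∧
        payoff n P.toMeasure xproc yproc =
          jointNRDF (μ.map (seg X 1 n)) Δ₁ Δ₂) ∧
    -- properties of every realization
    ∀ (H QV : ℕ → SqMat p₁ p₂) (V Y : ℕ → Ω → Vec p₁ p₂),
      IsRealization μ n H QV X W V Y →
      ∀ t ∈ Finset.Icc 1 n,
        -- joint Gaussianity of `(X^t, Y^t)`
        IsGaussian (μ.map fun ω => (seg X 1 t ω, seg Y 1 t ω)) ∧
        -- the second form of the realization
        (∀ᵐ ω ∂μ, Y t ω = act (H t) (X t ω) +
          act (1 - H t) (est μ X Y t (t - 1) ω) + V t ω) ∧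
        -- prediction from the preceding estimate
        (∀ᵐ ω ∂μ, est μ X Y t (t - 1) ω =
          act (A (t - 1)) (prevEst μ X Y t ω)) ∧
        -- (a)(i): the test channel
        (∀ᵐ ω ∂μ, condDistrib (Y t) (fun ω' => (seg Y 1 (t - 1) ω', X t ω')) μ
            (seg Y 1 (t - 1) ω, X t ω) =
          testChannel (H t) (QV t) (A (t - 1))
            (prevEst μ X Y t ω) (X t ω)) ∧
        -- (a)(ii): the identities for the pay-off
        condMutualInfo μ (seg X 1 t) (Y t) (seg Y 1 (t - 1)) =
          condMutualInfo μ (X t) (Y t) (seg Y 1 (t - 1)) ∧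
        condMutualInfo μ (X t) (Y t) (seg Y 1 (t - 1)) =
          condMutualInfo μ (X t) (Y t)
            (fun ω => (seg Y 1 (t - 1) ω, prevEst μ X Y t ω)) ∧
        condMutualInfo μ (X t) (Y t)
            (fun ω => (seg Y 1 (t - 1) ω, prevEst μ X Y t ω)) =
          condMutualInfo μ (X t) (fun ω => (Y t ω, est μ X Y t t ω))
            (fun ω => (seg Y 1 (t - 1) ω, est μ X Y t (t - 1) ω)) ∧
        condMutualInfo μ (X t) (fun ω => (Y t ω, est μ X Y t t ω))
            (fun ω => (seg Y 1 (t - 1) ω, est μ X Y t (t - 1) ω)) =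
          condMutualInfo μ (X t) (Y t)
            (fun ω => (seg Y 1 (t - 1) ω, prevEst μ X Y t ω,
              est μ X Y t t ω)) +
          condMutualInfo μ (X t) (est μ X Y t t)
            (fun ω => (seg Y 1 (t - 1) ω, prevEst μ X Y t ω)) ∧
        -- the lower bound
        condMutualInfo μ (X t) (est μ X Y t t)
            (fun ω => (seg Y 1 (t - 1) ω, est μ X Y t (t - 1) ω)) ≤
          condMutualInfo μ (seg X 1 t) (Y t)
            (seg Y 1 (t - 1)) ∧
        -- and a sufficient condition for equality in it
        (EstEqReproduction μ X Y t →
          condMutualInfo μ (seg X 1 t) (Y t)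
              (seg Y 1 (t - 1)) =
            condMutualInfo μ (X t) (est μ X Y t t)
              (fun ω => (seg Y 1 (t - 1) ω, est μ X Y t (t - 1) ω))) ∧
        -- (b): the update identity, and its sufficiency
        est μ X Y t t =ᵐ[μ] kalmanUpdate μ X Y t ∧
        (kalmanUpdate μ X Y t =ᵐ[μ] Y t → EstEqReproduction μ X Y t) ∧
        -- (b): Conditions 1 and 2
        ((∀ᵐ ω ∂μ, IsUnit (condCov μ (sigma Y (t - 1)) (Y t) (Y t) ω)) →
          condCov μ (sigma Y (t - 1)) (X t) (Y t) =ᵐ[μ]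
            condCov μ (sigma Y (t - 1)) (Y t) (Y t) →
          μ[X t | sigma Y (t - 1)] =ᵐ[μ] μ[Y t | sigma Y (t - 1)] →
          est μ X Y t t =ᵐ[μ] kalmanUpdate μ X Y t ∧
            kalmanUpdate μ X Y t =ᵐ[μ] Y t) := by
  exact ⟨exists_gaussian_minimizer hn hXW Δ₁ Δ₂,
    fun H QV V Y hR => hR.properties hn hXW⟩
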